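/- Model of computation: a real RAM with unit-cost operations $+,-,\times,/,\sqrt{\cdot},\lfloor\cdot\rfloor$, integer program constants, comparisons of reals, and arrays with indirect addressing. A program reports a point by its index in the input. For points $a,b,c,p,q,o\in\mathbb R^3$ and $\delta\in\mathbb R$, say that $(p,q,o)$ is *$\delta$-nearly congruent* to $\Delta abc$ if $$\big||pq|-|ab|\big|\le\delta,\qquad \big||po|-|ac|\big|\le\delta,\qquad \big||qo|-|bc|\big|\le\delta .\tag{1}$$ **Theorem.** Let $\beta,s>0$ be constants. There are constants $\alpha,\alpha',C,M$ and a program consisting of two consecutive steps, all depending only on $\beta$ and $s$, such that the following holds. The input is a set $B$ of $n\ge 1$ points in the closed unit ball of $\mathbb R^3$, a reference triangle $\Delta abc$ in $\mathbb R^3$ whose longest edge is $ab$, with $\beta\le|ab|\le 1/2$ and with height from $c$ (perpendicular to $ab$) at least $s$, and an error parameter $0<\varepsilon\le\min\{\beta,s\}$. 1. *(Congruent-sphere step.)* The first step reports pairs $(p,q)\in B^2$. Every pair with $\big||pq|-|ab|\big|\le\varepsilon$ is reported, every reported pair satisfies $\big||pq|-|ab|\big|\le\alpha'\varepsilon$,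 and each pair is reported at most $M$ times. If $N$ denotes the number of distinct reported pairs, this step takes time at most $C\,(n/\varepsilon+N)$. 2. *(Triple step.)* The second step, started in the configuration where the first has halted, reports triples $(p,q,o)\in B^3$. Every triple that is $\varepsilon$-nearly congruent to $\Delta abc$ is reported, every reported triple is $\alpha\varepsilon$-nearly congruent to $\Delta abc$, and each triple is reported at most $M$ times. If $k$ denotes the number of distinct reported triples, this step takes time at most $$C\left(\frac{n+N}{\varepsilon^{1/2}}+\frac{n^{1/3}N^{2/3}}{\varepsilon^{7/6}}+k\right).$$ In particular, all triples of $B^3$ that are $\varepsilon$-nearly congruent to $\Delta abc$ are reported in total time $O\!\left(\frac n\varepsilon+\frac{n+N}{\varepsilon^{1/2}}+\frac{n^{1/3}N^{2/3}}{\varepsilon^{7/6}}+k\right)$. -/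

import Mathlib

namespace RealRAM

/-- Expressions of a real RAM: integer constants, registers, the field operations, square roots,
the floor function, and indirect addressing. `get k e` reads array `k` at address `⌊e⌋`. -/
inductive Expr : Type
  | const (z : ℤ)
  | reg (x : ℕ)
  | add (e f : Expr)
  | sub (e f : Expr)
  | mul (e f : Expr)
  | div (e f : Expr)
  | sqrt (e : Expr)
  | floor (e : Expr)
  | get (k : ℕ) (e : Expr)

/-- Programs of a real RAM. `put k e f` writes the value of `f` into array `k` at address `⌊e⌋`,
`report es` outputs the tuple of values of the expressions `es`, `branch e f c d` runs `c` if
`e < f` and `d` otherwise, `loop e f c` repeats `c` as long as `e < f`. -/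
inductive Cmd : Type
  | skip
  | assign (x : ℕ) (e : Expr)
  | put (k : ℕ) (e f : Expr)
  | report (es : List Expr)
  | seq (c d : Cmd)
  | branch (e f : Expr) (c d : Cmd)
  | loop (e f : Expr) (c : Cmd)

/-- A memory configuration: real registers and real arrays with integer addresses. A program
mentions only finitely many of the registers and arrays. -/
structure State where
  reg : ℕ → ℝ
  mem : ℕ → ℤ → ℝ

/-- The value of an expression (with the conventions `x / 0 = 0` and `√x = 0` for `x < 0`). -/
noncomputable def Expr.eval (σ : State) : Expr → ℝ
  | .const z => (z : ℝ)
  | .reg x => σ.reg x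
  | .add e f => e.eval σ + f.eval σ
  | .sub e f => e.eval σ - f.eval σ
  | .mul e f => e.eval σ * f.eval σ
  | .div e f => e.eval σ / f.eval σ
  | .sqrt e => Real.sqrt (e.eval σ)
  | .floor e => (⌊e.eval σ⌋ : ℝ)
  | .get k e => σ.mem k ⌊e.eval σ⌋

/-- The number of elementary operations performed when an expression is evaluated: every
constant, register access, arithmetic operation and array access takes one unit of time. -/
def Expr.cost : Expr → ℕ
  | .const _ => 1
  | .reg _ => 1
  | .add e f => e.cost + f.cost + 1
  | .sub e f => e.cost + f.cost + 1
  | .mul e f => e.cost + f.cost + 1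
  | .div e f => e.cost + f.cost + 1
  | .sqrt e => e.cost + 1
  | .floor e => e.cost + 1
  | .get _ e => e.cost + 1

/-- The configuration `σ` after `v` has been written into register `x`. -/
def State.setReg (σ : State) (x : ℕ) (v : ℝ) : State where
  reg := fun y => if y = x then v else σ.reg y
  mem := σ.mem

/-- The configuration `σ` after `v` has been written into array `k` at address `i`. -/
def State.setMem (σ : State) (k : ℕ) (i : ℤ) (v : ℝ) : State where
  reg := σ.reg
  mem := fun l j => if l = k ∧ j = i then v else σ.mem l j

/-- `Runs c σ σ' out t`: the program `c`, started in the configuration `σ`, halts in the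
configuration `σ'` after `t` units of time, and `out` is the list of the tuples that it reports,
in the order in which they are reported, with repetitions. -/
inductive Runs : Cmd → State → State → List (List ℝ) → ℕ → Prop
  | skip (σ : State) : Runs .skip σ σ [] 1
  | assign (σ : State) (x : ℕ) (e : Expr) :
      Runs (.assign x e) σ (σ.setReg x (e.eval σ)) [] (e.cost + 1)
  | put (σ : State) (k : ℕ) (e f : Expr) :
      Runs (.put k e f) σ (σ.setMem k ⌊e.eval σ⌋ (f.eval σ)) [] (e.cost + f.cost + 1)
  | report (σ : State) (es : List Expr) :
      Runs (.report es) σ σ [es.map (Expr.eval σ)] ((es.map Expr.cost).sum + 1)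
  | seq {c d : Cmd} {σ σ₁ σ₂ : State} {o₁ o₂ : List (List ℝ)} {t₁ t₂ : ℕ} :
      Runs c σ σ₁ o₁ t₁ → Runs d σ₁ σ₂ o₂ t₂ →
      Runs (.seq c d) σ σ₂ (o₁ ++ o₂) (t₁ + t₂)
  | branch_true {e f : Expr} {c d : Cmd} {σ σ' : State} {o : List (List ℝ)} {t : ℕ} :
      e.eval σ < f.eval σ → Runs c σ σ' o t →
      Runs (.branch e f c d) σ σ' o (e.cost + f.cost + 1 + t)
  | branch_false {e f : Expr} {c d : Cmd} {σ σ' : State} {o : List (List ℝ)} {t : ℕ} :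
      ¬ e.eval σ < f.eval σ → Runs d σ σ' o t →
      Runs (.branch e f c d) σ σ' o (e.cost + f.cost + 1 + t)
  | loop_true {e f : Expr} {c : Cmd} {σ σ₁ σ₂ : State} {o₁ o₂ : List (List ℝ)} {t₁ t₂ : ℕ} :
      e.eval σ < f.eval σ → Runs c σ σ₁ o₁ t₁ → Runs (.loop e f c) σ₁ σ₂ o₂ t₂ →
      Runs (.loop e f c) σ σ₂ (o₁ ++ o₂) (e.cost + f.cost + 1 + t₁ + t₂)
  | loop_false {e f : Expr} {c : Cmd} {σ : State} :
      ¬ e.eval σ < f.eval σ → Runs (.loop e f c) σ σ [] (e.cost + f.cost + 1)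

/-- The array that holds `f 0, …, f (m - 1)` at the addresses `0, …, m - 1` and `0` elsewhere. -/
def arrayOf {m : ℕ} (f : Fin m → ℝ) (i : ℤ) : ℝ :=
  if h : 0 ≤ i ∧ i.toNat < m then f ⟨i.toNat, h.2⟩ else 0

end RealRAM

namespace NearTriangles

/-- Euclidean three-space. -/
abbrev Pt : Type := EuclideanSpace ℝ (Fin 3)

/-- The distance `|pq|` differs from `d` by at most `δ`. -/
def NearDist (d δ : ℝ) (p q : Pt) : Prop :=
  |dist p q - d| ≤ δ

/-- The triple `(p, q, o)` spans a triangle that is congruent to `abc` up to an error `δ` in each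
of the three corresponding side lengths. -/
def NearCongruent (a b c : Pt) (δ : ℝ) (p q o : Pt) : Prop :=
  NearDist (dist a b) δ p q ∧ NearDist (dist a c) δ p o ∧ NearDist (dist b c) δ q o

/-- The triangle `abc` has longest edge `ab`, with `β ≤ |ab| ≤ 1/2`, and the height of the
triangle from `c`, perpendicular to `ab`, is at least `s`. -/
structure IsFat (β s : ℝ) (a b c : Pt) : Prop where
  ac_le : dist a c ≤ dist a b
  bc_le : dist b c ≤ dist a b
  le_ab : β ≤ dist a b
  ab_le : dist a b ≤ 1 / 2
  le_height : s ≤ Metric.infDist c (line[ℝ, a, b] : Set Pt)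

/-- The initial configuration: register `0` holds the number `n` of points, register `1` holds
`ε`, arrays `0`, `1`, `2` hold the three coordinates of the points, and arrays `3`, `4`, `5` hold
the coordinates of `a`, `b`, `c`. All other memory is `0`. -/
noncomputable def input {n : ℕ} (B : Fin n → Pt) (a b c : Pt) (ε : ℝ) : RealRAM.State where
  reg := fun x => match x with
    | 0 => (n : ℝ)
    | 1 => ε
    | _ => 0
  mem := fun k => match k with
    | 0 => RealRAM.arrayOf fun i => B i 0
    | 1 => RealRAM.arrayOf fun i => B i 1
    | 2 => RealRAM.arrayOf fun i => B i 2
    | 3 => RealRAM.arrayOf fun j => a j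
    | 4 => RealRAM.arrayOf fun j => b j
    | 5 => RealRAM.arrayOf fun j => c j
    | _ => fun _ => 0

/-- A pair of points, as it is output by a program: through the indices of the points. -/
def encodePair {n : ℕ} (x : Fin n × Fin n) : List ℝ :=
  [(x.1 : ℝ), (x.2 : ℝ)]

/-- A triple of points, as it is output by a program: through the indices of the points. -/
def encodeTriple {n : ℕ} (x : Fin n × Fin n × Fin n) : List ℝ :=
  [(x.1 : ℝ), (x.2.1 : ℝ), (x.2.2 : ℝ)]

end NearTriangles

/-! Over a window of width `w`, a smooth surface stays within `O(w²)` of its tangent. This turns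
near-incidence with spheres and circles into equality of short integer keys.

Pairs. If `|pq|` is close to `|ab|`, then `q` lies within `O(ε)` of a sphere about `p`. Choose the
axis in which `q - p` is largest and a grid of mesh `√ε` in the plane orthogonal to it. Over one
cell, the sphere has bounded slope and agrees with its tangent plane up to `O(ε)`; rounding the two
slopes to multiples of `√ε` and the offset to multiples of `ε` costs another `O(ε)`. So five
integers (cell, slopes, offset) decide the incidence, up to boundedly many shifts of the offset.
Every point is stored under `O(1/ε)` slope pairs, and every `p` looks up `O(1/ε)` cells.

Triples. Given `(p, q)`, the third point `o` is near the circle in which two spheres intersect. Its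
tangent direction is the cross product of `q - p` and `o - p`, which the height of the triangle
bounds away from `0`; choose the axis of its largest component. In slabs of thickness `δ` with `δ² ≤
ε` the circle agrees with a tangent line up to `O(ε)`, and slopes may be rounded to multiples of `η
= ε / δ`. Storing costs `n / η²` and looking up costs `N / δ`. The choice `(δ, η) = (ε, 1)` gives `n
+ N / ε`, and `(√ε, √ε)` gives `n / ε + N / √ε`. The first is taken if `N √ε < n` (with `N` counted
with repetitions), where the mixed term of the theorem dominates `N / ε`; otherwise `n / ε ≤ N / √ε`
and the second is taken.

If `ε` exceeds a constant, all pairs and all their extensions are reported: any two points of the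
unit ball then satisfy the weakened condition, and the output pays for the time.

Completeness rests on `tangent_plane_of_near_sphere` and `tangent_line_of_near_circle`, soundness on
`abs_normSq_sub_le_of_tangent_plane` and `abs_normSq_sub_le_of_tangent_line`. Since each hit is
sound and found a bounded number of times, listing the hits is paid by the output. A key, read as a
number in base `O(1/ε)`, is itself the array address, and zero-initialised memory represents empty
buckets. Programs are verified with the time-aware triples `Emits`. -/

namespace RealRAM

/-! ### A program logic with output-sensitive time bounds -/

/-- The memory of a configuration. -/
abbrev Memory : Type := ℕ → ℤ → ℝ

/-- The time that a program needs if every command in it is executed once. -/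
def Cmd.size : Cmd → ℕ
  | .skip => 1
  | .assign _ e => e.cost + 1
  | .put _ e f => e.cost + f.cost + 1
  | .report es => (es.map Expr.cost).sum + 1
  | .seq c d => c.size + d.size
  | .branch e f c d => e.cost + f.cost + 1 + c.size + d.size
  | .loop e f c => e.cost + f.cost + 1 + c.size

/-- The first `d` registers of `σ` hold the values given by `ρ`. -/
def Agree (d : ℕ) (ρ : ℕ → ℝ) (σ : State) : Prop :=
  ∀ x < d, σ.reg x = ρ x

theorem agree_succ_update {d : ℕ} {ρ : ℕ → ℝ} {σ : State} {v : ℝ} :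
    Agree (d + 1) (Function.update ρ d v) σ ↔ Agree d ρ σ ∧ σ.reg d = v := by
  constructor
  · intro h
    refine ⟨fun x hx => ?_, ?_⟩
    · rw [h x (by omega), Function.update_of_ne (by omega)]
    · rw [h d (by omega), Function.update_self]
  · rintro ⟨h, h'⟩ x hx
    by_cases hxd : x = d
    · subst hxd; rw [h', Function.update_self]
    · rw [h x (by omega), Function.update_of_ne hxd]

theorem Agree.mono {d e : ℕ} {ρ : ℕ → ℝ} {σ : State} (h : Agree d ρ σ) (hed : e ≤ d) :
    Agree e ρ σ := fun x hx => h x (by omega)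

theorem Agree.setReg {d : ℕ} {ρ : ℕ → ℝ} {σ : State} (h : Agree d ρ σ) {x : ℕ} (hx : d ≤ x)
    (v : ℝ) : Agree d ρ (σ.setReg x v) := by
  intro y hy
  simp only [State.setReg]
  rw [if_neg (by omega)]
  exact h y hy

/-- Started with the first `d` registers as in `ρ` and with memory described by `J l`, the program
`c` leaves these registers unchanged, emits the items `xs`, item `x` being reported as `rep x`,
leaves memory described by `J' (l ++ xs)`, and takes time proportional to `b` plus the number of
items. -/
def Emits {X : Type*} (d : ℕ) (J J' : List X → Memory → Prop) (rep : X → List (List ℝ)) (c : Cmd)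
    (ρ : ℕ → ℝ) (xs : List X) (b : ℕ) : Prop :=
  ∀ l σ, Agree d ρ σ → J l σ.mem → ∃ σ' t, Runs c σ σ' (xs.flatMap rep) t ∧ Agree d ρ σ' ∧
    J' (l ++ xs) σ'.mem ∧ t ≤ c.size * (b + xs.length)

section Rules

variable {X : Type*} {d : ℕ} {J J' J'' : List X → Memory → Prop} {rep : X → List (List ℝ)}
  {ρ : ℕ → ℝ}

theorem Emits.mono {c : Cmd} {xs : List X} {b b' : ℕ} (h : Emits d J J' rep c ρ xs b)
    (hb : b ≤ b') : Emits d J J' rep c ρ xs b' := by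
  intro l σ hσ hJ
  obtain ⟨σ', t, h1, h2, h3, h4⟩ := h l σ hσ hJ
  exact ⟨σ', t, h1, h2, h3, h4.trans (by gcongr)⟩

/-- One `b` serves both commands and their composition, because the bound is multiplied by the
program size and sizes add. -/
theorem Emits.seq {c c' : Cmd} {xs ys : List X} {b : ℕ} (h : Emits d J J' rep c ρ xs b)
    (h' : Emits d J' J'' rep c' ρ ys b) : Emits d J J'' rep (.seq c c') ρ (xs ++ ys) b := by
  intro l σ hσ hJ
  obtain ⟨σ₁, t₁, a1, a2, a3, a4⟩ := h l σ hσ hJ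
  obtain ⟨σ₂, t₂, b1, b2, b3, b4⟩ := h' _ σ₁ a2 a3
  refine ⟨σ₂, t₁ + t₂, ?_, b2, by simpa using b3, ?_⟩
  · rw [List.flatMap_append]; exact .seq a1 b1
  · simp only [Cmd.size, List.length_append]
    nlinarith [Nat.zero_le (c.size * ys.length), Nat.zero_le (c'.size * xs.length)]

/-- The budget `1 ≤ b` pays for the test, which is executed even if nothing is emitted. -/
theorem Emits.branch_pos {e f : Expr} {c c' : Cmd} {xs : List X} {b : ℕ} (hb : 1 ≤ b)
    (h : Emits d J J' rep c ρ xs b)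
    (hlt : ∀ l σ, Agree d ρ σ → J l σ.mem → e.eval σ < f.eval σ) :
    Emits d J J' rep (.branch e f c c') ρ xs b := by
  intro l σ hσ hJ
  obtain ⟨σ₁, t₁, a1, a2, a3, a4⟩ := h l σ hσ hJ
  refine ⟨σ₁, _, .branch_true (hlt l σ hσ hJ) a1, a2, a3, ?_⟩
  simp only [Cmd.size]
  nlinarith [Nat.zero_le (c'.size * (b + xs.length)),
    Nat.mul_le_mul_left (e.cost + f.cost + 1) (show 1 ≤ b + xs.length by omega)]

theorem Emits.branch_neg {e f : Expr} {c c' : Cmd} {xs : List X} {b : ℕ} (hb : 1 ≤ b)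
    (h : Emits d J J' rep c' ρ xs b)
    (hlt : ∀ l σ, Agree d ρ σ → J l σ.mem → ¬ e.eval σ < f.eval σ) :
    Emits d J J' rep (.branch e f c c') ρ xs b := by
  intro l σ hσ hJ
  obtain ⟨σ₁, t₁, a1, a2, a3, a4⟩ := h l σ hσ hJ
  refine ⟨σ₁, _, .branch_false (hlt l σ hσ hJ) a1, a2, a3, ?_⟩
  simp only [Cmd.size]
  nlinarith [Nat.zero_le (c.size * (b + xs.length)),
    Nat.mul_le_mul_left (e.cost + f.cost + 1) (show 1 ≤ b + xs.length by omega)]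

/-- Assignment to the first register that is not protected. -/
theorem Emits.assign_seq {e : Expr} {c : Cmd} {xs : List X} {b : ℕ} {v : ℝ} (hb : 1 ≤ b)
    (h : Emits (d + 1) J J' rep c (Function.update ρ d v) xs b)
    (hv : ∀ l σ, Agree d ρ σ → J l σ.mem → e.eval σ = v) :
    Emits d J J' rep (.seq (.assign d e) c) ρ xs b := by
  intro l σ hσ hJ
  have h0 : Agree (d + 1) (Function.update ρ d v) (σ.setReg d (e.eval σ)) :=
    agree_succ_update.2 ⟨hσ.setReg le_rfl _, by simp [State.setReg, hv l σ hσ hJ]⟩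
  obtain ⟨σ₁, t₁, a1, a2, a3, a4⟩ := h l _ h0 hJ
  refine ⟨σ₁, _, .seq (.assign σ d e) a1, (agree_succ_update.1 a2).1, a3, ?_⟩
  simp only [Cmd.size]
  nlinarith [Nat.mul_le_mul_left (e.cost + 1) (show 1 ≤ b + xs.length by omega)]

/-- Repeat `c` for the values `0, 1, …` of register `x` that are less than `e`. -/
def forC (x : ℕ) (e : Expr) (c : Cmd) : Cmd :=
  .seq (.assign x (.const 0))
    (.loop (.reg x) e (.seq c (.assign x (.add (.reg x) (.const 1)))))

/-- The constant overhead of an iteration is charged to that iteration, so each one must have a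
positive budget or emit something. The second alternative lets a loop over a bucket run with `b =
0`. The summand `1` in `1 + m * b` covers the initialisation and the last, failing test. -/
theorem Emits.forC_range {e : Expr} {c : Cmd} {m : ℕ} {xs : ℕ → List X} {b b' : ℕ}
    (he : ∀ l σ, Agree d ρ σ → J l σ.mem → e.eval σ = m)
    (h : ∀ i < m, Emits (d + 1) J J rep c (Function.update ρ d (i : ℝ)) (xs i) b)
    (hb : 1 + m * b ≤ b') (hpos : ∀ i < m, 1 ≤ b + (xs i).length) :
    Emits d J J rep (RealRAM.forC d e c) ρ ((List.range m).flatMap xs) b' := by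
  -- The loop with `k` rounds left. Besides the body, a round costs `e.cost + 2` for the test and
  -- `4` for the increment; the failing test at the end costs `e.cost + 2`.
  have key : ∀ k i : ℕ, i + k = m → ∀ l σ, Agree d ρ σ → σ.reg d = i → J l σ.mem →
      ∃ σ' t, Runs (.loop (.reg d) e (.seq c (.assign d (.add (.reg d) (.const 1))))) σ σ'
        (((List.range' i k).flatMap xs).flatMap rep) t ∧ Agree d ρ σ' ∧
        J (l ++ (List.range' i k).flatMap xs) σ'.mem ∧
        t ≤ (e.cost + 2) + (e.cost + 6 + c.size) * (k * b + ((List.range' i k).flatMap xs).length) := by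
    intro k
    induction k with
    | zero =>
      intro i hi l σ hσ hd hJ
      refine ⟨σ, _, .loop_false ?_, hσ, by simpa using hJ, ?_⟩
      · rw [he l σ hσ hJ]
        simp only [Expr.eval, hd]
        simp only [not_lt, Nat.cast_le]; omega
      · simp [Expr.cost]; omega
    | succ k ih =>
      intro i hi l σ hσ hd hJ
      obtain ⟨σ₁, t₁, a1, a2, a3, a4⟩ := h i (by omega) l σ (agree_succ_update.2 ⟨hσ, hd⟩) hJ
      rw [agree_succ_update] at a2
      obtain ⟨σ₂, t₂, b1, b2, b3, b4⟩ := ih (i + 1) (by omega) (l ++ xs i)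
        (σ₁.setReg d (Expr.eval σ₁ (.add (.reg d) (.const 1)))) (a2.1.setReg le_rfl _)
        (by simp [State.setReg, Expr.eval, a2.2]) a3
      have hlt : Expr.eval σ (.reg d) < e.eval σ := by
        rw [he l σ hσ hJ]
        simp only [Expr.eval, hd, Nat.cast_lt]; omega
      refine ⟨σ₂, 1 + e.cost + 1 + (t₁ + 4) + t₂, ?_, b2, ?_, ?_⟩
      · have := Runs.loop_true hlt (.seq a1 (.assign _ _ _)) b1
        simpa [List.range'_succ, Expr.cost] using this
      · simpa [List.range'_succ] using b3
      · simp only [List.range'_succ, List.flatMap_cons, List.length_append]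
        have hp := Nat.mul_le_mul_left (e.cost + 6) (hpos i (by omega))
        nlinarith
  intro l σ hσ hJ
  obtain ⟨σ', t, a1, a2, a3, a4⟩ := key m 0 (by omega) l (σ.setReg d 0) (hσ.setReg le_rfl _)
    (by simp [State.setReg]) hJ
  have hr : List.range' 0 m = List.range m := List.range_eq_range'.symm
  rw [hr] at a1 a3 a4
  refine ⟨σ', 2 + t, ?_, a2, a3, ?_⟩
  · have := Runs.seq (Runs.assign σ d (.const 0)) (by simpa [Expr.eval] using a1)
    simpa [Expr.cost, RealRAM.forC] using this
  · simp only [RealRAM.forC, Cmd.size, Expr.cost]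
    set L := ((List.range m).flatMap xs).length
    have h1 : (e.cost + 6 + c.size) * (m * b + L) + (e.cost + 6 + c.size) ≤
        (e.cost + 6 + c.size) * (b' + L) := by
      calc _ = (e.cost + 6 + c.size) * (1 + m * b + L) := by ring
        _ ≤ _ := by gcongr
    have h2 : 1 ≤ b' + L := by omega
    nlinarith [Nat.mul_le_mul_left (e.cost + 2) h2, Nat.zero_le c.size]

theorem Emits.forC {e : Expr} {c : Cmd} {m : ℕ} {xs : Fin m → List X} {b b' : ℕ}
    (he : ∀ l σ, Agree d ρ σ → J l σ.mem → e.eval σ = m)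
    (h : ∀ i : Fin m, Emits (d + 1) J J rep c (Function.update ρ d (i : ℕ)) (xs i) b)
    (hb : 1 + m * b ≤ b') (hpos : ∀ i, 1 ≤ b + (xs i).length) :
    Emits d J J rep (RealRAM.forC d e c) ρ ((List.finRange m).flatMap xs) b' := by
  let xs' : ℕ → List X := fun i => if h : i < m then xs ⟨i, h⟩ else []
  have hx : (List.finRange m).flatMap xs = (List.range m).flatMap xs' := by
    rw [← List.map_coe_finRange_eq_range, List.flatMap_map]
    simp [xs', List.flatMap]
  rw [hx]
  refine Emits.forC_range he (fun i hi => ?_) hb (fun i hi => ?_)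
  · simpa [xs', hi] using h ⟨i, hi⟩
  · simpa [xs', hi] using hpos ⟨i, hi⟩

/-- Run `c` if `g.1 < g.2` for all `g` in a list. -/
def guardC (gs : List (Expr × Expr)) (c : Cmd) : Cmd :=
  gs.foldr (fun g c' => .branch g.1 g.2 c' .skip) c

-- Only the conjunction of the guards is tied to `P`: if `P` fails, which guard fails may depend on
-- the configuration.
open Classical in
theorem Emits.guardC {gs : List (Expr × Expr)} {c : Cmd} {xs : List X} {b : ℕ} {P : Prop}
    (hb : 1 ≤ b) (h : P → Emits d J J rep c ρ xs b)
    (hP : ∀ l σ, Agree d ρ σ → J l σ.mem → ((∀ g ∈ gs, g.1.eval σ < g.2.eval σ) ↔ P)) :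
    Emits d J J rep (RealRAM.guardC gs c) ρ (if P then xs else []) b := by
  induction gs generalizing P with
  | nil =>
    intro l σ hσ hJ
    have : P := (hP l σ hσ hJ).1 (by simp)
    rw [if_pos this]
    exact h this l σ hσ hJ
  | cons g gs ih =>
    intro l σ hσ hJ
    have h0 := hP l σ hσ hJ
    by_cases hP' : P
    · simp only [if_pos hP'] at *
      refine Emits.branch_pos hb ?_ (fun l σ h1 h2 => ((hP l σ h1 h2).2 hP') g (by simp)) l σ hσ hJ
      have := ih (P := True) (fun _ => h hP')
        (fun l σ h1 h2 => by
          simpa using fun e f hg => ((hP l σ h1 h2).2 hP') (e, f) (by simp [hg]))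
      simpa [RealRAM.guardC] using this
    · simp only [if_neg hP'] at *
      by_cases hg : g.1.eval σ < g.2.eval σ
      -- Induction up to the first failing guard, where the run ends in `skip`.
      · have key : ∀ gs' : List (Expr × Expr), (∃ g ∈ gs', ¬ g.1.eval σ < g.2.eval σ) →
            ∃ t, Runs (RealRAM.guardC gs' c) σ σ [] t ∧ t ≤ (RealRAM.guardC gs' c).size := by
          intro gs'
          induction gs' with
          | nil => simp
          | cons g' gs' ih' =>
            intro hex
            by_cases hg' : g'.1.eval σ < g'.2.eval σ
            · obtain ⟨t, ht, ht'⟩ := ih' (by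
                obtain ⟨x, hx, hx'⟩ := hex
                rcases List.mem_cons.1 hx with rfl | hx
                · exact absurd hg' hx'
                · exact ⟨x, hx, hx'⟩)
              exact ⟨_, .branch_true hg' ht, by
                simp only [RealRAM.guardC, List.foldr_cons, Cmd.size] at ht' ⊢; omega⟩
            · exact ⟨_, .branch_false hg' (.skip σ), by
                simp only [RealRAM.guardC, List.foldr_cons, Cmd.size]; omega⟩
        obtain ⟨t, ht, ht'⟩ := key (g :: gs) (by
          by_contra hcon
          push Not at hcon
          exact hP' (h0.1 hcon))
        refine ⟨σ, t, ht, hσ, by simpa using hJ, ht'.trans ?_⟩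
        simp only [List.length_nil, add_zero]
        exact Nat.le_mul_of_pos_right _ hb
      · refine ⟨σ, _, .branch_false hg (.skip σ), hσ, by simpa using hJ, ?_⟩
        simp only [RealRAM.guardC, List.foldr_cons, Cmd.size, List.length_nil, add_zero]
        refine le_trans ?_ (Nat.le_mul_of_pos_right _ hb)
        omega

end Rules

end RealRAM

/-! ### Buckets addressed by positional keys -/

namespace RealRAM

/-- The integer with digits `l`, the least significant one first, in base `R`. -/
def horner (R : ℤ) (l : List ℤ) : ℤ := l.foldr (fun d x => d + R * x) 0

/-- The expression for `horner`. -/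
def hornerE (R : Expr) (l : List Expr) : Expr := l.foldr (fun d x => .add d (.mul R x)) (.const 0)

theorem eval_hornerE {σ : State} {R : ℤ} {RE : Expr} (hR : RE.eval σ = R) :
    ∀ {es : List Expr} {κ : List ℤ}, es.map (Expr.eval σ) = κ.map (fun z : ℤ => (z : ℝ)) →
    (hornerE RE es).eval σ = horner R κ := by
  intro es
  induction es with
  | nil =>
    intro κ h
    cases κ with
    | nil => simp [hornerE, horner, Expr.eval]
    | cons => simp at h
  | cons e es ih =>
    intro κ h
    cases κ with
    | nil => simp at h
    | cons d κ =>
      simp only [List.map_cons, List.cons.injEq] at h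
      have := ih h.2
      simp only [hornerE, horner, List.foldr_cons, Expr.eval, hR, h.1] at this ⊢
      rw [this]; push_cast; rfl

/-- Digits come from a symmetric range of fewer than `R + 1` integers, so two of them that agree
modulo `R` are equal. -/
theorem eq_of_add_mul_eq {R d d' x x' : ℤ} (hd : 2 * |d| + 1 ≤ R) (hd' : 2 * |d'| + 1 ≤ R)
    (h : d + R * x = d' + R * x') : d = d' ∧ x = x' := by
  have h1 : d - d' = R * (x' - x) := by linarith
  have h2 : |d - d'| < R := by
    have := abs_sub d d'
    omega
  have h3 : d - d' = 0 := Int.eq_zero_of_abs_lt_dvd ⟨_, h1⟩ h2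
  refine ⟨by omega, ?_⟩
  rw [h3] at h1
  have hR : R ≠ 0 := by have := abs_nonneg d; omega
  rcases mul_eq_zero.1 h1.symm with h | h
  · exact absurd h hR
  · omega

/-- Keys are lists of five digits that are small compared to the base `R`. -/
def ValidKey (R : ℤ) (κ : List ℤ) : Prop := κ.length = 5 ∧ ∀ d ∈ κ, 2 * |d| + 1 ≤ R

/-- The last digit is unrestricted: it is the most significant one and is what remains once the
others are split off. It will be the position of an item in its bucket, for which no bound is then
needed. -/
theorem horner_append_inj {R : ℤ} : ∀ {κ κ' : List ℤ}, κ.length = κ'.length →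
    (∀ d ∈ κ, 2 * |d| + 1 ≤ R) → (∀ d ∈ κ', 2 * |d| + 1 ≤ R) → ∀ {i i' : ℤ}, 0 < R →
    horner R (κ ++ [i]) = horner R (κ' ++ [i']) → κ = κ' ∧ i = i' := by
  intro κ
  induction κ with
  | nil =>
    intro κ' hl _ _ i i' hR h
    obtain rfl : κ' = [] := List.eq_nil_of_length_eq_zero hl.symm
    simpa [horner] using h
  | cons d κ ih =>
    intro κ' hl h1 h2 i i' hR h
    cases κ' with
    | nil => simp at hl
    | cons d' κ' =>
      simp only [List.cons_append, horner, List.foldr_cons] at h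
      obtain ⟨e1, e2⟩ := eq_of_add_mul_eq (h1 d (by simp)) (h2 d' (by simp)) h
      obtain ⟨e3, e4⟩ := ih (by simpa using hl) (fun x hx => h1 x (by simp [hx]))
        (fun x hx => h2 x (by simp [hx])) hR e2
      exact ⟨by rw [e1, e3], e4⟩

theorem ValidKey.pos {R : ℤ} {κ : List ℤ} (h : ValidKey R κ) : 0 < R := by
  obtain ⟨h1, h2⟩ := h
  cases κ with
  | nil => simp at h1
  | cons d κ =>
    have := h2 d (by simp)
    have := abs_nonneg d
    omega

theorem ValidKey.append_inj {R : ℤ} {κ κ' : List ℤ} (h : ValidKey R κ) (h' : ValidKey R κ')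
    {i i' : ℤ} (he : horner R (κ ++ [i]) = horner R (κ' ++ [i'])) : κ = κ' ∧ i = i' :=
  horner_append_inj (h.1.trans h'.1.symm) h.2 h'.2 h.pos he

theorem horner_append_zero (R : ℤ) (κ : List ℤ) : horner R (κ ++ [0]) = horner R κ := by
  simp [horner]

theorem ValidKey.inj {R : ℤ} {κ κ' : List ℤ} (h : ValidKey R κ) (h' : ValidKey R κ')
    (he : horner R κ = horner R κ') : κ = κ' := by
  rw [← horner_append_zero R κ, ← horner_append_zero R κ'] at he
  exact (h.append_inj h' he).1

/-- The items that a list of pairs associates with a key. -/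
def bucket {ι : Type*} (ops : List (List ℤ × ι)) (κ : List ℤ) : List ι :=
  (ops.filter fun x => x.1 = κ).map Prod.snd

theorem mem_bucket {ι : Type*} {ops : List (List ℤ × ι)} {κ : List ℤ} {o : ι} :
    o ∈ bucket ops κ ↔ (κ, o) ∈ ops := by
  simp [bucket]

theorem bucket_append {ι : Type*} (ops : List (List ℤ × ι)) (κ κ' : List ℤ) (o : ι) :
    bucket (ops ++ [(κ, o)]) κ' = if κ = κ' then bucket ops κ' ++ [o] else bucket ops κ' := by
  by_cases h : κ = κ' <;> simp [bucket, h]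

theorem nodup_bucket {ι : Type*} {ops : List (List ℤ × ι)} (h : ops.Nodup) (κ : List ℤ) :
    (bucket ops κ).Nodup := by
  refine List.Nodup.map_on ?_ (h.filter _)
  intro x hx y hy hxy
  simp only [List.mem_filter, decide_eq_true_eq] at hx hy
  exact Prod.ext (hx.2.trans hy.2.symm) hxy

/-- The arrays `A` and `A + 1` store the buckets of `ops`: the first one their lengths and the
second one their items. -/
structure Stores {ι : Type*} (R : ℤ) (A : ℕ) (val : ι → ℝ) (ops : List (List ℤ × ι))
    (M : Memory) : Prop where
  length_eq : ∀ κ, ValidKey R κ → M A (horner R κ) = (bucket ops κ).length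
  item_eq : ∀ κ, ValidKey R κ → ∀ (i : ℕ) (h : i < (bucket ops κ).length),
    M (A + 1) (horner R (κ ++ [(i : ℤ)])) = val (bucket ops κ)[i]

/-- Untouched memory already represents empty buckets, so no time is spent on initialising the large
address range. -/
theorem Stores.nil {ι : Type*} {R : ℤ} {A : ℕ} {val : ι → ℝ} {M : Memory}
    (h : ∀ z, M A z = 0) : Stores R A val [] M where
  length_eq κ _ := by simp [h, bucket]
  item_eq κ _ i h := by simp [bucket] at h

/-- Addresses of valid keys are distinct, so the two writes affect the bucket of `κ` only. Invalid
keys may collide; nothing is claimed about them. -/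
theorem Stores.push {ι : Type*} {R : ℤ} {A : ℕ} {val : ι → ℝ} {ops : List (List ℤ × ι)}
    {M M' : Memory} (h : Stores R A val ops M) {κ : List ℤ} (hκ : ValidKey R κ) (o : ι)
    (h1 : ∀ j, M' A j = if j = horner R κ then ((bucket ops κ).length + 1 : ℝ) else M A j)
    (h2 : ∀ j, M' (A + 1) j = if j = horner R (κ ++ [((bucket ops κ).length : ℤ)]) then val o
      else M (A + 1) j) : Stores R A val (ops ++ [(κ, o)]) M' where
  length_eq κ' hκ' := by
    rw [h1, bucket_append]
    by_cases hk : κ = κ'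
    · subst hk; simp
    · rw [if_neg (fun he => hk (hκ'.inj hκ he).symm), if_neg hk, h.length_eq κ' hκ']
  item_eq κ' hκ' i hi := by
    rw [h2]
    simp only [bucket_append] at hi ⊢
    by_cases hk : κ = κ'
    · subst hk
      simp only [if_true] at hi ⊢
      by_cases hl : i = (bucket ops κ).length
      · subst hl; simp
      · have hi' : i < (bucket ops κ).length := by simp at hi; omega
        rw [if_neg (fun he => hl (by exact_mod_cast (hκ.append_inj hκ he).2)),
          h.item_eq κ hκ i hi', List.getElem_append_left hi']
    · simp only [if_neg hk] at hi ⊢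
      rw [if_neg (fun he => hk (hκ'.append_inj hκ he).1.symm), h.item_eq κ' hκ' i hi]

/-- Append the value of `v` to the bucket with key `κ` of the structure stored in the arrays `A`
and `A + 1`. -/
def pushC (A : ℕ) (R : Expr) (κ : List Expr) (v : Expr) : Cmd :=
  .seq (.put (A + 1) (hornerE R (κ ++ [.get A (hornerE R κ)])) v)
    (.put A (hornerE R κ) (.add (.get A (hornerE R κ)) (.const 1)))

/-- The arrays other than `A` and `A + 1` are those of `M₀`, and `A`, `A + 1` store `ops`. -/
def Inserting {ι : Type*} (R : ℤ) (A : ℕ) (val : ι → ℝ) (M₀ : Memory)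
    (ops : List (List ℤ × ι)) (M : Memory) : Prop :=
  (∀ k, k ≠ A → k ≠ A + 1 → M k = M₀ k) ∧ Stores R A val ops M

/-- The item is written before the length is increased, so the old length serves as its position.
The key depends on arrays below `20` only and hence has the same value in both writes. -/
theorem emits_pushC {ι : Type*} {d : ℕ} {ρ : ℕ → ℝ} {R : ℤ} {A : ℕ} (hA : 20 ≤ A) {val : ι → ℝ}
    {M₀ : Memory} {RE v : Expr} {es : List Expr} {κ : List ℤ} {o : ι} (hκ : ValidKey R κ)
    (h : ∀ σ, Agree d ρ σ → (∀ k < 20, σ.mem k = M₀ k) → RE.eval σ = R ∧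
      es.map (Expr.eval σ) = κ.map (fun z : ℤ => (z : ℝ)) ∧ v.eval σ = val o) :
    Emits d (Inserting R A val M₀) (Inserting R A val M₀) (fun _ => []) (pushC A RE es v) ρ
      [(κ, o)] 0 := by
  rintro ops σ hσ ⟨hJ, hS⟩
  obtain ⟨g1, g2, g3⟩ := h σ hσ (fun k hk => hJ k (by omega) (by omega))
  have gk := eval_hornerE g1 g2
  have gl : (Expr.get A (hornerE RE es)).eval σ = ((bucket ops κ).length : ℤ) := by
    simp only [Expr.eval, gk, Int.floor_intCast, hS.length_eq κ hκ]
    norm_cast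
  have ga : (hornerE RE (es ++ [.get A (hornerE RE es)])).eval σ =
      horner R (κ ++ [((bucket ops κ).length : ℤ)]) := by
    refine eval_hornerE g1 ?_
    rw [List.map_append, List.map_append, g2, List.map_singleton, List.map_singleton, gl]
  set σ₁ := σ.setMem (A + 1) ⌊(hornerE RE (es ++ [.get A (hornerE RE es)])).eval σ⌋ (v.eval σ)
    with hσ₁
  have hm1 : ∀ k, k ≠ A + 1 → σ₁.mem k = σ.mem k := by
    intro k hk; funext j; simp [hσ₁, State.setMem, hk]
  obtain ⟨g1', g2', -⟩ := h σ₁ hσ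
    (fun k hk => by rw [hm1 k (by omega)]; exact hJ k (by omega) (by omega))
  have gk' := eval_hornerE g1' g2'
  have gl' : (Expr.get A (hornerE RE es)).eval σ₁ = (bucket ops κ).length := by
    simp only [Expr.eval, gk', Int.floor_intCast, hm1 A (by omega), hS.length_eq κ hκ]
  refine ⟨_, _, .seq (.put σ _ _ _) (.put σ₁ _ _ _), hσ, ⟨?_, ?_⟩, ?_⟩
  · intro k h1 h2
    rw [← hJ k h1 h2, ← hm1 k h2]
    funext j; simp [State.setMem, h1]
  · refine hS.push hκ o (fun j => ?_) (fun j => ?_)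
    · simp only [State.setMem, gk', Int.floor_intCast, true_and, Expr.eval] at gl' ⊢
      rw [gl', hm1 A (by omega)]; simp
    · simp [State.setMem, hσ₁, ga, g3]
  · simp [Cmd.size, pushC]

/-- Store, in the arrays `A` and `A + 1`, every number less than register `0` under all keys that
arise from two more numbers less than `W`. -/
def insertC (A : ℕ) (R W : Expr) (κ : List Expr) : Cmd :=
  forC 3 (.reg 0) (forC 4 W (forC 5 W (pushC A R κ (.reg 3))))

/-- The pairs of a key and an item that `insertC` stores. -/
def insertions (n W : ℕ) (key : Fin n → Fin W → Fin W → List ℤ) : List (List ℤ × Fin n) :=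
  (List.finRange n).flatMap fun o => (List.finRange W).flatMap fun j =>
    (List.finRange W).flatMap fun k => [(key o j k, o)]

theorem mem_insertions {n W : ℕ} {key : Fin n → Fin W → Fin W → List ℤ} {κ : List ℤ} {o : Fin n} :
    (κ, o) ∈ insertions n W key ↔ ∃ j k, key o j k = κ := by
  simp only [insertions, List.mem_flatMap, List.mem_finRange, true_and, List.mem_singleton,
    Prod.mk.injEq]
  constructor
  · rintro ⟨o', j, k, h, rfl⟩; exact ⟨j, k, h.symm⟩
  · rintro ⟨j, k, h⟩; exact ⟨o, j, k, h.symm, rfl⟩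

theorem length_insertions {n W : ℕ} (key : Fin n → Fin W → Fin W → List ℤ) :
    (insertions n W key).length = n * (W * W) := by
  simp [insertions, List.length_flatMap]

/-- If the key of an item determines the two loop indices, no item occurs twice in a bucket. This is
one ingredient of the bounded multiplicity of the reports. -/
theorem nodup_insertions {n W : ℕ} {key : Fin n → Fin W → Fin W → List ℤ}
    (h : ∀ o j k j' k', key o j k = key o j' k' → j = j' ∧ k = k') :
    (insertions n W key).Nodup := by
  have aux : ∀ {m : ℕ} {Y : Type} (f : Fin m → List Y), (∀ i, (f i).Nodup) →
      (∀ i j x, x ∈ f i → x ∈ f j → i = j) → ((List.finRange m).flatMap f).Nodup := by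
    intro m Y f h1 h2
    rw [List.nodup_flatMap]
    refine ⟨fun i _ => h1 i, (List.nodup_finRange m).imp ?_⟩
    intro i j hij x hi hj
    exact hij (h2 i j x hi hj)
  refine aux _ (fun o => aux _ (fun j => aux _ (fun k => by simp) ?_) ?_) ?_
  · intro k k' x hk hk'
    simp only [List.mem_singleton] at hk hk'
    rw [hk] at hk'
    exact (h o j k j k' (Prod.ext_iff.1 hk').1).2
  · intro j j' x hj hj'
    simp only [List.mem_flatMap, List.mem_finRange, true_and, List.mem_singleton] at hj hj'
    obtain ⟨k, rfl⟩ := hj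
    obtain ⟨k', hk'⟩ := hj'
    exact (h o j k j' k' (Prod.ext_iff.1 hk').1).1
  · intro o o' x ho ho'
    simp only [List.mem_flatMap, List.mem_finRange, true_and, List.mem_singleton] at ho ho'
    obtain ⟨j, k, rfl⟩ := ho
    obtain ⟨j', k', hk'⟩ := ho'
    exact (Prod.ext_iff.1 hk').2

/-- Every stored copy counts as an emitted item with empty report. The copies thus enter the time
through the length of the list, and the budget only covers the loops around them. -/
theorem emits_insertC {n W : ℕ} {ρ : ℕ → ℝ} {R : ℤ} {A : ℕ} (hA : 20 ≤ A) {M₀ : Memory}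
    {RE WE : Expr} {es : List Expr} {key : Fin n → Fin W → Fin W → List ℤ} (hn : ρ 0 = n)
    (hW : ∀ σ, Agree 3 ρ σ → (∀ k < 20, σ.mem k = M₀ k) → WE.eval σ = W)
    (hR : ∀ σ, Agree 3 ρ σ → (∀ k < 20, σ.mem k = M₀ k) → RE.eval σ = R)
    (hv : ∀ o j k, ValidKey R (key o j k))
    (hkey : ∀ (o : Fin n) (j k : Fin W) σ, Agree 3 ρ σ → (∀ k < 20, σ.mem k = M₀ k) →
      σ.reg 3 = (o : ℕ) → σ.reg 4 = (j : ℕ) → σ.reg 5 = (k : ℕ) →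
      es.map (Expr.eval σ) = (key o j k).map (fun z : ℤ => (z : ℝ))) :
    Emits 3 (Inserting R A (fun o : Fin n => (o : ℝ)) M₀)
      (Inserting R A (fun o : Fin n => (o : ℝ)) M₀) (fun _ => []) (insertC A RE WE es) ρ
      (insertions n W key) (1 + n * (1 + W * 1)) := by
  have hlow : ∀ {l : List (List ℤ × Fin n)} {M : Memory},
      Inserting R A (fun o : Fin n => (o : ℝ)) M₀ l M → ∀ k < 20, M k = M₀ k :=
    fun h k hk => h.1 k (by omega) (by omega)
  refine Emits.forC (m := n) (b := 1 + W * 1) (fun l σ h1 h2 => ?_) (fun o => ?_) le_rfl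
    (fun _ => by omega)
  · simp only [Expr.eval]; rw [h1 0 (by norm_num), hn]
  refine Emits.forC (m := W) (b := 1) (fun l σ h1 h2 => ?_) (fun j => ?_) le_rfl (fun _ => by omega)
  · exact hW σ (h1.mono (by norm_num) |> agree_succ_update.1 |>.1) (hlow h2)
  refine Emits.forC (m := W) (b := 0) (fun l σ h1 h2 => ?_) (fun k => ?_) (by omega)
    (fun _ => by simp)
  · exact hW σ ((agree_succ_update.1 (agree_succ_update.1 h1).1).1) (hlow h2)
  refine emits_pushC hA (hv o j k) (fun σ h1 h2 => ?_)
  obtain ⟨⟨⟨h3, e3⟩, e4⟩, e5⟩ := (agree_succ_update.1 h1).imp_left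
    fun h => (agree_succ_update.1 h).imp_left agree_succ_update.1
  exact ⟨hR σ h3 h2, hkey o j k σ h3 h2 e3 e4 e5, e3⟩

/-- The conjunction of `L l M`, for the arrays below `20`, with the fact that the other arrays are
those of `M₀`. -/
def Upper {X : Type*} (L : List X → Memory → Prop) (M₀ : Memory) (l : List X) (M : Memory) :
    Prop :=
  L l M ∧ ∀ k, 20 ≤ k → M k = M₀ k

/-- Five nested loops, with the counters in the registers `3, …, 7`. In the innermost one, if the
guards `gs` hold, the command `c` is run for every item, in expression `item`, of a bucket. -/
def queryC (A : ℕ) (R e₀ e₁ e₂ e₃ e₄ : Expr) (gs : List (Expr × Expr)) (κ : List Expr)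
    (c : Expr → Cmd) : Cmd :=
  forC 3 e₀ (forC 4 e₁ (forC 5 e₂ (forC 6 e₃ (forC 7 e₄ (guardC gs
    (forC 8 (.get A (hornerE R κ)) (c (.get (A + 1) (hornerE R (κ ++ [.reg 8]))))))))))

open Classical in
/-- The items emitted by `queryC`. -/
noncomputable def answers {X : Type*} {n B₀ B₁ B₂ B₃ B₄ : ℕ} (ops : List (List ℤ × Fin n))
    (P : Fin B₀ → Fin B₁ → Fin B₂ → Fin B₃ → Fin B₄ → Prop)
    (key : Fin B₀ → Fin B₁ → Fin B₂ → Fin B₃ → Fin B₄ → List ℤ) (f : Fin B₀ → Fin n → X) : List X :=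
  (List.finRange B₀).flatMap fun a => (List.finRange B₁).flatMap fun b =>
    (List.finRange B₂).flatMap fun c => (List.finRange B₃).flatMap fun d =>
      (List.finRange B₄).flatMap fun e =>
        if P a b c d e then (bucket ops (key a b c d e)).map (f a) else []

/-- The explicit product pays for the five outer loops and the guards. The loop over a bucket needs
no budget of its own, since each of its iterations emits an item. -/
theorem emits_queryC {X : Type*} {n B₀ B₁ B₂ B₃ B₄ : ℕ} {L : List X → Memory → Prop}
    {rep : X → List (List ℝ)} {ρ : ℕ → ℝ} {R : ℤ} {A : ℕ} (hA : 20 ≤ A) {M₀ : Memory}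
    {ops : List (List ℤ × Fin n)} (hS : Stores R A (fun o : Fin n => (o : ℝ)) ops M₀)
    {RE e₀ e₁ e₂ e₃ e₄ : Expr} {gs : List (Expr × Expr)} {es : List Expr} {c : Expr → Cmd}
    {P : Fin B₀ → Fin B₁ → Fin B₂ → Fin B₃ → Fin B₄ → Prop}
    {key : Fin B₀ → Fin B₁ → Fin B₂ → Fin B₃ → Fin B₄ → List ℤ} {f : Fin B₀ → Fin n → X}
    (hB : ∀ l σ, Agree 3 ρ σ → L l σ.mem → e₀.eval σ = B₀ ∧ e₁.eval σ = B₁ ∧ e₂.eval σ = B₂ ∧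
      e₃.eval σ = B₃ ∧ e₄.eval σ = B₄ ∧ RE.eval σ = R)
    (hP : ∀ (a : Fin B₀) (b : Fin B₁) (c : Fin B₂) (d : Fin B₃) (e : Fin B₄) l σ, Agree 3 ρ σ →
      L l σ.mem → σ.reg 3 = (a : ℕ) → σ.reg 4 = (b : ℕ) → σ.reg 5 = (c : ℕ) → σ.reg 6 = (d : ℕ) →
      σ.reg 7 = (e : ℕ) → ((∀ g ∈ gs, g.1.eval σ < g.2.eval σ) ↔ P a b c d e))
    (hv : ∀ a b c d e, P a b c d e → ValidKey R (key a b c d e))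
    (hkey : ∀ (a : Fin B₀) (b : Fin B₁) (c : Fin B₂) (d : Fin B₃) (e : Fin B₄) l σ, Agree 3 ρ σ →
      L l σ.mem → σ.reg 3 = (a : ℕ) → σ.reg 4 = (b : ℕ) → σ.reg 5 = (c : ℕ) → σ.reg 6 = (d : ℕ) →
      σ.reg 7 = (e : ℕ) → P a b c d e →
      es.map (Expr.eval σ) = (key a b c d e).map (fun z : ℤ => (z : ℝ)))
    (hc : ∀ (a : Fin B₀) (o : Fin n) (ρ' : ℕ → ℝ) (item : Expr), ρ' 3 = (a : ℕ) →
      (∀ l σ, Agree 9 ρ' σ → Upper L M₀ l σ.mem → item.eval σ = (o : ℕ)) →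
      Emits 9 (Upper L M₀) (Upper L M₀) rep (c item) ρ' [f a o] 0) :
    Emits 3 (Upper L M₀) (Upper L M₀) rep (queryC A RE e₀ e₁ e₂ e₃ e₄ gs es c) ρ
      (answers ops P key f)
      (1 + B₀ * (1 + B₁ * (1 + B₂ * (1 + B₃ * (1 + B₄ * 1))))) := by
  refine Emits.forC (m := B₀) (fun l σ h1 h2 => (hB l σ h1 h2.1).1) (fun i₀ => ?_) le_rfl
    (fun _ => by omega)
  refine Emits.forC (m := B₁) (fun l σ h1 h2 => ?_) (fun i₁ => ?_) le_rfl (fun _ => by omega)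
  · exact (hB l σ (agree_succ_update.1 h1).1 h2.1).2.1
  refine Emits.forC (m := B₂) (fun l σ h1 h2 => ?_) (fun i₂ => ?_) le_rfl (fun _ => by omega)
  · exact (hB l σ (agree_succ_update.1 (agree_succ_update.1 h1).1).1 h2.1).2.2.1
  refine Emits.forC (m := B₃) (fun l σ h1 h2 => ?_) (fun i₃ => ?_) le_rfl (fun _ => by omega)
  · exact (hB l σ (agree_succ_update.1 (agree_succ_update.1 (agree_succ_update.1 h1).1).1).1
      h2.1).2.2.2.1
  refine Emits.forC (m := B₄) (fun l σ h1 h2 => ?_) (fun i₄ => ?_) le_rfl (fun _ => by omega)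
  · exact (hB l σ (agree_succ_update.1 (agree_succ_update.1 (agree_succ_update.1
      (agree_succ_update.1 h1).1).1).1).1 h2.1).2.2.2.2.1
  set ρ' := Function.update (Function.update (Function.update (Function.update
    (Function.update ρ 3 ((i₀ : ℕ) : ℝ)) (3 + 1) ((i₁ : ℕ) : ℝ)) (3 + 1 + 1) ((i₂ : ℕ) : ℝ))
    (3 + 1 + 1 + 1) ((i₃ : ℕ) : ℝ)) (3 + 1 + 1 + 1 + 1) ((i₄ : ℕ) : ℝ) with hρ'
  have hag : ∀ {σ}, Agree 8 ρ' σ → Agree 3 ρ σ ∧ σ.reg 3 = (i₀ : ℕ) ∧ σ.reg 4 = (i₁ : ℕ) ∧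
      σ.reg 5 = (i₂ : ℕ) ∧ σ.reg 6 = (i₃ : ℕ) ∧ σ.reg 7 = (i₄ : ℕ) := by
    intro σ h
    obtain ⟨h, e7⟩ := agree_succ_update.1 h
    obtain ⟨h, e6⟩ := agree_succ_update.1 h
    obtain ⟨h, e5⟩ := agree_succ_update.1 h
    obtain ⟨h, e4⟩ := agree_succ_update.1 h
    obtain ⟨h, e3⟩ := agree_succ_update.1 h
    exact ⟨h, e3, e4, e5, e6, e7⟩
  refine Emits.guardC le_rfl (fun hp => ?_) (fun l σ h1 h2 => ?_)
  · have hκ := hv _ _ _ _ _ hp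
    set κ := key i₀ i₁ i₂ i₃ i₄ with hκdef
    -- The bucket is listed by positions, which is the form that a counting loop produces.
    have hmap : (bucket ops κ).map (f i₀) =
        (List.finRange (bucket ops κ).length).flatMap fun i => [f i₀ (bucket ops κ)[i]] := by
      rw [← List.map_eq_flatMap]
      conv_lhs => rw [← List.map_getElem_finRange (bucket ops κ)]
      rw [List.map_map]; rfl
    have heval : ∀ l σ, Agree 8 ρ' σ → Upper L M₀ l σ.mem → RE.eval σ = R ∧
        es.map (Expr.eval σ) = κ.map (fun z : ℤ => (z : ℝ)) := by
      intro l σ h1 h2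
      obtain ⟨h, e3, e4, e5, e6, e7⟩ := hag h1
      exact ⟨(hB l σ h h2.1).2.2.2.2.2, hkey _ _ _ _ _ l σ h h2.1 e3 e4 e5 e6 e7 hp⟩
    rw [hmap]
    refine Emits.forC (b := 0) (fun l σ h1 h2 => ?_) (fun i => ?_) (by omega) (fun _ => by simp)
    · obtain ⟨g1, g2⟩ := heval l σ h1 h2
      simp only [Expr.eval, eval_hornerE g1 g2, Int.floor_intCast]
      rw [h2.2 A hA, hS.length_eq κ hκ]
    · refine hc _ _ _ _ (by simp [hρ']) (fun l σ h1 h2 => ?_)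
      obtain ⟨h1, e8⟩ := agree_succ_update.1 h1
      obtain ⟨g1, g2⟩ := heval l σ h1 h2
      have g3 : (hornerE RE (es ++ [.reg 8])).eval σ = horner R (κ ++ [((i : ℕ) : ℤ)]) := by
        refine eval_hornerE g1 ?_
        simp only [List.map_append, g2, List.map_cons, List.map_nil, Expr.eval]
        rw [e8]; simp
      simp only [Expr.eval, g3, Int.floor_intCast]
      rw [h2.2 (A + 1) (by omega), hS.item_eq κ hκ i i.2]
      rfl
  · obtain ⟨h, e3, e4, e5, e6, e7⟩ := hag h1
    exact hP _ _ _ _ _ l σ h h2.1 e3 e4 e5 e6 e7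

/-- The conjunction of `L l M`, for the arrays below `20`, with the fact that the arrays from `A`
on are empty. -/
def Fresh {X : Type*} (L : List X → Memory → Prop) (A : ℕ) (l : List X) (M : Memory) : Prop :=
  L l M ∧ ∀ k, A ≤ k → ∀ z, M k z = 0

/-- Whether `L l M` holds only depends on the arrays of `M` below `20`. -/
def IsLocal {X : Type*} (L : List X → Memory → Prop) : Prop :=
  ∀ l M M', (∀ k < 20, M k = M' k) → L l M → L l M'

/-- A phase that builds buckets and then queries them. -/
theorem emits_insert_query {X : Type*} {n : ℕ} {L : List X → Memory → Prop} (hL : IsLocal L)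
    {rep : X → List (List ℝ)} {ρ : ℕ → ℝ} {R : ℤ} {A : ℕ} (hA : 20 ≤ A) {c c' : Cmd}
    {ops : List (List ℤ × Fin n)} {xs : List X} {b : ℕ}
    (h : ∀ l M₀, L l M₀ → Emits 3 (Inserting R A (fun o : Fin n => (o : ℝ)) M₀)
      (Inserting R A (fun o : Fin n => (o : ℝ)) M₀) (fun _ => []) c ρ ops b)
    (h' : ∀ M₀, Stores R A (fun o : Fin n => (o : ℝ)) ops M₀ →
      Emits 3 (Upper L M₀) (Upper L M₀) rep c' ρ xs b) :
    Emits 3 (Fresh L A) (Fresh L (A + 2)) rep (.seq c c') ρ xs (b + ops.length) := by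
  rintro l σ hσ ⟨hJ, hz⟩
  obtain ⟨σ₁, t₁, a1, a2, ⟨a3, a4⟩, a5⟩ := h l σ.mem hJ [] σ hσ
    ⟨fun _ _ _ => rfl, Stores.nil (hz A le_rfl)⟩
  simp only [List.nil_append] at a4
  obtain ⟨σ₂, t₂, b1, b2, ⟨b3, b4⟩, b5⟩ := h' σ₁.mem a4 l σ₁ a2
    ⟨hL l σ.mem σ₁.mem (fun k hk => (a3 k (by omega) (by omega)).symm) hJ, fun _ _ => rfl⟩
  -- Insertions are items for the time accounting only; they leave no trace in the output. Their
  -- number moves into the budget of the phase.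
  have hnil : ops.flatMap (fun _ => ([] : List (List ℝ))) = [] := by simp
  refine ⟨σ₂, t₁ + t₂, ?_, b2, ⟨b3, fun k hk z => ?_⟩, ?_⟩
  · have := Runs.seq a1 b1
    rwa [hnil, List.nil_append] at this
  · rw [b4 k (by omega), a3 k (by omega) (by omega)]
    exact hz k (by omega) z
  · simp only [Cmd.size]
    nlinarith [Nat.zero_le (c.size * xs.length), Nat.zero_le (c'.size * ops.length)]

end RealRAM

/-! ### Quantitative tangency of planes to spheres and of lines to circles -/

namespace NearTriangles

/-- Used for soundness: `E` bounds the shift of the lookup, and the extra `1` is the rounding error.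
-/
theorem abs_sub_le_of_floor_eq {x y ε : ℝ} (hε : 0 < ε) {e : ℤ} {E : ℕ} (he : |e| ≤ E)
    (h : ⌊x / ε⌋ = ⌊y / ε⌋ + e) : |x - y| ≤ (E + 1) * ε := by
  have h1 := Int.floor_le (x / ε)
  have h2 := Int.lt_floor_add_one (x / ε)
  have h3 := Int.floor_le (y / ε)
  have h4 := Int.lt_floor_add_one (y / ε)
  have h5 : |(e : ℝ)| ≤ E := by exact_mod_cast he
  rw [h] at h1 h2
  push_cast at h1 h2
  obtain ⟨h6, h7⟩ := abs_le.1 h5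
  have h8 : |x / ε - y / ε| ≤ E + 1 := by
    rw [abs_le]; constructor <;> linarith
  rw [← sub_div, abs_div, abs_of_pos hε, div_le_iff₀ hε] at h8
  exact h8

/-- The converse, used for completeness: closeness up to `K * ε` is detected by boundedly many
shifts. -/
theorem exists_floor_eq {x y ε K : ℝ} (hε : 0 < ε) {E : ℕ} (hK : K + 1 ≤ E)
    (h : |x - y| ≤ K * ε) : ∃ e : ℤ, |e| ≤ E ∧ ⌊x / ε⌋ = ⌊y / ε⌋ + e := by
  refine ⟨⌊x / ε⌋ - ⌊y / ε⌋, ?_, by ring⟩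
  have h1 := Int.floor_le (x / ε)
  have h2 := Int.lt_floor_add_one (x / ε)
  have h3 := Int.floor_le (y / ε)
  have h4 := Int.lt_floor_add_one (y / ε)
  have h8 : |x / ε - y / ε| ≤ K := by
    rw [← sub_div, abs_div, abs_of_pos hε, div_le_iff₀ hε]; exact h
  obtain ⟨h6, h7⟩ := abs_le.1 h8
  have : |((⌊x / ε⌋ - ⌊y / ε⌋ : ℤ) : ℝ)| ≤ E := by
    push_cast
    rw [abs_le]; constructor <;> linarith
  exact_mod_cast this

theorem sub_floor_mul_mem {x δ : ℝ} (hδ : 0 < δ) :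
    0 ≤ x - ⌊x / δ⌋ * δ ∧ x - ⌊x / δ⌋ * δ ≤ δ := by
  have h1 := Int.floor_le (x / δ)
  have h2 := (Int.lt_floor_add_one (x / δ)).le
  rw [le_div_iff₀ hδ] at h1
  rw [div_le_iff₀ hδ] at h2
  constructor <;> linarith

theorem abs_add_sq_le {x y K L ε : ℝ} (hε0 : 0 ≤ ε) (hε : ε ≤ 1 / 2) (hx : x ^ 2 ≤ L * ε)
    (hy : |y| ≤ K * ε) : (x + y) ^ 2 ≤ (2 * L + K ^ 2) * ε := by
  have h1 : y ^ 2 ≤ (K * ε) ^ 2 := by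
    rw [← sq_abs y]; exact pow_le_pow_left₀ (abs_nonneg y) hy 2
  have h2 : (K * ε) ^ 2 ≤ K ^ 2 * ε / 2 := by
    have : 0 ≤ K ^ 2 * ε * (1 / 2 - ε) := by
      have := sub_nonneg.2 hε; positivity
    nlinarith
  nlinarith [sq_nonneg (x - y)]

theorem abs_mul_le_mul {x y a b : ℝ} (hx : |x| ≤ a) (hy : |y| ≤ b) : |x * y| ≤ a * b := by
  rw [abs_mul]
  exact mul_le_mul hx hy (abs_nonneg y) ((abs_nonneg x).trans hx)

/-- A point close to a tangent line of a sphere, close to the point of contact, is close to the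
sphere. -/
theorem abs_normSq_sub_le_of_tangent_line {X₀ X₁ X₂ τ₁ τ₂ l ω₁ ω₂ r ε K : ℝ} (hε0 : 0 ≤ ε)
    (hε : ε ≤ 1 / 2) (hr : |r| ≤ 1 / 2) (hX : X₀ ^ 2 + X₁ ^ 2 + X₂ ^ 2 = r ^ 2)
    (hτ : X₀ + X₁ * τ₁ + X₂ * τ₂ = 0) (h₁ : |τ₁| ≤ 2) (h₂ : |τ₂| ≤ 2) (hl : l ^ 2 ≤ ε)
    (hω₁ : |ω₁| ≤ K * ε) (hω₂ : |ω₂| ≤ K * ε) :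
    |(X₀ + l) ^ 2 + (X₁ + τ₁ * l + ω₁) ^ 2 + (X₂ + τ₂ * l + ω₂) ^ 2 - r ^ 2| ≤
      (2 * K ^ 2 + 2 * K + 17) * ε := by
  have hr2 : r ^ 2 ≤ (1 / 2) ^ 2 := by
    rw [← sq_abs]; exact pow_le_pow_left₀ (abs_nonneg r) hr 2
  have a1 : |X₁| ≤ 1 / 2 := abs_le_of_sq_le_sq (by linarith [sq_nonneg X₀, sq_nonneg X₂]) (by norm_num)
  have a2 : |X₂| ≤ 1 / 2 := abs_le_of_sq_le_sq (by linarith [sq_nonneg X₀, sq_nonneg X₁]) (by norm_num)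
  have t1 : τ₁ ^ 2 ≤ 2 ^ 2 := by
    rw [← sq_abs]; exact pow_le_pow_left₀ (abs_nonneg _) h₁ 2
  have t2 : τ₂ ^ 2 ≤ 2 ^ 2 := by
    rw [← sq_abs]; exact pow_le_pow_left₀ (abs_nonneg _) h₂ 2
  have b1 : (τ₁ * l + ω₁) ^ 2 ≤ (2 * 4 + K ^ 2) * ε :=
    abs_add_sq_le hε0 hε (by nlinarith [sq_nonneg l]) hω₁
  have b2 : (τ₂ * l + ω₂) ^ 2 ≤ (2 * 4 + K ^ 2) * ε :=
    abs_add_sq_le hε0 hε (by nlinarith [sq_nonneg l]) hω₂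
  have c1 := abs_le.1 (abs_mul_le_mul a1 hω₁)
  have c2 := abs_le.1 (abs_mul_le_mul a2 hω₂)
  -- The terms linear in `l` add up to `2 * l * (X₀ + X₁ * τ₁ + X₂ * τ₂)`, which vanishes by
  -- tangency. The rest is quadratic in `l` or contains `ω₁` or `ω₂`.
  have key : (X₀ + l) ^ 2 + (X₁ + τ₁ * l + ω₁) ^ 2 + (X₂ + τ₂ * l + ω₂) ^ 2 - r ^ 2 =
      2 * (X₁ * ω₁) + 2 * (X₂ * ω₂) + l ^ 2 + (τ₁ * l + ω₁) ^ 2 + (τ₂ * l + ω₂) ^ 2 := by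
    linear_combination hX + 2 * l * hτ
  rw [key, abs_le]
  constructor <;> linarith [sq_nonneg l, sq_nonneg (τ₁ * l + ω₁), sq_nonneg (τ₂ * l + ω₂)]

/-- A point close to the tangent plane of a sphere, close to the point of contact, is close to the
sphere. -/
theorem abs_normSq_sub_le_of_tangent_plane {y a b m₁ m₂ l₁ l₂ ω r ε K : ℝ} (hε0 : 0 ≤ ε)
    (hε : ε ≤ 1 / 2) (hr : |r| ≤ 1 / 2) (hX : y ^ 2 + a ^ 2 + b ^ 2 = r ^ 2)
    (hm₁ : m₁ * y = -a) (hm₂ : m₂ * y = -b) (h₁ : |m₁| ≤ 2) (h₂ : |m₂| ≤ 2) (hl₁ : l₁ ^ 2 ≤ ε)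
    (hl₂ : l₂ ^ 2 ≤ ε) (hω : |ω| ≤ K * ε) :
    |(y + (m₁ * l₁ + m₂ * l₂) + ω) ^ 2 + (a + l₁) ^ 2 + (b + l₂) ^ 2 - r ^ 2| ≤
      (K ^ 2 + K + 34) * ε := by
  have hr2 : r ^ 2 ≤ (1 / 2) ^ 2 := by
    rw [← sq_abs]; exact pow_le_pow_left₀ (abs_nonneg r) hr 2
  have a1 : |y| ≤ 1 / 2 := abs_le_of_sq_le_sq (by linarith [sq_nonneg a, sq_nonneg b]) (by norm_num)
  have t1 : m₁ ^ 2 ≤ 2 ^ 2 := by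
    rw [← sq_abs]; exact pow_le_pow_left₀ (abs_nonneg _) h₁ 2
  have t2 : m₂ ^ 2 ≤ 2 ^ 2 := by
    rw [← sq_abs]; exact pow_le_pow_left₀ (abs_nonneg _) h₂ 2
  have d1 : (m₁ * l₁) ^ 2 ≤ 4 * ε := by nlinarith [sq_nonneg l₁]
  have d2 : (m₂ * l₂) ^ 2 ≤ 4 * ε := by nlinarith [sq_nonneg l₂]
  have b1 : (m₁ * l₁ + m₂ * l₂ + ω) ^ 2 ≤ (2 * 16 + K ^ 2) * ε :=
    abs_add_sq_le hε0 hε (by linarith [sq_nonneg (m₁ * l₁ - m₂ * l₂)]) hω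
  have c1 := abs_le.1 (abs_mul_le_mul a1 hω)
  -- Since `m₁`, `m₂` are the slopes of the tangent plane, `a + m₁ * y` and `b + m₂ * y` vanish, and
  -- with them the terms linear in `l₁`, `l₂`.
  have key : (y + (m₁ * l₁ + m₂ * l₂) + ω) ^ 2 + (a + l₁) ^ 2 + (b + l₂) ^ 2 - r ^ 2 =
      2 * (y * ω) + l₁ ^ 2 + l₂ ^ 2 + (m₁ * l₁ + m₂ * l₂ + ω) ^ 2 := by
    linear_combination hX + 2 * l₁ * hm₁ + 2 * l₂ * hm₂
  rw [key, abs_le]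
  constructor <;> linarith [sq_nonneg l₁, sq_nonneg l₂, sq_nonneg (m₁ * l₁ + m₂ * l₂ + ω)]

/-- The constant in `tangent_plane_of_near_sphere`. -/
noncomputable def sphereConst (β : ℝ) : ℝ := (8 + 512 / β ^ 2) / β

/-- As `x` and `y` do not have opposite signs, `|x + y| ≥ |x| ≥ c`, and this factor can be divided
out of `x ^ 2 - y ^ 2`. -/
theorem abs_sub_le_div_of_sq {x y c B : ℝ} (hc : 0 < c) (hx : c ≤ |x|) (hxy : 0 ≤ x * y)
    (h : |x ^ 2 - y ^ 2| ≤ B) : |x - y| ≤ B / c := by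
  rw [le_div_iff₀ hc]
  have h1 : |x ^ 2 - y ^ 2| = |x - y| * |x + y| := by rw [← abs_mul]; ring_nf
  have h2 : c ≤ |x + y| := by
    have : |x| ≤ |x + y| := by
      apply sq_le_sq.1
      nlinarith [sq_nonneg y]
    linarith
  calc |x - y| * c ≤ |x - y| * |x + y| := by gcongr
    _ ≤ B := by rw [← h1]; exact h

set_option maxHeartbeats 400000 in
/-- The sphere of radius `r` over a corner of the square that contains `(c₁, c₂)`, when `(Z, c₁, c₂)`
is close to the sphere and has its largest coordinate in front. -/
theorem tangent_plane_of_near_sphere {β r δ ε Z c₁ c₂ l₁ l₂ sg : ℝ} (hβ : 0 < β) (hβr : β ≤ r)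
    (hr : r ≤ 1 / 2) (hδ : 0 < δ) (hδβ : δ ≤ β ^ 2 / 200) (hε : ε = δ ^ 2)
    (hl₁ : 0 ≤ l₁) (hl₁' : l₁ ≤ δ) (hl₂ : 0 ≤ l₂) (hl₂' : l₂ ≤ δ)
    (hρ : |Z ^ 2 + c₁ ^ 2 + c₂ ^ 2 - r ^ 2| ≤ 2 * ε) (h₁ : c₁ ^ 2 ≤ Z ^ 2) (h₂ : c₂ ^ 2 ≤ Z ^ 2)
    (hsg : sg = 1 ∨ sg = -1) (hsZ : 0 ≤ sg * Z) :
    (c₁ - l₁) ^ 2 < 4 * (r ^ 2 - (c₁ - l₁) ^ 2 - (c₂ - l₂) ^ 2) ∧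
    (c₂ - l₂) ^ 2 < 4 * (r ^ 2 - (c₁ - l₁) ^ 2 - (c₂ - l₂) ^ 2) ∧
    ∀ y m₁ m₂, y = sg * √(r ^ 2 - (c₁ - l₁) ^ 2 - (c₂ - l₂) ^ 2) → m₁ * y = -(c₁ - l₁) →
      m₂ * y = -(c₂ - l₂) → |Z - y - m₁ * l₁ - m₂ * l₂| ≤ sphereConst β * ε := by
  set D := r ^ 2 - (c₁ - l₁) ^ 2 - (c₂ - l₂) ^ 2 with hD
  have hβ1 : β ^ 2 ≤ 1 / 4 := by nlinarith
  have hδ1 : δ ≤ 1 / 800 := by linarith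
  have hεδ : ε ≤ δ / 800 := by rw [hε]; nlinarith
  have hε0 : 0 ≤ ε := by rw [hε]; positivity
  obtain ⟨ha, hb⟩ := abs_le.1 hρ
  have hβr2 : β ^ 2 ≤ r ^ 2 := pow_le_pow_left₀ hβ.le hβr 2
  have hr2 : r ^ 2 ≤ 1 / 4 := by nlinarith
  have e1 : |c₁| ≤ 1 := abs_le_of_sq_le_sq (by linarith [sq_nonneg Z, sq_nonneg c₂]) (by norm_num)
  have e2 : |c₂| ≤ 1 := abs_le_of_sq_le_sq (by linarith [sq_nonneg Z, sq_nonneg c₁]) (by norm_num)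
  have f1 := abs_le.1 (abs_mul_le_mul e1 (show |l₁| ≤ δ by rwa [abs_of_nonneg hl₁]))
  have f2 := abs_le.1 (abs_mul_le_mul e2 (show |l₂| ≤ δ by rwa [abs_of_nonneg hl₂]))
  have g1 : l₁ ^ 2 ≤ ε := by rw [hε]; exact pow_le_pow_left₀ hl₁ hl₁' 2
  have g2 : l₂ ^ 2 ≤ ε := by rw [hε]; exact pow_le_pow_left₀ hl₂ hl₂' 2
  -- Each cross term `2 * c * l` contributes at most `2 * δ`; the defect `2 * ε` and the squares fit
  -- into the remaining `δ`. As `Z ^ 2` is the largest of three squares with sum about `r ^ 2`, this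
  -- also keeps `D` away from `0`.
  have hDZ : |Z ^ 2 - D| ≤ 5 * δ := by
    rw [hD, abs_le]
    constructor <;> linarith [sq_nonneg l₁, sq_nonneg l₂]
  obtain ⟨hDZ1, hDZ2⟩ := abs_le.1 hDZ
  have hZ : (β / 2) ^ 2 ≤ Z ^ 2 := by linarith
  have hD0 : (β / 4) ^ 2 ≤ D := by linarith
  have hβ2 : 0 < β ^ 2 := by positivity
  refine ⟨by linarith, by linarith, ?_⟩
  intro y m₁ m₂ hy hm₁ hm₂
  have hsg2 : sg ^ 2 = 1 := by rcases hsg with h | h <;> rw [h] <;> norm_num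
  have hDpos : 0 ≤ D := le_trans (by positivity) hD0
  have hy2 : y ^ 2 = D := by rw [hy, mul_pow, hsg2, Real.sq_sqrt hDpos, one_mul]
  have hyZ : 0 ≤ Z * y := by
    rw [hy]
    have := mul_nonneg hsZ (Real.sqrt_nonneg D)
    linarith
  have hyabs : β / 4 ≤ |y| := by
    apply abs_le_of_sq_le_sq' _ (abs_nonneg y) |>.2
    rw [sq_abs, hy2]; exact hD0
  have hZabs : β / 2 ≤ |Z| := by
    apply abs_le_of_sq_le_sq' _ (abs_nonneg Z) |>.2
    rw [sq_abs]; exact hZ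
  -- A bound of order `δ` suffices, because `Z - y` enters the identity `key` below only through its
  -- square.
  have hd : |Z - y| ≤ 5 * δ / (β / 2) := by
    refine abs_sub_le_div_of_sq (by positivity) hZabs hyZ ?_
    rw [hy2]; exact hDZ
  have hd2 : (Z - y) ^ 2 ≤ 100 / β ^ 2 * ε := by
    rw [← sq_abs]
    calc |Z - y| ^ 2 ≤ (5 * δ / (β / 2)) ^ 2 := pow_le_pow_left₀ (abs_nonneg _) hd 2
      _ = 100 / β ^ 2 * ε := by rw [hε]; field_simp; norm_num
  -- The choice of the slopes cancels the linear terms. What is left is of order `ε`, and `y` is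
  -- bounded away from `0`.
  have key : 2 * y * (Z - y - m₁ * l₁ - m₂ * l₂) =
      (Z ^ 2 + c₁ ^ 2 + c₂ ^ 2 - r ^ 2) - (Z - y) ^ 2 - l₁ ^ 2 - l₂ ^ 2 := by
    rw [hD] at hy2
    linear_combination - hy2 - 2 * l₁ * hm₁ - 2 * l₂ * hm₂
  have hbound : |2 * y * (Z - y - m₁ * l₁ - m₂ * l₂)| ≤ (4 + 100 / β ^ 2) * ε := by
    rw [key, abs_le]
    constructor <;> linarith [sq_nonneg (Z - y), sq_nonneg l₁, sq_nonneg l₂]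
  rw [abs_mul, abs_mul, abs_of_pos (by norm_num : (0 : ℝ) < 2)] at hbound
  set ω := |Z - y - m₁ * l₁ - m₂ * l₂|
  have hω : 0 ≤ ω := abs_nonneg _
  have : β / 2 * ω ≤ (4 + 100 / β ^ 2) * ε := by
    have := mul_le_mul_of_nonneg_right hyabs hω
    linarith
  calc ω = (β / 2 * ω) * (2 / β) := by field_simp
    _ ≤ ((4 + 100 / β ^ 2) * ε) * (2 / β) := by gcongr
    _ = (8 + 200 / β ^ 2) / β * ε := by field_simp; ring
    _ ≤ sphereConst β * ε := by unfold sphereConst; gcongr; norm_num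

/-- The constant in `tangent_line_of_near_circle`. -/
noncomputable def circleConst (c : ℝ) : ℝ := 2 * (4 + (29 / c ^ 5) ^ 2) / c ^ 3

set_option maxHeartbeats 1000000 in
/-- The circle of the points with given distances from two points, in a coordinate plane close to
a point that is close to this circle, when the tangent of the circle is transversal to the plane. -/
theorem tangent_line_of_near_circle {c r₁ r₂ δ ε v₀ v₁ v₂ h O₁ O₂ l sg : ℝ} (hc : 0 < c)
    (hc1 : c ≤ 1) (hr₁ : 0 ≤ r₁) (hr₁' : r₁ ≤ 1 / 2) (hδ : 0 < δ)
    (hδc : δ ≤ c ^ 6 / 200) (hε0 : 0 < ε) (hε : ε ≤ δ) (hδε : δ ^ 2 ≤ ε) (hl : 0 ≤ l) (hl' : l ≤ δ)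
    (hv : v₀ ^ 2 + v₁ ^ 2 + v₂ ^ 2 ≤ 1)
    (hO : |(h + l) ^ 2 + O₁ ^ 2 + O₂ ^ 2 - r₁ ^ 2| ≤ 2 * ε)
    (hO' : |(h + l - v₀) ^ 2 + (O₁ - v₁) ^ 2 + (O₂ - v₂) ^ 2 - r₂ ^ 2| ≤ 2 * ε)
    (hG : c ≤ |O₂ * v₁ - O₁ * v₂|) (hG₁ : |O₂ * v₀ - (h + l) * v₂| ≤ |O₂ * v₁ - O₁ * v₂|)
    (hG₂ : |(h + l) * v₁ - O₁ * v₀| ≤ |O₂ * v₁ - O₁ * v₂|)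
    (hsg : sg = 1 ∨ sg = -1) (hsG : 0 ≤ sg * (O₂ * v₁ - O₁ * v₂)) :
    ∀ w κ D μ X₁ X₂, w = v₁ ^ 2 + v₂ ^ 2 →
      κ = ((v₀ ^ 2 + v₁ ^ 2 + v₂ ^ 2 + r₁ ^ 2 - r₂ ^ 2) / 2 - v₀ * h) / w →
      D = (r₁ ^ 2 - h ^ 2) / w - κ ^ 2 → μ = sg * √D → X₁ = κ * v₁ - μ * v₂ →
      X₂ = κ * v₂ + μ * v₁ →
      0 < D ∧ (h * v₂ - v₀ * X₂) ^ 2 < 4 * (μ * w) ^ 2 ∧ (v₀ * X₁ - v₁ * h) ^ 2 < 4 * (μ * w) ^ 2 ∧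
      |O₁ - X₁ - (h * v₂ - v₀ * X₂) / (μ * w) * l| ≤ circleConst c * ε ∧
      |O₂ - X₂ - (v₀ * X₁ - v₁ * h) / (μ * w) * l| ≤ circleConst c * ε := by
  intro w κ D μ X₁ X₂ hw hκ hD hμ hX₁ hX₂
  have hc6 : c ^ 6 ≤ 1 := pow_le_one₀ hc.le hc1
  have hδ1 : δ ≤ 1 / 200 := by linarith
  have hr2 : r₁ ^ 2 ≤ 1 / 4 := by nlinarith
  obtain ⟨o1, o2⟩ := abs_le.1 hO
  obtain ⟨o3, o4⟩ := abs_le.1 hO'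
  have b0 : |h + l| ≤ 1 := abs_le_of_sq_le_sq (by linarith [sq_nonneg O₁, sq_nonneg O₂]) (by norm_num)
  have b1 : |O₁| ≤ 1 :=
    abs_le_of_sq_le_sq (by linarith [sq_nonneg (h + l), sq_nonneg O₂]) (by norm_num)
  have b2 : |O₂| ≤ 1 :=
    abs_le_of_sq_le_sq (by linarith [sq_nonneg (h + l), sq_nonneg O₁]) (by norm_num)
  have d0 : |v₀| ≤ 1 := abs_le_of_sq_le_sq (by linarith [sq_nonneg v₁, sq_nonneg v₂]) (by norm_num)
  have d1 : |v₁| ≤ 1 := abs_le_of_sq_le_sq (by linarith [sq_nonneg v₀, sq_nonneg v₂]) (by norm_num)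
  have d2 : |v₂| ≤ 1 := abs_le_of_sq_le_sq (by linarith [sq_nonneg v₀, sq_nonneg v₁]) (by norm_num)
  set G := O₂ * v₁ - O₁ * v₂ with hGdef
  have hG2 : c ^ 2 ≤ G ^ 2 := by
    rw [← sq_abs G]; exact pow_le_pow_left₀ hc.le hG 2
  have hw1 : w ≤ 1 := by rw [hw]; linarith [sq_nonneg v₀]
  have hwc : c ^ 2 ≤ w := by
    have e1 : G ^ 2 + (O₁ * v₁ + O₂ * v₂) ^ 2 = (O₁ ^ 2 + O₂ ^ 2) * w := by rw [hw, hGdef]; ring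
    have e2 : O₁ ^ 2 + O₂ ^ 2 ≤ 1 := by linarith [sq_nonneg (h + l)]
    have e3 : 0 ≤ w := by rw [hw]; positivity
    have e4 := mul_le_mul_of_nonneg_right e2 e3
    linarith [sq_nonneg (O₁ * v₁ + O₂ * v₂)]
  have hw0 : 0 < w := lt_of_lt_of_le (by positivity) hwc
  -- Coordinates of `(O₁, O₂)` in the orthogonal frame `(v₁, v₂)`, `(-v₂, v₁)`. Their counterparts
  -- `κ`, `μ` belong to the exact circle point at height `h`: `κ` solves the linear equation
  -- obtained by subtracting the sphere equations, and `μ` the remaining quadratic one.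
  obtain ⟨κo, hκo⟩ : ∃ κo, κo = (O₁ * v₁ + O₂ * v₂) / w := ⟨_, rfl⟩
  obtain ⟨μo, hμo⟩ : ∃ μo, μo = G / w := ⟨_, rfl⟩
  have hκow : κo * w = O₁ * v₁ + O₂ * v₂ := by rw [hκo]; field_simp
  have hμow : μo * w = G := by rw [hμo]; field_simp
  have hκw : κ * w = (v₀ ^ 2 + v₁ ^ 2 + v₂ ^ 2 + r₁ ^ 2 - r₂ ^ 2) / 2 - v₀ * h := by
    rw [hκ]; field_simp
  have hO1 : O₁ = κo * v₁ - μo * v₂ := by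
    apply mul_right_cancel₀ hw0.ne'
    rw [sub_mul, mul_right_comm, hκow, mul_right_comm μo, hμow, hw, hGdef]; ring
  have hO2 : O₂ = κo * v₂ + μo * v₁ := by
    apply mul_right_cancel₀ hw0.ne'
    rw [add_mul, mul_right_comm, hκow, mul_right_comm μo, hμow, hw, hGdef]; ring
  have hlv : |v₀ * l| ≤ 1 * δ := abs_mul_le_mul d0 (by rwa [abs_of_nonneg hl])
  obtain ⟨lv1, lv2⟩ := abs_le.1 hlv
  -- The shift of height contributes `|v₀ * l| ≤ δ`, and the two defects together `2 * ε ≤ 2 * δ`.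
  have hκd : |κ - κo| ≤ 3 * δ / c ^ 2 := by
    have e1 : |(κ - κo) * w| ≤ 3 * δ := by
      rw [sub_mul, hκw, hκow, abs_le]
      constructor <;> linarith
    rw [abs_mul, abs_of_pos hw0] at e1
    rw [le_div_iff₀ (by positivity)]
    exact le_trans (by gcongr) e1
  have hκo2 : |κo| ≤ 2 / c ^ 2 := by
    rw [hκo, abs_div, abs_of_pos hw0]
    have e1 := abs_mul_le_mul b1 d1
    have e2 := abs_mul_le_mul b2 d2
    have := abs_add_le (O₁ * v₁) (O₂ * v₂)
    gcongr
    linarith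
  have hc2 : 0 < c ^ 2 := by positivity
  have hl2 : l ^ 2 ≤ δ := by
    have := pow_le_pow_left₀ hl hl' 2
    have h1 := mul_le_mul_of_nonneg_left (show δ ≤ 1 by linarith) hδ.le
    linarith
  have hlO : |(h + l) * l| ≤ 1 * δ := abs_mul_le_mul b0 (by rwa [abs_of_nonneg hl])
  obtain ⟨lO1, lO2⟩ := abs_le.1 hlO
  have hμD : |μo ^ 2 - D| ≤ 26 * δ / c ^ 4 := by
    have e1 : (μo ^ 2 - D) = ((h + l) ^ 2 + O₁ ^ 2 + O₂ ^ 2 - r₁ ^ 2 - 2 * ((h + l) * l) + l ^ 2) / w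
        + (κ - κo) * (κ + κo) := by
      have : O₁ ^ 2 + O₂ ^ 2 = (κo ^ 2 + μo ^ 2) * w := by rw [hO1, hO2, hw]; ring
      rw [hD]
      field_simp
      linear_combination - this
    have e2 : |((h + l) ^ 2 + O₁ ^ 2 + O₂ ^ 2 - r₁ ^ 2 - 2 * ((h + l) * l) + l ^ 2) / w| ≤
        5 * δ / c ^ 2 := by
      rw [abs_div, abs_of_pos hw0]
      gcongr
      rw [abs_le]
      constructor <;> linarith [sq_nonneg l]
    have e3 : |κ + κo| ≤ 7 / c ^ 2 := by
      have : κ + κo = (κ - κo) + κo + κo := by ring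
      rw [this]
      refine (abs_add_three _ _ _).trans ?_
      calc _ ≤ 3 * δ / c ^ 2 + 2 / c ^ 2 + 2 / c ^ 2 := by gcongr
        _ = (3 * δ + 4) / c ^ 2 := by ring
        _ ≤ 7 / c ^ 2 := by gcongr; linarith
    rw [e1]
    refine (abs_add_le _ _).trans ?_
    calc _ ≤ 5 * δ / c ^ 2 + 3 * δ / c ^ 2 * (7 / c ^ 2) := add_le_add e2 (abs_mul_le_mul hκd e3)
      _ = (5 * δ * c ^ 2 + 21 * δ) / c ^ 4 := by field_simp; ring
      _ ≤ 26 * δ / c ^ 4 := by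
        gcongr
        linarith [mul_le_mul_of_nonneg_left (pow_le_one₀ (n := 2) hc.le hc1) hδ.le]
  have hμoabs : c ≤ |μo| := by
    rw [hμo, abs_div, abs_of_pos hw0, le_div_iff₀ hw0]
    exact (mul_le_of_le_one_right hc.le hw1).trans hG
  have hμo2 : c ^ 2 ≤ μo ^ 2 := by
    rw [← sq_abs μo]; exact pow_le_pow_left₀ hc.le hμoabs 2
  have hDlow : (c / 2) ^ 2 ≤ D := by
    have : 26 * δ / c ^ 4 ≤ c ^ 2 / 2 := by
      rw [div_le_iff₀ (by positivity)]
      have : c ^ 2 / 2 * c ^ 4 = c ^ 6 / 2 := by ring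
      have : 0 < c ^ 6 := by positivity
      linarith
    have := (abs_le.1 hμD).2
    have : 0 < c ^ 2 := by positivity
    linarith
  have hD0 : 0 < D := lt_of_lt_of_le (by positivity) hDlow
  have hsg2 : sg ^ 2 = 1 := by rcases hsg with h | h <;> rw [h] <;> norm_num
  have hμ2 : μ ^ 2 = D := by rw [hμ, mul_pow, hsg2, Real.sq_sqrt hD0.le, one_mul]
  have hμμo : 0 ≤ μo * μ := by
    rw [hμo, hμ, div_mul_eq_mul_div]
    apply div_nonneg _ hw0.le
    have := mul_nonneg hsG (Real.sqrt_nonneg D)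
    linarith
  have hμabs : c / 2 ≤ |μ| := by
    apply abs_le_of_sq_le_sq' _ (abs_nonneg μ) |>.2
    rw [sq_abs, hμ2]; exact hDlow
  -- The sign `sg` was chosen so that `μ` and `μo` lie on the same side; hence closeness of the
  -- squares gives closeness of the numbers.
  have hμd : |μo - μ| ≤ 26 * δ / c ^ 5 := by
    have := abs_sub_le_div_of_sq (B := 26 * δ / c ^ 4) hc hμoabs hμμo (by rw [hμ2]; exact hμD)
    rwa [div_div, ← pow_succ] at this
  set K := 29 / c ^ 5 with hK
  have hKδ : 3 * δ / c ^ 2 + 26 * δ / c ^ 5 ≤ K * δ := by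
    have : 3 * δ / c ^ 2 ≤ 3 * δ / c ^ 5 := by
      apply div_le_div_of_nonneg_left (by positivity) (by positivity)
      exact pow_le_pow_of_le_one hc.le hc1 (by norm_num)
    calc _ ≤ 3 * δ / c ^ 5 + 26 * δ / c ^ 5 := by gcongr
      _ = K * δ := by rw [hK]; ring
  have hμd' : |μo - μ| ≤ K * δ := by
    have : 0 ≤ 3 * δ / c ^ 2 := by positivity
    linarith
  have hκd' : |κo - κ| ≤ 3 * δ / c ^ 2 := by rwa [abs_sub_comm]
  have hdiff : ∀ x y : ℝ, |x| ≤ 1 → |y| ≤ 1 → |(κo - κ) * x + (μo - μ) * y| ≤ K * δ := by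
    intro x y hx hy
    refine (abs_add_le _ _).trans (le_trans (add_le_add
      (abs_mul_le_mul hκd' hx) (abs_mul_le_mul hμd hy)) ?_)
    linarith
  have hOX1 : |O₁ - X₁| ≤ K * δ := by
    have := hdiff v₁ (-v₂) d1 (by rwa [abs_neg])
    rwa [show (κo - κ) * v₁ + (μo - μ) * -v₂ = O₁ - X₁ by rw [hO1, hX₁]; ring] at this
  have hOX2 : |O₂ - X₂| ≤ K * δ := by
    have := hdiff v₂ v₁ d2 d1
    rwa [show (κo - κ) * v₂ + (μo - μ) * v₁ = O₂ - X₂ by rw [hO2, hX₂]; ring] at this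
  have hμw : |G| - K * δ ≤ |μ * w| := by
    have e1 : |G - μ * w| ≤ K * δ * 1 := by
      rw [← hμow, ← sub_mul]
      exact abs_mul_le_mul hμd' (by rwa [abs_of_pos hw0])
    have := abs_sub_abs_le_abs_sub G (μ * w)
    linarith
  -- Passing from `O` to the circle point changes the numerators of the slopes by at most `(1 + K) *
  -- δ` and the denominator `G` by at most `K * δ`. At `O` the slopes are at most `1`, so they stay
  -- below `2` once `(1 + 3 * K) * δ < |G|`.
  have hsmall : (1 + 3 * K) * δ < c := by
    have e1 : 1 + 3 * K ≤ 88 / c ^ 5 := by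
      have : 1 ≤ 1 / c ^ 5 := by
        rw [le_div_iff₀ (by positivity), one_mul]; exact pow_le_one₀ hc.le hc1
      calc 1 + 3 * K ≤ 1 / c ^ 5 + 3 * K := by linarith
        _ = 88 / c ^ 5 := by rw [hK]; ring
    calc (1 + 3 * K) * δ ≤ 88 / c ^ 5 * (c ^ 6 / 200) := by gcongr
      _ = 88 / 200 * c := by field_simp
      _ < c := by linarith
  have hK0 : 0 < K := by positivity
  have hslope : ∀ x : ℝ, |x| ≤ |G| + (1 + K) * δ → x ^ 2 < 4 * (μ * w) ^ 2 := by
    intro x hx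
    have : |x| < 2 * |μ * w| := by linarith
    have := pow_lt_pow_left₀ this (abs_nonneg x) (n := 2) (by norm_num)
    rw [mul_pow, sq_abs, sq_abs] at this
    linarith
  have hs1 : (h * v₂ - v₀ * X₂) ^ 2 < 4 * (μ * w) ^ 2 := by
    apply hslope
    have e1 : |v₀ * (O₂ - X₂)| ≤ 1 * (K * δ) := abs_mul_le_mul d0 hOX2
    have e2 : |l * v₂| ≤ δ * 1 := abs_mul_le_mul (by rwa [abs_of_nonneg hl]) d2
    have e3 : h * v₂ - v₀ * X₂ = -(O₂ * v₀ - (h + l) * v₂) + v₀ * (O₂ - X₂) + -(l * v₂) := by ring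
    rw [e3]
    refine (abs_add_three _ _ _).trans ?_
    rw [abs_neg, abs_neg]
    linarith
  have hs2 : (v₀ * X₁ - v₁ * h) ^ 2 < 4 * (μ * w) ^ 2 := by
    apply hslope
    have e1 : |v₀ * (O₁ - X₁)| ≤ 1 * (K * δ) := abs_mul_le_mul d0 hOX1
    have e2 : |l * v₁| ≤ δ * 1 := abs_mul_le_mul (by rwa [abs_of_nonneg hl]) d1
    have e3 : v₀ * X₁ - v₁ * h = -((h + l) * v₁ - O₁ * v₀) + -(v₀ * (O₁ - X₁)) + l * v₁ := by ring
    rw [e3]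
    refine (abs_add_three _ _ _).trans ?_
    rw [abs_neg, abs_neg]
    linarith
  refine ⟨hD0, hs1, hs2, ?_⟩
  have hμ0 : μ ≠ 0 := by
    intro h0; rw [h0, abs_zero] at hμabs; linarith
  have hμw0 : μ * w ≠ 0 := mul_ne_zero hμ0 hw0.ne'
  set τ₁ := (h * v₂ - v₀ * X₂) / (μ * w) with hτ₁
  set τ₂ := (v₀ * X₁ - v₁ * h) / (μ * w) with hτ₂
  have hτ₁' : τ₁ * (μ * w) = h * v₂ - v₀ * X₂ := by rw [hτ₁]; field_simp
  have hτ₂' : τ₂ * (μ * w) = v₀ * X₁ - v₁ * h := by rw [hτ₂]; field_simp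
  have hdet : v₁ * X₂ - v₂ * X₁ = μ * w := by rw [hX₁, hX₂, hw]; ring
  have hXX : h ^ 2 + X₁ ^ 2 + X₂ ^ 2 = r₁ ^ 2 := by
    have e1 : X₁ ^ 2 + X₂ ^ 2 = (κ ^ 2 + μ ^ 2) * w := by rw [hX₁, hX₂, hw]; ring
    rw [add_assoc, e1, hμ2, hD]; field_simp; ring
  have hXv : v₀ * h + v₁ * X₁ + v₂ * X₂ =
      (v₀ ^ 2 + v₁ ^ 2 + v₂ ^ 2 + r₁ ^ 2 - r₂ ^ 2) / 2 := by
    have : v₁ * X₁ + v₂ * X₂ = κ * w := by rw [hX₁, hX₂, hw]; ring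
    rw [add_assoc, this, hκw]; ring
  have hvτ : v₁ * τ₁ + v₂ * τ₂ = -v₀ := by
    apply mul_right_cancel₀ hμw0
    linear_combination v₁ * hτ₁' + v₂ * hτ₂' - v₀ * hdet
  have hXτ : X₁ * τ₁ + X₂ * τ₂ = -h := by
    apply mul_right_cancel₀ hμw0
    linear_combination X₁ * hτ₁' + X₂ * hτ₂' - h * hdet
  -- The deviation from the tangent line is recovered from its inner products with `(v₁, v₂)` and
  -- `(X₁, X₂)`. The first is half the difference of the two sphere defects; the second, in `hB`, is
  -- half of one defect minus squares of quantities of order `δ`.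
  have hA : |v₁ * (O₁ - X₁ - τ₁ * l) + v₂ * (O₂ - X₂ - τ₂ * l)| ≤ 2 * ε := by
    have : v₁ * (O₁ - X₁ - τ₁ * l) + v₂ * (O₂ - X₂ - τ₂ * l) =
      ((h + l) ^ 2 + O₁ ^ 2 + O₂ ^ 2 - r₁ ^ 2) / 2 -
        ((h + l - v₀) ^ 2 + (O₁ - v₁) ^ 2 + (O₂ - v₂) ^ 2 - r₂ ^ 2) / 2 := by
      linear_combination - l * hvτ - hXv
    rw [this, abs_le]
    constructor <;> linarith
  have hB : |X₁ * (O₁ - X₁ - τ₁ * l) + X₂ * (O₂ - X₂ - τ₂ * l)| ≤ (2 + K ^ 2) * ε := by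
    have e1 : X₁ * (O₁ - X₁ - τ₁ * l) + X₂ * (O₂ - X₂ - τ₂ * l) =
      ((h + l) ^ 2 + O₁ ^ 2 + O₂ ^ 2 - r₁ ^ 2) / 2 -
        (l ^ 2 + (O₁ - X₁) ^ 2 + (O₂ - X₂) ^ 2) / 2 := by
      linear_combination - l * hXτ - hXX / 2
    have e2 : l ^ 2 ≤ ε := (pow_le_pow_left₀ hl hl' 2).trans hδε
    have e3 : (K * δ) ^ 2 ≤ K ^ 2 * ε := by rw [mul_pow]; gcongr
    have e4 : (O₁ - X₁) ^ 2 ≤ K ^ 2 * ε := by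
      rw [← sq_abs]; exact (pow_le_pow_left₀ (abs_nonneg _) hOX1 2).trans e3
    have e5 : (O₂ - X₂) ^ 2 ≤ K ^ 2 * ε := by
      rw [← sq_abs]; exact (pow_le_pow_left₀ (abs_nonneg _) hOX2 2).trans e3
    rw [e1, abs_le]
    constructor <;> linarith [sq_nonneg (O₁ - X₁), sq_nonneg (O₂ - X₂), sq_nonneg l]
  have hx1 : |X₁| ≤ 1 :=
    abs_le_of_sq_le_sq (by linarith [sq_nonneg h, sq_nonneg X₂]) (by norm_num)
  have hx2 : |X₂| ≤ 1 :=
    abs_le_of_sq_le_sq (by linarith [sq_nonneg h, sq_nonneg X₁]) (by norm_num)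
  have hμw' : c ^ 3 / 2 ≤ |μ * w| := by
    rw [abs_mul, abs_of_pos hw0]
    calc c ^ 3 / 2 = c / 2 * c ^ 2 := by ring
      _ ≤ |μ| * w := by gcongr
  -- Cramer's rule: the determinant `v₁ * X₂ - v₂ * X₁ = μ * w` is at least `c ^ 3 / 2` in absolute
  -- value.
  have hsolve : ∀ ω A' B' : ℝ, ω * (μ * w) = A' + B' → |A'| ≤ 2 * ε → |B'| ≤ (2 + K ^ 2) * ε →
      |ω| ≤ circleConst c * ε := by
    intro ω A' B' h1 h2 h3
    have e1 : |ω| * |μ * w| ≤ (4 + K ^ 2) * ε := by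
      rw [← abs_mul, h1]
      refine (abs_add_le _ _).trans ?_
      linarith
    have e2 : |ω| * (c ^ 3 / 2) ≤ (4 + K ^ 2) * ε := le_trans (by gcongr) e1
    calc |ω| = |ω| * (c ^ 3 / 2) * (2 / c ^ 3) := by field_simp
      _ ≤ (4 + K ^ 2) * ε * (2 / c ^ 3) := by gcongr
      _ = circleConst c * ε := by rw [circleConst, hK]; ring
  constructor
  · refine hsolve _ (X₂ * (v₁ * (O₁ - X₁ - τ₁ * l) + v₂ * (O₂ - X₂ - τ₂ * l)))
      (-v₂ * (X₁ * (O₁ - X₁ - τ₁ * l) + X₂ * (O₂ - X₂ - τ₂ * l))) ?_ ?_ ?_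
    · rw [← hdet]; ring
    · simpa using abs_mul_le_mul hx2 hA
    · simpa using abs_mul_le_mul (show |-v₂| ≤ 1 by rwa [abs_neg]) hB
  · refine hsolve _ (-X₁ * (v₁ * (O₁ - X₁ - τ₁ * l) + v₂ * (O₂ - X₂ - τ₂ * l)))
      (v₁ * (X₁ * (O₁ - X₁ - τ₁ * l) + X₂ * (O₂ - X₂ - τ₂ * l))) ?_ ?_ ?_
    · rw [← hdet]; ring
    · simpa using abs_mul_le_mul (show |-X₁| ≤ 1 by rwa [abs_neg]) hA
    · simpa using abs_mul_le_mul d1 hB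

end NearTriangles

/-! ### Integer keys: equality of keys versus approximate incidence -/

namespace NearTriangles

/-- The height, over the plane through its center, of a point of the sphere with squared radius
`R`, above or below the point with coordinates `a`, `b`. -/
noncomputable def sphereHeight (R a b sg : ℝ) : ℝ := sg * √(R - a * a - b * b)

/-- The key of the point `(q₀, q₁, q₂)` for the slopes with indices `k`, `l`. -/
noncomputable def sphereKey (δ ε q₀ q₁ q₂ : ℝ) (k l : ℤ) : List ℤ :=
  [⌊q₁ / δ⌋, ⌊q₂ / δ⌋, k, l,
    ⌊(q₀ - k * δ * (q₁ - ⌊q₁ / δ⌋ * δ) - l * δ * (q₂ - ⌊q₂ / δ⌋ * δ)) / ε⌋]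

/-- The key of the tangent plane of a sphere over a corner of the grid. -/
noncomputable def sphereLookup (δ ε R p₀ p₁ p₂ sg : ℝ) (i j e : ℤ) : List ℤ :=
  [i, j, ⌊(p₁ - i * δ) / sphereHeight R (i * δ - p₁) (j * δ - p₂) sg / δ⌋,
    ⌊(p₂ - j * δ) / sphereHeight R (i * δ - p₁) (j * δ - p₂) sg / δ⌋,
    ⌊(p₀ + sphereHeight R (i * δ - p₁) (j * δ - p₂) sg) / ε⌋ + e]

/-- The tangent plane of a sphere over a corner of the grid is not steep. -/
def SphereGuard (δ R p₁ p₂ : ℝ) (i j : ℤ) : Prop :=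
  (i * δ - p₁) * (i * δ - p₁) <
      4 * (R - (i * δ - p₁) * (i * δ - p₁) - (j * δ - p₂) * (j * δ - p₂)) ∧
    (j * δ - p₂) * (j * δ - p₂) <
      4 * (R - (i * δ - p₁) * (i * δ - p₁) - (j * δ - p₂) * (j * δ - p₂))

theorem abs_div_le_two_of_sq_lt {x y : ℝ} (h : x ^ 2 < 4 * y ^ 2) : |x / y| ≤ 2 := by
  have hy : y ≠ 0 := by rintro rfl; nlinarith [sq_nonneg x]
  rw [abs_div, div_le_iff₀ (abs_pos.2 hy)]
  apply abs_le_of_sq_le_sq' _ (by positivity) |>.2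
  rw [sq_abs, mul_pow, sq_abs]; linarith

theorem sphereHeight_sq {R a b sg : ℝ} (hsg : sg = 1 ∨ sg = -1) (h : 0 ≤ R - a * a - b * b) :
    sphereHeight R a b sg ^ 2 = R - a * a - b * b := by
  have hsg2 : sg ^ 2 = 1 := by rcases hsg with h | h <;> rw [h] <;> norm_num
  rw [sphereHeight, mul_pow, hsg2, Real.sq_sqrt h, one_mul]

/-- The strict inequalities force the radicand to be positive, so the conventions for roots of
negative numbers and for division by zero play no role. -/
theorem SphereGuard.bounds {δ R p₁ p₂ sg : ℝ} {i j : ℤ} (h : SphereGuard δ R p₁ p₂ i j)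
    (hsg : sg = 1 ∨ sg = -1) :
    sphereHeight R (i * δ - p₁) (j * δ - p₂) sg ^ 2 =
        R - (i * δ - p₁) * (i * δ - p₁) - (j * δ - p₂) * (j * δ - p₂) ∧
      sphereHeight R (i * δ - p₁) (j * δ - p₂) sg ≠ 0 ∧
      |(p₁ - i * δ) / sphereHeight R (i * δ - p₁) (j * δ - p₂) sg| ≤ 2 ∧
      |(p₂ - j * δ) / sphereHeight R (i * δ - p₁) (j * δ - p₂) sg| ≤ 2 := by
  have h0 : 0 < R - (i * δ - p₁) * (i * δ - p₁) - (j * δ - p₂) * (j * δ - p₂) := by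
    have := h.1
    nlinarith [mul_self_nonneg (i * δ - p₁)]
  have h1 := sphereHeight_sq hsg h0.le
  refine ⟨h1, ?_, ?_, ?_⟩
  · intro hz; rw [hz] at h1; norm_num at h1; linarith
  · apply abs_div_le_two_of_sq_lt
    rw [h1]; have := h.1; nlinarith
  · apply abs_div_le_two_of_sq_lt
    rw [h1]; have := h.2; nlinarith

/-- An error of at most `η` in the slope acts over a length of at most `δ`; this dictates `η * δ =
ε`. -/
theorem abs_mul_sub_floor_le {m η l δ ε : ℝ} (hη : 0 < η) (hl : 0 ≤ l) (hl' : l ≤ δ)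
    (hε : η * δ = ε) : |m * l - ⌊m / η⌋ * η * l| ≤ 1 * ε := by
  obtain ⟨h1, h2⟩ := sub_floor_mul_mem (x := m) hη
  rw [← sub_mul, one_mul, ← hε]
  refine abs_mul_le_mul ?_ (by rwa [abs_of_nonneg hl])
  rwa [abs_of_nonneg h1]

/-- Soundness of a hit. In `E + 3`, comparing rounded offsets accounts for `E + 1`, and each of the
two rounded slopes for `1`. -/
theorem near_sphere_of_lookup {δ ε r p₀ p₁ p₂ q₀ q₁ q₂ sg : ℝ} {i j e k l : ℤ} {E : ℕ}
    (hδ : 0 < δ) (hε : ε ≤ 1 / 2) (hδε : δ * δ = ε) (hr : |r| ≤ 1 / 2) (hsg : sg = 1 ∨ sg = -1)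
    (he : |e| ≤ E) (hg : SphereGuard δ (r ^ 2) p₁ p₂ i j)
    (h : sphereKey δ ε q₀ q₁ q₂ k l = sphereLookup δ ε (r ^ 2) p₀ p₁ p₂ sg i j e) :
    |(q₀ - p₀) ^ 2 + (q₁ - p₁) ^ 2 + (q₂ - p₂) ^ 2 - r ^ 2| ≤
      (((E : ℝ) + 3) ^ 2 + (E + 3) + 34) * ε := by
  have hε0 : 0 < ε := by rw [← hδε]; positivity
  obtain ⟨g1, g2, g3, g4⟩ := hg.bounds (sg := sg) hsg
  simp only [sphereKey, sphereLookup, List.cons.injEq, and_true] at h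
  obtain ⟨rfl, rfl, hk, hl, hb⟩ := h
  obtain ⟨a1, a2⟩ := sub_floor_mul_mem (x := q₁) hδ
  obtain ⟨b1, b2⟩ := sub_floor_mul_mem (x := q₂) hδ
  set y := sphereHeight (r ^ 2) (⌊q₁ / δ⌋ * δ - p₁) (⌊q₂ / δ⌋ * δ - p₂) sg
  set m₁ := (p₁ - ⌊q₁ / δ⌋ * δ) / y with hm₁
  set m₂ := (p₂ - ⌊q₂ / δ⌋ * δ) / y with hm₂
  set l₁ := q₁ - ⌊q₁ / δ⌋ * δ with hl₁
  set l₂ := q₂ - ⌊q₂ / δ⌋ * δ with hl₂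
  have hω := abs_sub_le_of_floor_eq hε0 he hb
  have f1 := abs_mul_sub_floor_le (m := m₁) hδ a1 a2 hδε
  have f2 := abs_mul_sub_floor_le (m := m₂) hδ b1 b2 hδε
  rw [← hk] at f1
  rw [← hl] at f2
  have hω' : |q₀ - p₀ - y - (m₁ * l₁ + m₂ * l₂)| ≤ ((E : ℝ) + 3) * ε := by
    rw [abs_le] at *
    constructor <;> linarith
  have := abs_normSq_sub_le_of_tangent_plane hε0.le hε hr
    (show y ^ 2 + (⌊q₁ / δ⌋ * δ - p₁) ^ 2 + (⌊q₂ / δ⌋ * δ - p₂) ^ 2 = r ^ 2 by rw [g1]; ring)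
    (show m₁ * y = -(⌊q₁ / δ⌋ * δ - p₁) by rw [hm₁]; field_simp; ring)
    (show m₂ * y = -(⌊q₂ / δ⌋ * δ - p₂) by rw [hm₂]; field_simp; ring) g3 g4
    (show l₁ ^ 2 ≤ ε by rw [← hδε, ← sq]; exact pow_le_pow_left₀ a1 a2 2)
    (show l₂ ^ 2 ≤ ε by rw [← hδε, ← sq]; exact pow_le_pow_left₀ b1 b2 2) hω'
  refine le_of_eq_of_le ?_ this
  congr 1
  rw [hl₁, hl₂]
  ring

/-- Completeness. The curvature accounts for `sphereConst β`, the rounding of two slopes for `2` and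
that of the offset for `1`, so shifts up to `E` suffice. The hemisphere is given by the sign of `q₀
- p₀`. -/
theorem lookup_of_near_sphere {β δ ε r p₀ p₁ p₂ q₀ q₁ q₂ : ℝ} {E : ℕ} (hβ : 0 < β) (hβr : β ≤ r)
    (hr : r ≤ 1 / 2) (hδ : 0 < δ) (hδβ : δ ≤ β ^ 2 / 200) (hδε : δ * δ = ε)
    (hE : sphereConst β + 3 ≤ E)
    (hρ : |(q₀ - p₀) ^ 2 + (q₁ - p₁) ^ 2 + (q₂ - p₂) ^ 2 - r ^ 2| ≤ 2 * ε)
    (h₁ : (q₁ - p₁) ^ 2 ≤ (q₀ - p₀) ^ 2) (h₂ : (q₂ - p₂) ^ 2 ≤ (q₀ - p₀) ^ 2) :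
    ∃ (sg : ℝ) (e k l : ℤ), (sg = 1 ∨ sg = -1) ∧ |e| ≤ E ∧ |(k : ℝ)| ≤ 2 / δ + 1 ∧
      |(l : ℝ)| ≤ 2 / δ + 1 ∧ SphereGuard δ (r ^ 2) p₁ p₂ ⌊q₁ / δ⌋ ⌊q₂ / δ⌋ ∧
      sphereKey δ ε q₀ q₁ q₂ k l =
        sphereLookup δ ε (r ^ 2) p₀ p₁ p₂ sg ⌊q₁ / δ⌋ ⌊q₂ / δ⌋ e := by
  have hε0 : 0 < ε := by rw [← hδε]; positivity
  obtain ⟨a1, a2⟩ := sub_floor_mul_mem (x := q₁) hδ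
  obtain ⟨b1, b2⟩ := sub_floor_mul_mem (x := q₂) hδ
  obtain ⟨sg, hsg, hsZ⟩ : ∃ sg : ℝ, (sg = 1 ∨ sg = -1) ∧ 0 ≤ sg * (q₀ - p₀) := by
    rcases le_total 0 (q₀ - p₀) with h | h
    · exact ⟨1, Or.inl rfl, by linarith⟩
    · exact ⟨-1, Or.inr rfl, by linarith⟩
  have main := tangent_plane_of_near_sphere hβ hβr hr hδ hδβ (by rw [← hδε]; ring) a1 a2 b1 b2 hρ
    h₁ h₂ hsg hsZ
  rw [show q₁ - p₁ - (q₁ - ⌊q₁ / δ⌋ * δ) = ⌊q₁ / δ⌋ * δ - p₁ by ring,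
    show q₂ - p₂ - (q₂ - ⌊q₂ / δ⌋ * δ) = ⌊q₂ / δ⌋ * δ - p₂ by ring] at main
  obtain ⟨m1, m2, m3⟩ := main
  have hg : SphereGuard δ (r ^ 2) p₁ p₂ ⌊q₁ / δ⌋ ⌊q₂ / δ⌋ := by
    constructor <;> nlinarith
  obtain ⟨g1, g2, g3, g4⟩ := hg.bounds (sg := sg) hsg
  set y := sphereHeight (r ^ 2) (⌊q₁ / δ⌋ * δ - p₁) (⌊q₂ / δ⌋ * δ - p₂) sg with hy
  have hfl : ∀ m : ℝ, |m| ≤ 2 → |((⌊m / δ⌋ : ℤ) : ℝ)| ≤ 2 / δ + 1 := by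
    intro m hm
    have e1 := Int.floor_le (m / δ)
    have e2 := (Int.lt_floor_add_one (m / δ)).le
    have e3 : |m / δ| ≤ 2 / δ := by rw [abs_div, abs_of_pos hδ]; gcongr
    rw [abs_le] at *
    constructor <;> linarith
  have hω := m3 y ((p₁ - ⌊q₁ / δ⌋ * δ) / y) ((p₂ - ⌊q₂ / δ⌋ * δ) / y)
    (by rw [hy, sphereHeight]; ring_nf) (by field_simp; ring) (by field_simp; ring)
  have f1 := abs_mul_sub_floor_le (m := (p₁ - ⌊q₁ / δ⌋ * δ) / y) hδ a1 a2 hδε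
  have f2 := abs_mul_sub_floor_le (m := (p₂ - ⌊q₂ / δ⌋ * δ) / y) hδ b1 b2 hδε
  have hb : |(q₀ - ⌊(p₁ - ⌊q₁ / δ⌋ * δ) / y / δ⌋ * δ * (q₁ - ⌊q₁ / δ⌋ * δ) -
      ⌊(p₂ - ⌊q₂ / δ⌋ * δ) / y / δ⌋ * δ * (q₂ - ⌊q₂ / δ⌋ * δ)) - (p₀ + y)| ≤
      (sphereConst β + 2) * ε := by
    rw [abs_le] at *
    constructor <;> linarith
  obtain ⟨e, he, hfe⟩ := exists_floor_eq (E := E) hε0 (by linarith) hb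
  refine ⟨sg, e, ⌊(p₁ - ⌊q₁ / δ⌋ * δ) / y / δ⌋, ⌊(p₂ - ⌊q₂ / δ⌋ * δ) / y / δ⌋, hsg, he, hfl _ g3,
    hfl _ g4, hg, ?_⟩
  simp only [sphereKey, sphereLookup, ← hy, hfe]

/-- The key of the point `(o₀, o₁, o₂)` for the slopes with indices `j`, `k`. -/
noncomputable def circleKey (δ η ε o₀ o₁ o₂ : ℝ) (j k : ℤ) : List ℤ :=
  [⌊o₀ / δ⌋, j, k, ⌊(o₁ - j * η * (o₀ - ⌊o₀ / δ⌋ * δ)) / ε⌋,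
    ⌊(o₂ - k * η * (o₀ - ⌊o₀ / δ⌋ * δ)) / ε⌋]

/-- The coordinate along `(v₁, v₂)` of the intersection points of a circle, given by the squared
distances `R₁` from the origin and `R₂` from `(v₀, v₁, v₂)`, with the plane at height `h`. -/
noncomputable def circleAlong (R₁ R₂ v₀ v₁ v₂ h : ℝ) : ℝ :=
  ((v₀ * v₀ + v₁ * v₁ + v₂ * v₂ + R₁ - R₂) / 2 - v₀ * h) / (v₁ * v₁ + v₂ * v₂)

/-- The square of the coordinate across `(v₁, v₂)` of the intersection points of a circle with a
plane. -/
noncomputable def circleDisc (R₁ R₂ v₀ v₁ v₂ h : ℝ) : ℝ :=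
  (R₁ - h * h) / (v₁ * v₁ + v₂ * v₂) -
    circleAlong R₁ R₂ v₀ v₁ v₂ h * circleAlong R₁ R₂ v₀ v₁ v₂ h

/-- The coordinate across `(v₁, v₂)` of an intersection point of a circle with a plane. -/
noncomputable def circleAcross (R₁ R₂ v₀ v₁ v₂ h sg : ℝ) : ℝ :=
  sg * √(circleDisc R₁ R₂ v₀ v₁ v₂ h)

/-- The first coordinate in the plane of an intersection point of a circle with a plane. -/
noncomputable def circleFst (R₁ R₂ v₀ v₁ v₂ h sg : ℝ) : ℝ :=
  circleAlong R₁ R₂ v₀ v₁ v₂ h * v₁ - circleAcross R₁ R₂ v₀ v₁ v₂ h sg * v₂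

/-- The second coordinate in the plane of an intersection point of a circle with a plane. -/
noncomputable def circleSnd (R₁ R₂ v₀ v₁ v₂ h sg : ℝ) : ℝ :=
  circleAlong R₁ R₂ v₀ v₁ v₂ h * v₂ + circleAcross R₁ R₂ v₀ v₁ v₂ h sg * v₁

/-- The component of the tangent of a circle in the direction of `h`, in an unnormalized form. -/
noncomputable def circleDen (R₁ R₂ v₀ v₁ v₂ h sg : ℝ) : ℝ :=
  circleAcross R₁ R₂ v₀ v₁ v₂ h sg * (v₁ * v₁ + v₂ * v₂)

/-- The first component in the plane of the tangent of a circle, in an unnormalized form. -/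
noncomputable def circleNumFst (R₁ R₂ v₀ v₁ v₂ h sg : ℝ) : ℝ :=
  h * v₂ - v₀ * circleSnd R₁ R₂ v₀ v₁ v₂ h sg

/-- The second component in the plane of the tangent of a circle, in an unnormalized form. -/
noncomputable def circleNumSnd (R₁ R₂ v₀ v₁ v₂ h sg : ℝ) : ℝ :=
  v₀ * circleFst R₁ R₂ v₀ v₁ v₂ h sg - v₁ * h

/-- The key of the tangent line of a circle at an intersection point with a plane. -/
noncomputable def circleLookup (δ η ε R₁ R₂ p₀ p₁ p₂ v₀ v₁ v₂ sg : ℝ) (i e f : ℤ) : List ℤ :=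
  [i, ⌊circleNumFst R₁ R₂ v₀ v₁ v₂ (i * δ - p₀) sg / circleDen R₁ R₂ v₀ v₁ v₂ (i * δ - p₀) sg / η⌋,
    ⌊circleNumSnd R₁ R₂ v₀ v₁ v₂ (i * δ - p₀) sg / circleDen R₁ R₂ v₀ v₁ v₂ (i * δ - p₀) sg / η⌋,
    ⌊(p₁ + circleFst R₁ R₂ v₀ v₁ v₂ (i * δ - p₀) sg) / ε⌋ + e,
    ⌊(p₂ + circleSnd R₁ R₂ v₀ v₁ v₂ (i * δ - p₀) sg) / ε⌋ + f]

/-- The circle intersects the plane, and its tangent is transversal to the plane. -/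
def CircleGuard (R₁ R₂ v₀ v₁ v₂ h sg : ℝ) : Prop :=
  0 < circleDisc R₁ R₂ v₀ v₁ v₂ h ∧
    circleNumFst R₁ R₂ v₀ v₁ v₂ h sg * circleNumFst R₁ R₂ v₀ v₁ v₂ h sg <
      4 * (circleDen R₁ R₂ v₀ v₁ v₂ h sg * circleDen R₁ R₂ v₀ v₁ v₂ h sg) ∧
    circleNumSnd R₁ R₂ v₀ v₁ v₂ h sg * circleNumSnd R₁ R₂ v₀ v₁ v₂ h sg <
      4 * (circleDen R₁ R₂ v₀ v₁ v₂ h sg * circleDen R₁ R₂ v₀ v₁ v₂ h sg)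

/-- The direction `(1, τ₁, τ₂)`, with `τ₁`, `τ₂` the two quotients, is proportional to the cross
product of `(v₀, v₁, v₂)` with the position of the intersection point. It is therefore orthogonal to
both, that is, tangent to both spheres. The guard excludes vanishing denominators and negative
radicands. -/
theorem CircleGuard.facts {R₁ R₂ v₀ v₁ v₂ h sg : ℝ} (hg : CircleGuard R₁ R₂ v₀ v₁ v₂ h sg)
    (hsg : sg = 1 ∨ sg = -1) :
    h ^ 2 + circleFst R₁ R₂ v₀ v₁ v₂ h sg ^ 2 + circleSnd R₁ R₂ v₀ v₁ v₂ h sg ^ 2 = R₁ ∧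
    v₀ * h + v₁ * circleFst R₁ R₂ v₀ v₁ v₂ h sg + v₂ * circleSnd R₁ R₂ v₀ v₁ v₂ h sg =
      (v₀ ^ 2 + v₁ ^ 2 + v₂ ^ 2 + R₁ - R₂) / 2 ∧
    v₀ + v₁ * (circleNumFst R₁ R₂ v₀ v₁ v₂ h sg / circleDen R₁ R₂ v₀ v₁ v₂ h sg) +
      v₂ * (circleNumSnd R₁ R₂ v₀ v₁ v₂ h sg / circleDen R₁ R₂ v₀ v₁ v₂ h sg) = 0 ∧
    h + circleFst R₁ R₂ v₀ v₁ v₂ h sg *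
        (circleNumFst R₁ R₂ v₀ v₁ v₂ h sg / circleDen R₁ R₂ v₀ v₁ v₂ h sg) +
      circleSnd R₁ R₂ v₀ v₁ v₂ h sg *
        (circleNumSnd R₁ R₂ v₀ v₁ v₂ h sg / circleDen R₁ R₂ v₀ v₁ v₂ h sg) = 0 ∧
    |circleNumFst R₁ R₂ v₀ v₁ v₂ h sg / circleDen R₁ R₂ v₀ v₁ v₂ h sg| ≤ 2 ∧
    |circleNumSnd R₁ R₂ v₀ v₁ v₂ h sg / circleDen R₁ R₂ v₀ v₁ v₂ h sg| ≤ 2 := by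
  obtain ⟨g1, g2, g3⟩ := hg
  have t1 : |circleNumFst R₁ R₂ v₀ v₁ v₂ h sg / circleDen R₁ R₂ v₀ v₁ v₂ h sg| ≤ 2 :=
    abs_div_le_two_of_sq_lt (by linarith)
  have t2 : |circleNumSnd R₁ R₂ v₀ v₁ v₂ h sg / circleDen R₁ R₂ v₀ v₁ v₂ h sg| ≤ 2 :=
    abs_div_le_two_of_sq_lt (by linarith)
  have hden : circleDen R₁ R₂ v₀ v₁ v₂ h sg ≠ 0 := by
    intro h0; rw [h0] at g2; nlinarith [mul_self_nonneg (circleNumFst R₁ R₂ v₀ v₁ v₂ h sg)]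
  have hw : v₁ * v₁ + v₂ * v₂ ≠ 0 := fun h0 => hden (by rw [circleDen, h0, mul_zero])
  have hsg2 : sg ^ 2 = 1 := by rcases hsg with h | h <;> rw [h] <;> norm_num
  have hμ2 : circleAcross R₁ R₂ v₀ v₁ v₂ h sg ^ 2 = circleDisc R₁ R₂ v₀ v₁ v₂ h := by
    rw [circleAcross, mul_pow, hsg2, Real.sq_sqrt g1.le, one_mul]
  have hκw : circleAlong R₁ R₂ v₀ v₁ v₂ h * (v₁ * v₁ + v₂ * v₂) =
      (v₀ * v₀ + v₁ * v₁ + v₂ * v₂ + R₁ - R₂) / 2 - v₀ * h := by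
    rw [circleAlong]; exact div_mul_cancel₀ _ hw
  have hDw : circleDisc R₁ R₂ v₀ v₁ v₂ h * (v₁ * v₁ + v₂ * v₂) = R₁ - h * h -
      circleAlong R₁ R₂ v₀ v₁ v₂ h ^ 2 * (v₁ * v₁ + v₂ * v₂) := by
    rw [circleDisc, sub_mul, div_mul_cancel₀ _ hw]; ring
  refine ⟨?_, ?_, ?_, ?_, t1, t2⟩
  · rw [circleFst, circleSnd]
    linear_combination (v₁ * v₁ + v₂ * v₂) * hμ2 + hDw
  · rw [circleFst, circleSnd]
    linear_combination hκw
  · field_simp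
    rw [circleDen, circleNumFst, circleNumSnd, circleFst, circleSnd]
    ring
  · field_simp
    rw [circleDen, circleNumFst, circleNumSnd, circleFst, circleSnd]
    ring

/-- The line is tangent to both spheres, so a single estimate, applied to each of them, gives both
distances. In `E + 2`, offsets account for `E + 1` and the one slope involved for `1`. -/
theorem near_circle_of_lookup {δ η ε r₁ r₂ p₀ p₁ p₂ v₀ v₁ v₂ o₀ o₁ o₂ sg : ℝ} {i j k e f : ℤ}
    {E : ℕ} (hδ : 0 < δ) (hη : 0 < η) (hε : ε ≤ 1 / 2) (hηδ : η * δ = ε) (hδε : δ ^ 2 ≤ ε)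
    (hr₁ : |r₁| ≤ 1 / 2) (hr₂ : |r₂| ≤ 1 / 2) (hsg : sg = 1 ∨ sg = -1)
    (he : |e| ≤ E) (hf : |f| ≤ E) (hg : CircleGuard (r₁ ^ 2) (r₂ ^ 2) v₀ v₁ v₂ (i * δ - p₀) sg)
    (h : circleKey δ η ε o₀ o₁ o₂ j k =
      circleLookup δ η ε (r₁ ^ 2) (r₂ ^ 2) p₀ p₁ p₂ v₀ v₁ v₂ sg i e f) :
    |(o₀ - p₀) ^ 2 + (o₁ - p₁) ^ 2 + (o₂ - p₂) ^ 2 - r₁ ^ 2| ≤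
      (2 * ((E : ℝ) + 2) ^ 2 + 2 * (E + 2) + 17) * ε ∧
    |(o₀ - p₀ - v₀) ^ 2 + (o₁ - p₁ - v₁) ^ 2 + (o₂ - p₂ - v₂) ^ 2 - r₂ ^ 2| ≤
      (2 * ((E : ℝ) + 2) ^ 2 + 2 * (E + 2) + 17) * ε := by
  have hε0 : 0 < ε := by rw [← hηδ]; positivity
  obtain ⟨g1, g2, g3, g4, g5, g6⟩ := hg.facts hsg
  simp only [circleKey, circleLookup, List.cons.injEq, and_true] at h
  obtain ⟨rfl, hj, hk, hb₁, hb₂⟩ := h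
  obtain ⟨a1, a2⟩ := sub_floor_mul_mem (x := o₀) hδ
  set x₁ := circleFst (r₁ ^ 2) (r₂ ^ 2) v₀ v₁ v₂ (⌊o₀ / δ⌋ * δ - p₀) sg
  set x₂ := circleSnd (r₁ ^ 2) (r₂ ^ 2) v₀ v₁ v₂ (⌊o₀ / δ⌋ * δ - p₀) sg
  set τ₁ := circleNumFst (r₁ ^ 2) (r₂ ^ 2) v₀ v₁ v₂ (⌊o₀ / δ⌋ * δ - p₀) sg /
    circleDen (r₁ ^ 2) (r₂ ^ 2) v₀ v₁ v₂ (⌊o₀ / δ⌋ * δ - p₀) sg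
  set τ₂ := circleNumSnd (r₁ ^ 2) (r₂ ^ 2) v₀ v₁ v₂ (⌊o₀ / δ⌋ * δ - p₀) sg /
    circleDen (r₁ ^ 2) (r₂ ^ 2) v₀ v₁ v₂ (⌊o₀ / δ⌋ * δ - p₀) sg
  set l := o₀ - ⌊o₀ / δ⌋ * δ with hl
  have c1 := abs_sub_le_of_floor_eq hε0 he hb₁
  have c2 := abs_sub_le_of_floor_eq hε0 hf hb₂
  have f1 := abs_mul_sub_floor_le (m := τ₁) hη a1 a2 hηδ
  have f2 := abs_mul_sub_floor_le (m := τ₂) hη a1 a2 hηδ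
  rw [← hj] at f1
  rw [← hk] at f2
  have hω₁ : |o₁ - p₁ - x₁ - τ₁ * l| ≤ ((E : ℝ) + 2) * ε := by
    rw [abs_le] at *
    constructor <;> linarith
  have hω₂ : |o₂ - p₂ - x₂ - τ₂ * l| ≤ ((E : ℝ) + 2) * ε := by
    rw [abs_le] at *
    constructor <;> linarith
  have hl2 : l ^ 2 ≤ ε := (pow_le_pow_left₀ a1 a2 2).trans hδε
  constructor
  · have := abs_normSq_sub_le_of_tangent_line hε0.le hε hr₁ g1 g4 g5 g6 hl2 hω₁ hω₂
    refine le_of_eq_of_le ?_ this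
    congr 1
    rw [hl]
    ring
  -- Now with the origin moved to the second center: `g1 - 2 * g2` puts the intersection point on
  -- the second sphere, and `g4 - g3` is tangency there.
  · have := abs_normSq_sub_le_of_tangent_line hε0.le hε hr₂
      (X₀ := ⌊o₀ / δ⌋ * δ - p₀ - v₀) (X₁ := x₁ - v₁) (X₂ := x₂ - v₂)
      (by linear_combination g1 - 2 * g2) (by linear_combination g4 - g3) g5 g6 hl2 hω₁ hω₂
    refine le_of_eq_of_le ?_ this
    congr 1
    rw [hl]
    ring

/-- The curvature accounts for `circleConst c`, the rounded slope for `1` and the rounded offset for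
`1`. -/
theorem lookup_of_near_circle {c δ η ε r₁ r₂ p₀ p₁ p₂ v₀ v₁ v₂ o₀ o₁ o₂ : ℝ} {E : ℕ} (hc : 0 < c)
    (hc1 : c ≤ 1) (hr₁ : 0 ≤ r₁) (hr₁' : r₁ ≤ 1 / 2) (hδ : 0 < δ) (hη : 0 < η)
    (hδc : δ ≤ c ^ 6 / 200) (hε : ε ≤ δ) (hηδ : η * δ = ε) (hδε : δ ^ 2 ≤ ε)
    (hE : circleConst c + 2 ≤ E) (hv : v₀ ^ 2 + v₁ ^ 2 + v₂ ^ 2 ≤ 1)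
    (hO : |(o₀ - p₀) ^ 2 + (o₁ - p₁) ^ 2 + (o₂ - p₂) ^ 2 - r₁ ^ 2| ≤ 2 * ε)
    (hO' : |(o₀ - p₀ - v₀) ^ 2 + (o₁ - p₁ - v₁) ^ 2 + (o₂ - p₂ - v₂) ^ 2 - r₂ ^ 2| ≤ 2 * ε)
    (hG : c ≤ |(o₂ - p₂) * v₁ - (o₁ - p₁) * v₂|)
    (hG₁ : |(o₂ - p₂) * v₀ - (o₀ - p₀) * v₂| ≤ |(o₂ - p₂) * v₁ - (o₁ - p₁) * v₂|)
    (hG₂ : |(o₀ - p₀) * v₁ - (o₁ - p₁) * v₀| ≤ |(o₂ - p₂) * v₁ - (o₁ - p₁) * v₂|) :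
    ∃ (sg : ℝ) (e f j k : ℤ), (sg = 1 ∨ sg = -1) ∧ |e| ≤ E ∧ |f| ≤ E ∧ |(j : ℝ)| ≤ 2 / η + 1 ∧
      |(k : ℝ)| ≤ 2 / η + 1 ∧
      CircleGuard (r₁ ^ 2) (r₂ ^ 2) v₀ v₁ v₂ (⌊o₀ / δ⌋ * δ - p₀) sg ∧
      circleKey δ η ε o₀ o₁ o₂ j k =
        circleLookup δ η ε (r₁ ^ 2) (r₂ ^ 2) p₀ p₁ p₂ v₀ v₁ v₂ sg ⌊o₀ / δ⌋ e f := by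
  have hε0 : 0 < ε := by rw [← hηδ]; positivity
  obtain ⟨a1, a2⟩ := sub_floor_mul_mem (x := o₀) hδ
  obtain ⟨sg, hsg, hsG⟩ : ∃ sg : ℝ, (sg = 1 ∨ sg = -1) ∧
      0 ≤ sg * ((o₂ - p₂) * v₁ - (o₁ - p₁) * v₂) := by
    rcases le_total 0 ((o₂ - p₂) * v₁ - (o₁ - p₁) * v₂) with h | h
    · exact ⟨1, Or.inl rfl, by linarith⟩
    · exact ⟨-1, Or.inr rfl, by linarith⟩
  have hh : o₀ - p₀ = (⌊o₀ / δ⌋ * δ - p₀) + (o₀ - ⌊o₀ / δ⌋ * δ) := by ring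
  set h := ⌊o₀ / δ⌋ * δ - p₀ with hdef
  set l := o₀ - ⌊o₀ / δ⌋ * δ with hl
  rw [hh] at hO hO' hG₁ hG₂
  have hw : v₁ * v₁ + v₂ * v₂ = v₁ ^ 2 + v₂ ^ 2 := by ring
  have main := tangent_line_of_near_circle hc hc1 hr₁ hr₁' hδ hδc hε0 hε hδε a1 a2 hv hO hO' hG
    hG₁ hG₂ hsg hsG (v₁ * v₁ + v₂ * v₂) (circleAlong (r₁ ^ 2) (r₂ ^ 2) v₀ v₁ v₂ h)
    (circleDisc (r₁ ^ 2) (r₂ ^ 2) v₀ v₁ v₂ h) (circleAcross (r₁ ^ 2) (r₂ ^ 2) v₀ v₁ v₂ h sg)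
    (circleFst (r₁ ^ 2) (r₂ ^ 2) v₀ v₁ v₂ h sg) (circleSnd (r₁ ^ 2) (r₂ ^ 2) v₀ v₁ v₂ h sg) hw
    (by rw [circleAlong]; ring) (by rw [circleDisc]; ring) rfl rfl rfl
  obtain ⟨m1, m2, m3, m4, m5⟩ := main
  have hg : CircleGuard (r₁ ^ 2) (r₂ ^ 2) v₀ v₁ v₂ h sg := by
    refine ⟨m1, ?_, ?_⟩
    · rw [← sq, ← sq]; exact m2
    · rw [← sq, ← sq]; exact m3
  obtain ⟨-, -, -, -, g5, g6⟩ := hg.facts hsg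
  change |_ - _ - circleNumFst (r₁ ^ 2) (r₂ ^ 2) v₀ v₁ v₂ h sg /
    circleDen (r₁ ^ 2) (r₂ ^ 2) v₀ v₁ v₂ h sg * _| ≤ _ at m4
  change |_ - _ - circleNumSnd (r₁ ^ 2) (r₂ ^ 2) v₀ v₁ v₂ h sg /
    circleDen (r₁ ^ 2) (r₂ ^ 2) v₀ v₁ v₂ h sg * _| ≤ _ at m5
  set x₁ := circleFst (r₁ ^ 2) (r₂ ^ 2) v₀ v₁ v₂ h sg with hx₁
  set x₂ := circleSnd (r₁ ^ 2) (r₂ ^ 2) v₀ v₁ v₂ h sg with hx₂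
  set τ₁ := circleNumFst (r₁ ^ 2) (r₂ ^ 2) v₀ v₁ v₂ h sg /
    circleDen (r₁ ^ 2) (r₂ ^ 2) v₀ v₁ v₂ h sg with hτ₁
  set τ₂ := circleNumSnd (r₁ ^ 2) (r₂ ^ 2) v₀ v₁ v₂ h sg /
    circleDen (r₁ ^ 2) (r₂ ^ 2) v₀ v₁ v₂ h sg with hτ₂
  have hfl : ∀ m : ℝ, |m| ≤ 2 → |((⌊m / η⌋ : ℤ) : ℝ)| ≤ 2 / η + 1 := by
    intro m hm
    have e1 := Int.floor_le (m / η)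
    have e2 := (Int.lt_floor_add_one (m / η)).le
    have e3 : |m / η| ≤ 2 / η := by rw [abs_div, abs_of_pos hη]; gcongr
    rw [abs_le] at *
    constructor <;> linarith
  have f1 := abs_mul_sub_floor_le (m := τ₁) hη a1 a2 hηδ
  have f2 := abs_mul_sub_floor_le (m := τ₂) hη a1 a2 hηδ
  have hb₁ : |(o₁ - ⌊τ₁ / η⌋ * η * l) - (p₁ + x₁)| ≤ (circleConst c + 1) * ε := by
    rw [abs_le] at *
    constructor <;> linarith
  have hb₂ : |(o₂ - ⌊τ₂ / η⌋ * η * l) - (p₂ + x₂)| ≤ (circleConst c + 1) * ε := by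
    rw [abs_le] at *
    constructor <;> linarith
  obtain ⟨e, he, hfe⟩ := exists_floor_eq (E := E) hε0 (by linarith) hb₁
  obtain ⟨f, hf, hff⟩ := exists_floor_eq (E := E) hε0 (by linarith) hb₂
  refine ⟨sg, e, f, ⌊τ₁ / η⌋, ⌊τ₂ / η⌋, hsg, he, hf, hfl _ g5, hfl _ g6, hg, ?_⟩
  simp only [circleKey, circleLookup, ← hdef, ← hl, ← hx₁, ← hx₂, ← hτ₁, ← hτ₂, hfe, hff]

end NearTriangles

/-! ### From coordinates to distances, and the choice of the axis -/

namespace NearTriangles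

/-- Indices in `Fin 3` are cyclic, so one computation with the axes `t`, `t + 1`, `t + 2` covers all
three directions. -/
theorem sum_axes (t : Fin 3) (f : Fin 3 → ℝ) : f t + f (t + 1) + f (t + 2) = f 0 + f 1 + f 2 := by
  fin_cases t
  · rfl
  · change f 1 + f 2 + f 0 = _; ring
  · change f 2 + f 0 + f 1 = _; ring

theorem dist_sq_axes (P Q : Pt) (t : Fin 3) :
    dist P Q ^ 2 = (P t - Q t) ^ 2 + (P (t + 1) - Q (t + 1)) ^ 2 + (P (t + 2) - Q (t + 2)) ^ 2 := by
  rw [sum_axes t fun i => (P i - Q i) ^ 2, EuclideanSpace.dist_eq, Real.sq_sqrt (by positivity),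
    Fin.sum_univ_three]
  simp [Real.dist_eq, sq_abs]

theorem abs_coord_le_one {P : Pt} (h : ‖P‖ ≤ 1) (t : Fin 3) : |P t| ≤ 1 :=
  (PiLp.norm_apply_le P t).trans h

theorem NearDist.sq {d δ : ℝ} {p q : Pt} (h : NearDist d δ p q) (hd0 : 0 ≤ d) (hd : d ≤ 1 / 2)
    (hδ : δ ≤ 1 / 2) : |dist p q ^ 2 - d ^ 2| ≤ 2 * δ := by
  have h0 := dist_nonneg (x := p) (y := q)
  unfold NearDist at h
  have h1 : dist p q ^ 2 - d ^ 2 = (dist p q - d) * (dist p q + d) := by ring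
  have h2 : |dist p q + d| ≤ 2 := by
    rw [abs_of_nonneg (by linarith)]; linarith [(abs_le.1 h).2]
  rw [h1]
  linarith [abs_mul_le_mul h h2]

theorem nearDist_of_sq {d b δ K : ℝ} {p q : Pt} (hb : 0 < b) (hd : b ≤ d)
    (h : |dist p q ^ 2 - d ^ 2| ≤ K * δ) : NearDist d (K / b * δ) p q := by
  have h0 := dist_nonneg (x := p) (y := q)
  unfold NearDist
  have h1 : dist p q ^ 2 - d ^ 2 = (dist p q - d) * (dist p q + d) := by ring
  rw [h1, abs_mul, abs_of_nonneg (by linarith : 0 ≤ dist p q + d)] at h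
  rw [div_mul_eq_mul_div, le_div_iff₀ hb]
  refine le_trans ?_ h
  gcongr
  linarith

/-- The constant in `nearDist_of_sphere_lookup`. -/
noncomputable def pairConst (β : ℝ) (E : ℕ) : ℝ := (((E : ℝ) + 3) ^ 2 + (E + 3) + 34) / β

theorem nearDist_of_sphere_lookup {β δ ε r sg : ℝ} {P Q : Pt} {t : Fin 3} {i j e k l : ℤ} {E : ℕ}
    (hβ : 0 < β) (hβr : β ≤ r) (hδ : 0 < δ) (hε : ε ≤ 1 / 2) (hδε : δ * δ = ε) (hr : r ≤ 1 / 2)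
    (hsg : sg = 1 ∨ sg = -1) (he : |e| ≤ E) (hg : SphereGuard δ (r ^ 2) (P (t + 1)) (P (t + 2)) i j)
    (h : sphereKey δ ε (Q t) (Q (t + 1)) (Q (t + 2)) k l =
      sphereLookup δ ε (r ^ 2) (P t) (P (t + 1)) (P (t + 2)) sg i j e) :
    NearDist r (pairConst β E * ε) P Q := by
  apply nearDist_of_sq hβ hβr
  rw [dist_comm, dist_sq_axes Q P t]
  exact near_sphere_of_lookup hδ hε hδε (by rwa [abs_of_nonneg (hβ.le.trans hβr)]) hsg he hg h

/-- Applied to the squared coordinates of `Q - P` and to the components of a cross product, this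
yields slopes of at most about `1`, which leaves room below the bound `2` of the guards. -/
theorem exists_axis (f : Fin 3 → ℝ) : ∃ t, f (t + 1) ≤ f t ∧ f (t + 2) ≤ f t := by
  obtain ⟨t, ht⟩ := Finite.exists_max f
  exact ⟨t, ht _, ht _⟩

theorem exists_sphere_lookup {β δ ε r : ℝ} {P Q : Pt} {E : ℕ} (hβ : 0 < β) (hβr : β ≤ r)
    (hr : r ≤ 1 / 2) (hδ : 0 < δ) (hε : ε ≤ 1 / 2) (hδβ : δ ≤ β ^ 2 / 200) (hδε : δ * δ = ε)
    (hE : sphereConst β + 3 ≤ E) (h : NearDist r ε P Q) :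
    ∃ (t : Fin 3) (sg : ℝ) (e k l : ℤ), (sg = 1 ∨ sg = -1) ∧ |e| ≤ E ∧ |(k : ℝ)| ≤ 2 / δ + 1 ∧
      |(l : ℝ)| ≤ 2 / δ + 1 ∧
      SphereGuard δ (r ^ 2) (P (t + 1)) (P (t + 2)) ⌊Q (t + 1) / δ⌋ ⌊Q (t + 2) / δ⌋ ∧
      sphereKey δ ε (Q t) (Q (t + 1)) (Q (t + 2)) k l =
        sphereLookup δ ε (r ^ 2) (P t) (P (t + 1)) (P (t + 2)) sg ⌊Q (t + 1) / δ⌋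
          ⌊Q (t + 2) / δ⌋ e := by
  obtain ⟨t, h1, h2⟩ := exists_axis fun t => (Q t - P t) ^ 2
  have hn := h.sq (hβ.le.trans hβr) hr hε
  rw [dist_comm, dist_sq_axes Q P t] at hn
  exact ⟨t, lookup_of_near_sphere hβ hβr hr hδ hδβ hδε hE hn h1 h2⟩

/-- The right-hand side is the Gram determinant of `b - a` and `c - a`, hence `|ab|²` times the
squared distance of `c` from the foot of its perpendicular on the line `ab`. -/
theorem IsFat.height_sq_le {β s : ℝ} {a b c : Pt} (h : IsFat β s a b c) (hβ : 0 < β) (hs : 0 < s) :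
    (β * s) ^ 2 ≤ dist a c ^ 2 * dist a b ^ 2 -
      ((dist a b ^ 2 + dist a c ^ 2 - dist b c ^ 2) / 2) ^ 2 := by
  have hab : 0 < dist a b := hβ.trans_le h.le_ab
  set x := (dist a b ^ 2 + dist a c ^ 2 - dist b c ^ 2) / 2 with hx
  have hinner : inner ℝ (b - a) (c - a) = x := by
    rw [real_inner_eq_norm_mul_self_add_norm_mul_self_sub_norm_sub_mul_self_div_two, hx,
      dist_comm a b, dist_comm a c, dist_eq_norm, dist_eq_norm, dist_eq_norm]
    rw [sub_sub_sub_cancel_right]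
    ring
  have hf : s ≤ dist c (AffineMap.lineMap a b (x / dist a b ^ 2)) :=
    h.le_height.trans (Metric.infDist_le_dist_of_mem (AffineMap.lineMap_mem_affineSpan_pair _ _ _))
  have hfsq : dist c (AffineMap.lineMap a b (x / dist a b ^ 2)) ^ 2 =
      dist a c ^ 2 - x ^ 2 / dist a b ^ 2 := by
    rw [AffineMap.lineMap_apply, dist_eq_norm, vsub_eq_sub, vadd_eq_add,
      show c - ((x / dist a b ^ 2) • (b - a) + a) = (c - a) - (x / dist a b ^ 2) • (b - a) by abel,
      norm_sub_sq_real, norm_smul, inner_smul_right, real_inner_comm, hinner, ← dist_eq_norm,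
      ← dist_eq_norm, dist_comm c a, dist_comm b a, mul_pow, Real.norm_eq_abs, sq_abs]
    field_simp
    ring
  have h1 : s ^ 2 ≤ dist a c ^ 2 - x ^ 2 / dist a b ^ 2 := by
    rw [← hfsq]; exact pow_le_pow_left₀ hs.le hf 2
  have h2 : β ^ 2 ≤ dist a b ^ 2 := pow_le_pow_left₀ hβ.le h.le_ab 2
  calc (β * s) ^ 2 = β ^ 2 * s ^ 2 := by ring
    _ ≤ dist a b ^ 2 * (dist a c ^ 2 - x ^ 2 / dist a b ^ 2) := by gcongr
    _ = _ := by field_simp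

theorem IsFat.le_ac {β s : ℝ} {a b c : Pt} (h : IsFat β s a b c) : s ≤ dist a c := by
  rw [dist_comm]
  exact h.le_height.trans (Metric.infDist_le_dist_of_mem (left_mem_affineSpan_pair ℝ a b))

theorem IsFat.le_bc {β s : ℝ} {a b c : Pt} (h : IsFat β s a b c) : s ≤ dist b c := by
  rw [dist_comm]
  exact h.le_height.trans (Metric.infDist_le_dist_of_mem (right_mem_affineSpan_pair ℝ a b))

/-- The constant in `nearDist_of_circle_lookup`. -/
noncomputable def tripleConst (s : ℝ) (E : ℕ) : ℝ :=
  (2 * ((E : ℝ) + 2) ^ 2 + 2 * (E + 2) + 17) / s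

theorem nearDist_of_circle_lookup {s δ η ε r₁ r₂ sg : ℝ} {P Q O : Pt} {t : Fin 3}
    {i j k e f : ℤ} {E : ℕ} (hs : 0 < s) (hs₁ : s ≤ r₁) (hs₂ : s ≤ r₂) (hr₁ : r₁ ≤ 1 / 2)
    (hr₂ : r₂ ≤ 1 / 2) (hδ : 0 < δ) (hη : 0 < η) (hε : ε ≤ 1 / 2) (hηδ : η * δ = ε)
    (hδε : δ ^ 2 ≤ ε) (hsg : sg = 1 ∨ sg = -1) (he : |e| ≤ E) (hf : |f| ≤ E)
    (hg : CircleGuard (r₁ ^ 2) (r₂ ^ 2) (Q t - P t) (Q (t + 1) - P (t + 1)) (Q (t + 2) - P (t + 2))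
      (i * δ - P t) sg)
    (h : circleKey δ η ε (O t) (O (t + 1)) (O (t + 2)) j k =
      circleLookup δ η ε (r₁ ^ 2) (r₂ ^ 2) (P t) (P (t + 1)) (P (t + 2)) (Q t - P t)
        (Q (t + 1) - P (t + 1)) (Q (t + 2) - P (t + 2)) sg i e f) :
    NearDist r₁ (tripleConst s E * ε) P O ∧ NearDist r₂ (tripleConst s E * ε) Q O := by
  obtain ⟨h1, h2⟩ := near_circle_of_lookup hδ hη hε hηδ hδε
    (by rwa [abs_of_nonneg (hs.le.trans hs₁)]) (by rwa [abs_of_nonneg (hs.le.trans hs₂)])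
    hsg he hf hg h
  constructor
  · apply nearDist_of_sq hs hs₁
    rw [dist_comm, dist_sq_axes O P t]
    exact h1
  · apply nearDist_of_sq hs hs₂
    rw [dist_comm, dist_sq_axes O Q t]
    simpa only [sub_sub_sub_cancel_right] using h2

/-- Perturbation of a Gram determinant expressed by squared side lengths. The linear terms
contribute at most `5 / 2 * ε` and the quadratic ones `13 * ε ^ 2`; the constant `10` is generous.
-/
theorem gram_lower_bound {m x y z X Y Z ε : ℝ} (hx : 0 ≤ x) (hx' : x ≤ 1 / 4) (hy : 0 ≤ y)
    (hy' : y ≤ 1 / 4) (hz : 0 ≤ z) (hz' : z ≤ 1 / 4) (hε0 : 0 ≤ ε) (hε : ε ≤ 1 / 40)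
    (hm : m ≤ x * y - ((y + x - z) / 2) ^ 2)
    (hX : |X - x| ≤ 2 * ε) (hY : |Y - y| ≤ 2 * ε) (hZ : |Z - z| ≤ 2 * ε) :
    m - 10 * ε ≤ X * Y - ((Y + X - Z) / 2) ^ 2 := by
  have e1 : |(X - x) * (Y - y)| ≤ 2 * ε * (2 * ε) := abs_mul_le_mul hX hY
  have e2 : |(X - x) * y| ≤ 2 * ε * (1 / 4) :=
    abs_mul_le_mul hX (by rwa [abs_of_nonneg hy])
  have e3 : |(Y - y) * x| ≤ 2 * ε * (1 / 4) :=
    abs_mul_le_mul hY (by rwa [abs_of_nonneg hx])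
  have e4 : |((Y - y) + (X - x) - (Z - z)) / 2| ≤ 3 * ε := by
    rw [abs_le] at *
    constructor <;> linarith
  have e5 : |(y + x - z) / 2| ≤ 1 / 4 := by
    rw [abs_le]
    constructor <;> linarith
  have e6 := abs_mul_le_mul e4 e5
  have e7 := abs_mul_le_mul e4 e4
  have e8 : ε * ε ≤ ε * (1 / 40) := by gcongr
  have key : X * Y - ((Y + X - Z) / 2) ^ 2 = (x * y - ((y + x - z) / 2) ^ 2) +
      (X - x) * (Y - y) + (X - x) * y + (Y - y) * x -
      2 * (((Y - y) + (X - x) - (Z - z)) / 2 * ((y + x - z) / 2)) -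
      ((Y - y) + (X - x) - (Z - z)) / 2 * (((Y - y) + (X - x) - (Z - z)) / 2) := by ring
  rw [key]
  linarith [(abs_le.1 e1).1, (abs_le.1 e2).1, (abs_le.1 e3).1, (abs_le.1 e6).2, (abs_le.1 e7).2]

theorem exists_circle_lookup {β s δ η ε : ℝ} {a b c P Q O : Pt} {E : ℕ} (hβ : 0 < β)
    (hs : 0 < s) (hfat : IsFat β s a b c) (hδ : 0 < δ) (hη : 0 < η)
    (hδc : δ ≤ (β * s / 3) ^ 6 / 200) (hε : ε ≤ δ) (hηδ : η * δ = ε) (hδε : δ ^ 2 ≤ ε)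
    (hεc : ε ≤ (β * s / 3) ^ 2 / 40) (hE : circleConst (β * s / 3) + 2 ≤ E)
    (h : NearCongruent a b c ε P Q O) :
    ∃ (t : Fin 3) (sg : ℝ) (e f j k : ℤ), (sg = 1 ∨ sg = -1) ∧ |e| ≤ E ∧ |f| ≤ E ∧
      |(j : ℝ)| ≤ 2 / η + 1 ∧ |(k : ℝ)| ≤ 2 / η + 1 ∧
      CircleGuard (dist a c ^ 2) (dist b c ^ 2) (Q t - P t) (Q (t + 1) - P (t + 1))
        (Q (t + 2) - P (t + 2)) (⌊O t / δ⌋ * δ - P t) sg ∧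
      circleKey δ η ε (O t) (O (t + 1)) (O (t + 2)) j k =
        circleLookup δ η ε (dist a c ^ 2) (dist b c ^ 2) (P t) (P (t + 1)) (P (t + 2)) (Q t - P t)
          (Q (t + 1) - P (t + 1)) (Q (t + 2) - P (t + 2)) sg ⌊O t / δ⌋ e f := by
  have hε0 : 0 < ε := by rw [← hηδ]; positivity
  set κ := β * s / 3 with hκ
  have hκ0 : 0 < κ := by positivity
  have hab := hfat.ab_le
  have hac := hfat.ac_le.trans hab
  have hbc := hfat.bc_le.trans hab
  have hκ1 : κ ≤ 1 / 12 := by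
    have h1 := hfat.le_ab.trans hab
    have h2 := hfat.le_ac.trans hac
    rw [hκ]; nlinarith
  have hκ2 : κ ^ 2 ≤ 1 := pow_le_one₀ hκ0.le (by linarith)
  have hε1 : ε ≤ 1 / 40 := by linarith
  obtain ⟨n1, n2, n3⟩ := h
  have s1 := n1.sq dist_nonneg hab (by linarith)
  have s2 := n2.sq dist_nonneg hac (by linarith)
  have s3 := n3.sq dist_nonneg hbc (by linarith)
  have hsq : ∀ x : ℝ, 0 ≤ x → x ≤ 1 / 2 → x ^ 2 ≤ 1 / 4 := fun x h0 h1 => by nlinarith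
  have hgram := gram_lower_bound (sq_nonneg (dist a c)) (hsq _ dist_nonneg hac)
    (sq_nonneg (dist a b)) (hsq _ dist_nonneg hab) (sq_nonneg (dist b c)) (hsq _ dist_nonneg hbc)
    hε0.le hε1 (hfat.height_sq_le hβ hs) s2 s1 s3
  -- The components of the cross product of `Q - P` and `O - P`, the tangent direction of the circle
  -- through `O` about the line `PQ`.
  obtain ⟨t, t1, t2⟩ := exists_axis fun t =>
    |(O (t + 2) - P (t + 2)) * (Q (t + 1) - P (t + 1)) -
      (O (t + 1) - P (t + 1)) * (Q (t + 2) - P (t + 2))|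
  have i1 : t + 1 + 1 = t + 2 := by fin_cases t <;> rfl
  have i2 : t + 1 + 2 = t := by fin_cases t <;> rfl
  have i3 : t + 2 + 1 = t := by fin_cases t <;> rfl
  have i4 : t + 2 + 2 = t + 1 := by fin_cases t <;> rfl
  simp only [i1, i2, i3, i4] at t1 t2
  have d1 := dist_sq_axes P Q t
  have d2 := dist_sq_axes P O t
  have d3 := dist_sq_axes Q O t
  rw [d1, d2, d3] at hgram
  rw [d1] at s1
  rw [d2] at s2
  rw [d3] at s3
  set v₀ := Q t - P t with hv₀
  set v₁ := Q (t + 1) - P (t + 1) with hv₁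
  set v₂ := Q (t + 2) - P (t + 2) with hv₂
  set w₀ := O t - P t with hw₀
  set w₁ := O (t + 1) - P (t + 1) with hw₁
  set w₂ := O (t + 2) - P (t + 2) with hw₂
  -- The largest of three squares is at least a third of their sum, which is at least `9 * κ ^ 2 -
  -- 10 * ε`; and `10 * ε ≤ κ ^ 2 / 4`.
  have hc : κ ≤ |w₂ * v₁ - w₁ * v₂| := by
    apply abs_le_of_sq_le_sq' _ (abs_nonneg _) |>.2
    have q1 : (w₀ * v₂ - w₂ * v₀) ^ 2 ≤ |w₂ * v₁ - w₁ * v₂| ^ 2 := by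
      rw [← sq_abs]; exact pow_le_pow_left₀ (abs_nonneg _) t1 2
    have q2 : (w₁ * v₀ - w₀ * v₁) ^ 2 ≤ |w₂ * v₁ - w₁ * v₂| ^ 2 := by
      rw [← sq_abs]; exact pow_le_pow_left₀ (abs_nonneg _) t2 2
    have q3 : 9 * κ ^ 2 = (β * s) ^ 2 := by rw [hκ]; ring
    have q4 : (w₀ * v₂ - w₂ * v₀) ^ 2 + (w₁ * v₀ - w₀ * v₁) ^ 2 + (w₂ * v₁ - w₁ * v₂) ^ 2 ≥
        (β * s) ^ 2 - 10 * ε := by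
      refine hgram.trans (le_of_eq ?_)
      rw [hv₀, hv₁, hv₂, hw₀, hw₁, hw₂]
      ring
    rw [← sq_abs (w₂ * v₁ - w₁ * v₂)] at q4
    have q5 : 0 < κ ^ 2 := by positivity
    linarith
  have hv : v₀ ^ 2 + v₁ ^ 2 + v₂ ^ 2 ≤ 1 := by
    have := (abs_le.1 s1).2
    have h5 := hsq _ dist_nonneg hab
    rw [hv₀, hv₁, hv₂]
    linarith
  refine ⟨t, lookup_of_near_circle hκ0 (by linarith) dist_nonneg hac hδ hη hδc hε hηδ hδε hE
    hv ?_ ?_ hc ?_ ?_⟩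
  · refine le_of_eq_of_le ?_ s2
    congr 1; ring
  · refine le_of_eq_of_le ?_ s3
    congr 1; ring
  · rw [abs_sub_comm]; exact t1
  · rw [abs_sub_comm]; exact t2

end NearTriangles

/-! ### Expressions for loop ranges and key bases; counting multiplicities -/

namespace RealRAM

instance : Add Expr := ⟨Expr.add⟩
instance : Sub Expr := ⟨Expr.sub⟩
instance : Mul Expr := ⟨Expr.mul⟩
instance : Div Expr := ⟨Expr.div⟩

section Eval

variable (σ : State) (e f : Expr)

@[simp] theorem Expr.eval_add : (e + f).eval σ = e.eval σ + f.eval σ := rfl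
@[simp] theorem Expr.eval_sub : (e - f).eval σ = e.eval σ - f.eval σ := rfl
@[simp] theorem Expr.eval_mul : (e * f).eval σ = e.eval σ * f.eval σ := rfl
@[simp] theorem Expr.eval_div : (e / f).eval σ = e.eval σ / f.eval σ := rfl
@[simp] theorem Expr.eval_floor : (Expr.floor e).eval σ = (⌊e.eval σ⌋ : ℝ) := rfl
@[simp] theorem Expr.eval_const (z : ℤ) : (Expr.const z).eval σ = (z : ℝ) := rfl

end Eval

theorem arrayOf_natCast {m : ℕ} (f : Fin m → ℝ) (i : Fin m) : arrayOf f ((i : ℕ) : ℤ) = f i := by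
  simp [arrayOf]

/-- The expression `2 * w + 1`. -/
def spanE (w : Expr) : Expr := .const 2 * w + .const 1

theorem eval_spanE {σ : State} {w : Expr} {m : ℕ} (h : w.eval σ = m) :
    (spanE w).eval σ = (2 * m + 1 : ℕ) := by
  simp [spanE, h]

/-- The expression `⌊c / η⌋ + 1`. -/
def widthE (c : ℤ) (η : Expr) : Expr := .floor (.const c / η) + .const 1

/-- The number `⌊c / η⌋ + 1`. -/
noncomputable def width (c η : ℝ) : ℕ := ⌊c / η⌋₊ + 1

theorem eval_widthE {σ : State} {c : ℕ} {ηE : Expr} {η : ℝ} (hη : 0 < η) (h : ηE.eval σ = η) :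
    (widthE c ηE).eval σ = width c η := by
  have : 0 ≤ (c : ℝ) / η := by positivity
  simp [widthE, width, h, natCast_floor_eq_intCast_floor this]

theorem lt_width {c η : ℝ} : c / η < width c η := by
  unfold width; push_cast; exact Nat.lt_floor_add_one _

theorem width_le {c η : ℝ} (hc : 0 ≤ c) (hη : 0 < η) : (width c η : ℝ) ≤ c / η + 1 := by
  unfold width; push_cast
  have := Nat.floor_le (div_nonneg hc hη.le)
  linarith

/-- The integer represented by an index in a range centered at `w`. -/
def centered (w : ℕ) (i : Fin (2 * w + 1)) : ℤ := ((i : ℕ) : ℤ) - w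

theorem centered_injective {w : ℕ} {i j : Fin (2 * w + 1)} (h : centered w i = centered w j) :
    i = j := by
  unfold centered at h; ext; omega

theorem abs_centered_le {w : ℕ} (i : Fin (2 * w + 1)) : |centered w i| ≤ w := by
  unfold centered; rw [abs_le]; omega

theorem exists_centered {w : ℕ} {z : ℤ} (h : |z| ≤ w) : ∃ i, centered w i = z := by
  rw [abs_le] at h
  exact ⟨⟨(z + w).toNat, by omega⟩, by simp only [centered]; omega⟩

theorem exists_centered_of_le {w : ℕ} {z : ℤ} {x : ℝ} (h : |(z : ℝ)| ≤ x + 1) (hx : x < w) :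
    ∃ i, centered w i = z := by
  apply exists_centered
  have h1 : |(z : ℝ)| < w + 1 := by linarith
  have : |z| < (w : ℤ) + 1 := by exact_mod_cast h1
  omega

theorem eval_centered {σ : State} {x w : ℕ} {wE : Expr} {i : Fin (2 * w + 1)}
    (hx : σ.reg x = (i : ℕ)) (hw : wE.eval σ = w) :
    (Expr.reg x - wE).eval σ = (centered w i : ℤ) := by
  simp [centered, hw, Expr.eval, hx]

/-- The sign represented by an index. -/
noncomputable def signOf (s : Fin 2) : ℝ := 2 * (s : ℕ) - 1

theorem signOf_eq (s : Fin 2) : signOf s = 1 ∨ signOf s = -1 := by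
  fin_cases s
  · right; norm_num [signOf]
  · left; norm_num [signOf]

theorem exists_signOf {x : ℝ} (h : x = 1 ∨ x = -1) : ∃ s, signOf s = x := by
  rcases h with rfl | rfl
  · exact ⟨1, by norm_num [signOf]⟩
  · exact ⟨0, by norm_num [signOf]⟩

/-- The expression for `signOf`. -/
def signE (x : ℕ) : Expr := .const 2 * .reg x - .const 1

theorem eval_signE {σ : State} {x : ℕ} {s : Fin 2} (h : σ.reg x = (s : ℕ)) :
    (signE x).eval σ = signOf s := by
  simp [signE, signOf, Expr.eval, h]

/-- The base of the positional system that is used for keys. -/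
noncomputable def keyBase (K : ℕ) (ε : ℝ) : ℤ := 2 * ⌊K / ε⌋ + 1

/-- The expression for `keyBase`. -/
def keyBaseE (K : ℕ) (ε : Expr) : Expr := spanE (.floor (.const K / ε))

theorem eval_keyBaseE {σ : State} {K : ℕ} {ε : Expr} :
    (keyBaseE K ε).eval σ = keyBase K (ε.eval σ) := by
  simp [keyBaseE, keyBase, spanE]

theorem validKey_of_abs_le {K : ℕ} {ε : ℝ} {x y z u v : ℤ} (hx : |(x : ℝ)| ≤ K / ε)
    (hy : |(y : ℝ)| ≤ K / ε) (hz : |(z : ℝ)| ≤ K / ε) (hu : |(u : ℝ)| ≤ K / ε)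
    (hv : |(v : ℝ)| ≤ K / ε) : ValidKey (keyBase K ε) [x, y, z, u, v] := by
  have key : ∀ d : ℤ, |(d : ℝ)| ≤ K / ε → 2 * |d| + 1 ≤ keyBase K ε := by
    intro d hd
    have : |d| ≤ ⌊K / ε⌋ := Int.le_floor.2 (by push_cast; exact hd)
    unfold keyBase; omega
  refine ⟨rfl, fun d hd => ?_⟩
  simp only [List.mem_cons, List.not_mem_nil, or_false] at hd
  rcases hd with rfl | rfl | rfl | rfl | rfl <;> exact key _ (by assumption)

theorem abs_floor_le {x y : ℝ} (h : |x| ≤ y) : |((⌊x⌋ : ℤ) : ℝ)| ≤ y + 1 := by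
  have e1 := Int.floor_le x
  have e2 := (Int.lt_floor_add_one x).le
  rw [abs_le] at *
  constructor <;> linarith

theorem abs_floor_div_le {x c η : ℝ} (hη : 0 < η) (h : |x| ≤ c) :
    |((⌊x / η⌋ : ℤ) : ℝ)| ≤ c / η + 1 := by
  apply abs_floor_le
  rw [abs_div, abs_of_pos hη]; gcongr

/-- The finest scale in use is `ε`, so all digits are `O(1/ε)`, and one base serves for cells,
slopes and offsets. -/
theorem div_add_one_le {c η ε : ℝ} {m : ℕ} {K : ℕ} (hc : 0 ≤ c) (hε : 0 < ε) (hεη : ε ≤ η)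
    (hε1 : ε ≤ 1) (h : c + 1 + m ≤ K) : c / η + 1 + m ≤ K / ε := by
  have h1 : c / η ≤ c / ε := by gcongr
  have h2 : 1 + (m : ℝ) ≤ (1 + m) / ε := by
    rw [le_div_iff₀ hε]; nlinarith [Nat.cast_nonneg (α := ℝ) m]
  calc c / η + 1 + m ≤ c / ε + (1 + m) / ε := by linarith
    _ = (c + 1 + m) / ε := by ring
    _ ≤ K / ε := by gcongr

section Counting

variable {X : Type*} [BEq X]

theorem count_flatMap_le {m M : ℕ} (f : Fin m → List X) (x : X) (h : ∀ i, (f i).count x ≤ M) :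
    ((List.finRange m).flatMap f).count x ≤ m * M := by
  rw [List.count_flatMap]
  have := List.sum_le_card_nsmul ((List.finRange m).map (List.count x ∘ f)) M (by
    intro y hy
    obtain ⟨i, -, rfl⟩ := List.mem_map.1 hy
    exact h i)
  simpa using this

/-- For loop indices that `x` itself determines, such as a grid cell; these contribute no factor to
the multiplicity. -/
theorem count_flatMap_le_of_unique [LawfulBEq X] {m M : ℕ} (f : Fin m → List X) (x : X)
    (h : ∀ i, (f i).count x ≤ M) (hu : ∀ i j, x ∈ f i → x ∈ f j → i = j) :
    ((List.finRange m).flatMap f).count x ≤ M := by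
  by_cases hx : ∃ i, x ∈ f i
  · obtain ⟨i, hi⟩ := hx
    have : ((List.finRange m).map (List.count x ∘ f)).sum = (f i).count x := by
      rw [← List.ofFn_eq_map, List.sum_ofFn]
      rw [Finset.sum_eq_single i]
      · rfl
      · intro j _ hj
        exact List.count_eq_zero.2 fun h' => hj (hu j i h' hi)
      · simp
    rw [List.count_flatMap, this]
    exact h i
  · push Not at hx
    rw [List.count_eq_zero.2]
    · exact Nat.zero_le _
    · simpa using hx

end Counting

theorem mem_answers {X : Type*} {n B₀ B₁ B₂ B₃ B₄ : ℕ} {ops : List (List ℤ × Fin n)}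
    {P : Fin B₀ → Fin B₁ → Fin B₂ → Fin B₃ → Fin B₄ → Prop}
    {key : Fin B₀ → Fin B₁ → Fin B₂ → Fin B₃ → Fin B₄ → List ℤ} {f : Fin B₀ → Fin n → X} {x : X} :
    x ∈ answers ops P key f ↔
      ∃ a b c d e, P a b c d e ∧ ∃ o, (key a b c d e, o) ∈ ops ∧ f a o = x := by
  simp only [answers, List.mem_flatMap, List.mem_finRange, true_and]
  refine exists_congr fun a => exists_congr fun b => exists_congr fun c => exists_congr fun d =>
    exists_congr fun e => ?_
  by_cases h : P a b c d e <;> simp [h, mem_bucket]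

end RealRAM

/-! ### Memory layout and expressions of the pair step -/

namespace NearTriangles

open RealRAM

/-- The memory `M` holds the points `B` and the vertices `a`, `b`, `c`. -/
structure HoldsInput {n : ℕ} (B : Fin n → Pt) (a b c : Pt) (M : Memory) : Prop where
  points : ∀ t : Fin 3, M t = arrayOf fun i => B i t
  fst : M 3 = arrayOf fun j => a j
  snd : M 4 = arrayOf fun j => b j
  trd : M 5 = arrayOf fun j => c j

theorem HoldsInput.congr {n : ℕ} {B : Fin n → Pt} {a b c : Pt} {M M' : Memory}
    (h : HoldsInput B a b c M) (hM : ∀ k < 6, M k = M' k) : HoldsInput B a b c M' where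
  points t := by rw [← hM t (by omega)]; exact h.points t
  fst := by rw [← hM 3 (by norm_num)]; exact h.fst
  snd := by rw [← hM 4 (by norm_num)]; exact h.snd
  trd := by rw [← hM 5 (by norm_num)]; exact h.trd

/-- The coordinate `t` of the point with index `x`. -/
def coordE (t : Fin 3) (x : Expr) : Expr := .get t x

theorem eval_coordE {n : ℕ} {B : Fin n → Pt} {a b c : Pt} {σ : State}
    (h : HoldsInput B a b c σ.mem) {x : Expr} {i : Fin n} (hx : x.eval σ = (i : ℕ)) (t : Fin 3) :
    (coordE t x).eval σ = B i t := by
  simp only [coordE, Expr.eval, hx, h.points t, Int.floor_natCast]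
  exact arrayOf_natCast (fun i => B i t) i

/-- The square of the difference of the entries at address `j` of the arrays `k` and `l`. -/
def diffSqE (k l : ℕ) (j : ℤ) : Expr :=
  (.get k (.const j) - .get l (.const j)) * (.get k (.const j) - .get l (.const j))

/-- The squared distance of the points that are stored in the arrays `k` and `l`. -/
def distSqE (k l : ℕ) : Expr := diffSqE k l 0 + diffSqE k l 1 + diffSqE k l 2

theorem eval_distSqE {σ : State} {k l : ℕ} {P Q : Pt} (hk : σ.mem k = arrayOf fun j => P j)
    (hl : σ.mem l = arrayOf fun j => Q j) : (distSqE k l).eval σ = dist P Q ^ 2 := by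
  have h0 := arrayOf_natCast (fun j => P j) (0 : Fin 3)
  have h1 := arrayOf_natCast (fun j => P j) (1 : Fin 3)
  have h2 := arrayOf_natCast (fun j => P j) (2 : Fin 3)
  have k0 := arrayOf_natCast (fun j => Q j) (0 : Fin 3)
  have k1 := arrayOf_natCast (fun j => Q j) (1 : Fin 3)
  have k2 := arrayOf_natCast (fun j => Q j) (2 : Fin 3)
  simp only [Fin.val_zero, Fin.val_one, Fin.val_two, Nat.cast_zero, Nat.cast_one,
    Nat.cast_ofNat] at h0 h1 h2 k0 k1 k2
  simp only [distSqE, diffSqE, Expr.eval_add, Expr.eval_sub, Expr.eval, hk, hl,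
    Int.floor_intCast, h0, h1, h2, k0, k1, k2]
  rw [dist_sq_axes P Q 0]
  simp only [zero_add]
  ring

/-- The expression for `sphereHeight`. -/
def sphereHeightE (R a b sg : Expr) : Expr := sg * .sqrt (R - a * a - b * b)

/-- The expressions for `sphereKey`. -/
def sphereKeyE (δ ε q₀ q₁ q₂ k l : Expr) : List Expr :=
  [.floor (q₁ / δ), .floor (q₂ / δ), k, l,
    .floor ((q₀ - k * δ * (q₁ - .floor (q₁ / δ) * δ) - l * δ * (q₂ - .floor (q₂ / δ) * δ)) / ε)]

theorem map_eval_sphereKeyE {σ : State} {δ ε q₀ q₁ q₂ k l : Expr} {k' l' : ℤ}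
    (hk : k.eval σ = k') (hl : l.eval σ = l') :
    (sphereKeyE δ ε q₀ q₁ q₂ k l).map (Expr.eval σ) =
      (sphereKey (δ.eval σ) (ε.eval σ) (q₀.eval σ) (q₁.eval σ) (q₂.eval σ) k' l').map
        (fun z : ℤ => (z : ℝ)) := by
  simp [sphereKeyE, sphereKey, hk, hl]

/-- The expressions for `sphereLookup`. -/
def sphereLookupE (δ ε R p₀ p₁ p₂ sg i j e : Expr) : List Expr :=
  [i, j, .floor ((p₁ - i * δ) / sphereHeightE R (i * δ - p₁) (j * δ - p₂) sg / δ),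
    .floor ((p₂ - j * δ) / sphereHeightE R (i * δ - p₁) (j * δ - p₂) sg / δ),
    .floor ((p₀ + sphereHeightE R (i * δ - p₁) (j * δ - p₂) sg) / ε) + e]

theorem map_eval_sphereLookupE {σ : State} {δ ε R p₀ p₁ p₂ sg i j e : Expr} {i' j' e' : ℤ}
    (hi : i.eval σ = i') (hj : j.eval σ = j') (he : e.eval σ = e') :
    (sphereLookupE δ ε R p₀ p₁ p₂ sg i j e).map (Expr.eval σ) =
      (sphereLookup (δ.eval σ) (ε.eval σ) (R.eval σ) (p₀.eval σ) (p₁.eval σ) (p₂.eval σ)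
        (sg.eval σ) i' j' e').map (fun z : ℤ => (z : ℝ)) := by
  have hh : ∀ R a b sg : Expr, (sphereHeightE R a b sg).eval σ =
    sphereHeight (R.eval σ) (a.eval σ) (b.eval σ) (sg.eval σ) := fun _ _ _ _ => rfl
  simp [sphereLookupE, sphereLookup, hh, hi, hj, he]

/-- The expressions for `SphereGuard`. -/
def sphereGuardE (δ R p₁ p₂ i j : Expr) : List (Expr × Expr) :=
  [((i * δ - p₁) * (i * δ - p₁),
      .const 4 * (R - (i * δ - p₁) * (i * δ - p₁) - (j * δ - p₂) * (j * δ - p₂))),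
    ((j * δ - p₂) * (j * δ - p₂),
      .const 4 * (R - (i * δ - p₁) * (i * δ - p₁) - (j * δ - p₂) * (j * δ - p₂)))]

theorem eval_sphereGuardE {σ : State} {δ R p₁ p₂ i j : Expr} {i' j' : ℤ} (hi : i.eval σ = i')
    (hj : j.eval σ = j') : (∀ g ∈ sphereGuardE δ R p₁ p₂ i j, g.1.eval σ < g.2.eval σ) ↔
      SphereGuard (δ.eval σ) (R.eval σ) (p₁.eval σ) (p₂.eval σ) i' j' := by
  simp [sphereGuardE, SphereGuard, hi, hj]

/-- The memory `M` holds the input, and the list `l` of pairs in the arrays `8`, `9`, `10`. -/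
def HoldsPairs {n : ℕ} (B : Fin n → Pt) (a b c : Pt) (l : List (Fin n × Fin n)) (M : Memory) :
    Prop :=
  HoldsInput B a b c M ∧ M 8 0 = l.length ∧
    ∀ (i : ℕ) (h : i < l.length), M 9 i = (l[i].1 : ℕ) ∧ M 10 i = (l[i].2 : ℕ)

theorem isLocal_holdsPairs {n : ℕ} (B : Fin n → Pt) (a b c : Pt) :
    IsLocal (HoldsPairs B a b c) := by
  rintro l M M' h ⟨h1, h2, h3⟩
  refine ⟨h1.congr fun k hk => h k (by omega), ?_, fun i hi => ?_⟩
  · rw [← h 8 (by norm_num)]; exact h2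
  · rw [← h 9 (by norm_num), ← h 10 (by norm_num)]; exact h3 i hi

/-- Report the pair of register `3` and the value of `item`, and store it in memory. -/
def emitPairC (item : Expr) : Cmd :=
  .seq (.report [.reg 3, item])
    (.seq (.put 10 (.get 8 (.const 0)) item)
      (.seq (.put 9 (.get 8 (.const 0)) (.reg 3))
        (.put 8 (.const 0) (.get 8 (.const 0) + .const 1))))

theorem emits_emitPairC {n : ℕ} {B : Fin n → Pt} {a b c : Pt} {U : Memory → Prop}
    (hU : ∀ M M', (∀ k, 20 ≤ k → M k = M' k) → U M → U M') {d : ℕ} (hd : 3 < d) {ρ : ℕ → ℝ}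
    {p q : Fin n} {item : Expr} (hp : ρ 3 = (p : ℕ))
    (hitem : ∀ l σ, Agree d ρ σ → HoldsPairs B a b c l σ.mem ∧ U σ.mem → item.eval σ = (q : ℕ)) :
    Emits d (fun l M => HoldsPairs B a b c l M ∧ U M) (fun l M => HoldsPairs B a b c l M ∧ U M)
      (fun x => [encodePair x]) (emitPairC item) ρ [(p, q)] 0 := by
  rintro l σ hσ hJ
  have hq := hitem l σ hσ hJ
  obtain ⟨⟨h1, h2, h3⟩, hu⟩ := hJ
  have hp' : σ.reg 3 = (p : ℕ) := by rw [hσ 3 hd, hp]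
  have hlen : ∀ σ' : State, σ'.mem 8 0 = l.length →
      ⌊(Expr.get 8 (.const 0)).eval σ'⌋ = (l.length : ℤ) := by
    intro σ' h'; simp [Expr.eval, h']
  set σ₁ := σ.setMem 10 l.length (q : ℕ) with hσ₁
  set σ₂ := σ₁.setMem 9 l.length (p : ℕ) with hσ₂
  set σ₃ := σ₂.setMem 8 0 (l.length + 1 : ℝ) with hσ₃
  have e₁ : σ₁.mem 8 0 = l.length := by simp [hσ₁, State.setMem, h2]
  have e₂ : σ₂.mem 8 0 = l.length := by simp [hσ₂, hσ₁, State.setMem, h2]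
  have r₀ := Runs.report σ [.reg 3, item]
  have r₁ := Runs.put σ 10 (.get 8 (.const 0)) item
  have r₂ := Runs.put σ₁ 9 (.get 8 (.const 0)) (.reg 3)
  have r₃ := Runs.put σ₂ 8 (.const 0) (.get 8 (.const 0) + .const 1)
  rw [hlen σ h2, hq, ← hσ₁] at r₁
  rw [hlen σ₁ e₁, show (Expr.reg 3).eval σ₁ = (p : ℕ) from hp', ← hσ₂] at r₂
  rw [show ⌊(Expr.const 0).eval σ₂⌋ = 0 by simp,
    show (Expr.get 8 (.const 0) + Expr.const 1).eval σ₂ = l.length + 1 by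
      simp [Expr.eval, e₂], ← hσ₃] at r₃
  have hmem : ∀ k, k ≠ 8 → k ≠ 9 → k ≠ 10 → σ.mem k = σ₃.mem k := by
    intro k a1 a2 a3
    funext z
    simp [hσ₃, hσ₂, hσ₁, State.setMem, a1, a2, a3]
  have hrun := Runs.seq r₀ (.seq r₁ (.seq r₂ r₃))
  simp only [List.map_cons, List.map_nil, hq, show (Expr.reg 3).eval σ = (p : ℕ) from hp',
    List.append_nil] at hrun
  refine ⟨σ₃, _, hrun, hσ, ⟨⟨h1.congr fun k hk => hmem k (by omega) (by omega) (by omega), ?_, ?_⟩,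
    hU _ _ (fun k hk => hmem k (by omega) (by omega) (by omega)) hu⟩, ?_⟩
  · simp [hσ₃, State.setMem]
  · intro i hi
    simp only [hσ₃, hσ₂, hσ₁, State.setMem]
    by_cases hil : i = l.length
    · subst hil; simp
    · have hi' : i < l.length := by simp at hi; omega
      simp [hil, List.getElem_append_left hi', h3 i hi']
  · simp [Cmd.size, emitPairC]

end NearTriangles

/-! ### The pair step along one axis -/

namespace NearTriangles

open RealRAM

theorem eval_widthE_one {σ : State} {x : ℕ} {η : ℝ} (hη : 0 < η) (h : σ.reg x = η) :
    (widthE 1 (.reg x)).eval σ = width 1 η := by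
  simpa using eval_widthE (c := 1) (ηE := .reg x) hη h

theorem eval_widthE_two {σ : State} {e : Expr} {η : ℝ} (hη : 0 < η) (h : e.eval σ = η) :
    (widthE 2 e).eval σ = width 2 η := by
  simpa using eval_widthE (c := 2) hη h

theorem mul_width_two_le {η : ℝ} (hη : 0 < η) (hη1 : η ≤ 1) {z : ℤ} (hz : |z| ≤ width 2 η) :
    |(z : ℝ) * η| ≤ 3 := by
  have h1 : |(z : ℝ)| ≤ 2 / η + 1 := by
    have : |(z : ℝ)| ≤ (width 2 η : ℝ) := by exact_mod_cast hz
    exact this.trans (width_le (by norm_num) hη)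
  rw [abs_mul, abs_of_pos hη]
  calc |(z : ℝ)| * η ≤ (2 / η + 1) * η := by gcongr
    _ = 2 + η := by field_simp
    _ ≤ 3 := by linarith

theorem abs_centered_width_le {c η ε : ℝ} {K : ℕ} (hc : 0 ≤ c) (hη : 0 < η) (hε : 0 < ε)
    (hεη : ε ≤ η) (hε1 : ε ≤ 1) (h : c + 1 ≤ K) (i : Fin (2 * width c η + 1)) :
    |((centered (width c η) i : ℤ) : ℝ)| ≤ K / ε := by
  have h1 : |((centered (width c η) i : ℤ) : ℝ)| ≤ (width c η : ℝ) := by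
    exact_mod_cast abs_centered_le i
  have h2 := div_add_one_le (m := 0) (K := K) hc hε hεη hε1 (by simpa using h)
  have h3 := width_le hc hη
  simp only [Nat.cast_zero, add_zero] at h2
  linarith

theorem abs_floor_div_le' {x c η ε : ℝ} {K : ℕ} (hη : 0 < η) (hε : 0 < ε) (hεη : ε ≤ η)
    (hε1 : ε ≤ 1) (hK : c + 1 ≤ K) (h : |x| ≤ c) : |((⌊x / η⌋ : ℤ) : ℝ)| ≤ K / ε := by
  have h2 := div_add_one_le (m := 0) (K := K) ((abs_nonneg x).trans h) hε hεη hε1 (by simpa using hK)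
  simp only [Nat.cast_zero, add_zero] at h2
  exact (abs_floor_div_le hη h).trans h2

theorem abs_floor_div_add_le {x c ε : ℝ} {K E : ℕ} {e : ℤ} (hε : 0 < ε)
    (hε1 : ε ≤ 1) (hK : c + 1 + E ≤ K) (h : |x| ≤ c) (he : |e| ≤ E) :
    |((⌊x / ε⌋ + e : ℤ) : ℝ)| ≤ K / ε := by
  have h2 := div_add_one_le (m := E) (K := K) ((abs_nonneg x).trans h) hε le_rfl hε1 hK
  have h3 : |(e : ℝ)| ≤ E := by exact_mod_cast he
  push_cast
  linarith [abs_add_le ((⌊x / ε⌋ : ℤ) : ℝ) (e : ℝ), abs_floor_div_le hε h]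

section PairPhase

variable {n : ℕ} (B : Fin n → Pt) (δ ε R : ℝ) (E : ℕ) (t : Fin 3)

/-- The keys of the points in the pair step. -/
noncomputable def pairKey (o : Fin n) (j k : Fin (2 * width 2 δ + 1)) : List ℤ :=
  sphereKey δ ε (B o t) (B o (t + 1)) (B o (t + 2)) (centered _ j) (centered _ k)

/-- The keys that are looked up in the pair step. -/
noncomputable def pairLookup (p : Fin n) (i j : Fin (2 * width 1 δ + 1)) (s : Fin 2)
    (e : Fin (2 * E + 1)) : List ℤ :=
  sphereLookup δ ε R (B p t) (B p (t + 1)) (B p (t + 2)) (signOf s) (centered _ i) (centered _ j)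
    (centered E e)

/-- The condition for looking up a key in the pair step. -/
def PairGuard (p : Fin n) (i j : Fin (2 * width 1 δ + 1)) (_ : Fin 2) (_ : Fin (2 * E + 1)) :
    Prop :=
  SphereGuard δ R (B p (t + 1)) (B p (t + 2)) (centered _ i) (centered _ j)

/-- The pairs that are found in the pair step in the direction of axis `t`. -/
noncomputable def pairAnswers : List (Fin n × Fin n) :=
  answers (insertions n (2 * width 2 δ + 1) (pairKey B δ ε t)) (PairGuard B δ R E t)
    (pairLookup B δ ε R E t) fun p q => (p, q)

end PairPhase

/-- The part of the pair step for the axis `t`, with buckets in the arrays `A` and `A + 1`. -/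
def pairPhaseC (E : ℕ) (t : Fin 3) (A : ℕ) : Cmd :=
  .seq
    (insertC A (keyBaseE (E + 20) (.reg 1)) (spanE (widthE 2 (.reg 2)))
      (sphereKeyE (.reg 2) (.reg 1) (coordE t (.reg 3)) (coordE (t + 1) (.reg 3))
        (coordE (t + 2) (.reg 3)) (.reg 4 - widthE 2 (.reg 2)) (.reg 5 - widthE 2 (.reg 2))))
    (queryC A (keyBaseE (E + 20) (.reg 1)) (.reg 0) (spanE (widthE 1 (.reg 2)))
      (spanE (widthE 1 (.reg 2))) (.const 2) (.const (2 * E + 1))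
      (sphereGuardE (.reg 2) (distSqE 3 4) (coordE (t + 1) (.reg 3)) (coordE (t + 2) (.reg 3))
        (.reg 4 - widthE 1 (.reg 2)) (.reg 5 - widthE 1 (.reg 2)))
      (sphereLookupE (.reg 2) (.reg 1) (distSqE 3 4) (coordE t (.reg 3)) (coordE (t + 1) (.reg 3))
        (coordE (t + 2) (.reg 3)) (signE 6) (.reg 4 - widthE 1 (.reg 2))
        (.reg 5 - widthE 1 (.reg 2)) (.reg 7 - .const E))
      emitPairC)

theorem validKey_pairKey {n : ℕ} {B : Fin n → Pt} (hB : ∀ i, ‖B i‖ ≤ 1) {δ ε : ℝ} {E : ℕ}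
    {t : Fin 3} (hδ : 0 < δ) (hε : 0 < ε) (hεδ : ε ≤ δ) (hδ1 : δ ≤ 1) (o : Fin n)
    (j k : Fin (2 * width 2 δ + 1)) : ValidKey (keyBase (E + 20) ε) (pairKey B δ ε t o j k) := by
  have hE : (0 : ℝ) ≤ E := Nat.cast_nonneg E
  have hε1 := hεδ.trans hδ1
  refine validKey_of_abs_le ?_ ?_ ?_ ?_ ?_
  · exact abs_floor_div_le' hδ hε hεδ hε1 (by push_cast; linarith) (abs_coord_le_one (hB o) _)
  · exact abs_floor_div_le' hδ hε hεδ hε1 (by push_cast; linarith) (abs_coord_le_one (hB o) _)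
  · exact abs_centered_width_le (by norm_num) hδ hε hεδ hε1 (by push_cast; linarith) j
  · exact abs_centered_width_le (by norm_num) hδ hε hεδ hε1 (by push_cast; linarith) k
  -- `7 = 1 + 3 + 3`: a coordinate and two slope terms, each slope being at most `3` by the range of
  -- its index.
  · refine abs_floor_div_le' (c := 7) hε hε le_rfl hε1 (by push_cast; linarith) ?_
    obtain ⟨a1, a2⟩ := sub_floor_mul_mem (x := B o (t + 1)) hδ
    obtain ⟨b1, b2⟩ := sub_floor_mul_mem (x := B o (t + 2)) hδ
    have h1 := abs_mul_le_mul (mul_width_two_le hδ hδ1 (abs_centered_le j))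
      (show |B o (t + 1) - ⌊B o (t + 1) / δ⌋ * δ| ≤ 1 by rw [abs_of_nonneg a1]; linarith)
    have h2 := abs_mul_le_mul (mul_width_two_le hδ hδ1 (abs_centered_le k))
      (show |B o (t + 2) - ⌊B o (t + 2) / δ⌋ * δ| ≤ 1 by rw [abs_of_nonneg b1]; linarith)
    have h3 := abs_coord_le_one (hB o) t
    rw [abs_le] at *
    constructor <;> linarith

/-- The guard is essential: it bounds the slopes, and it makes the height that of a genuine point of
the sphere. -/
theorem validKey_pairLookup {n : ℕ} {B : Fin n → Pt} (hB : ∀ i, ‖B i‖ ≤ 1) {δ ε r : ℝ} {E : ℕ}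
    {t : Fin 3} (hδ : 0 < δ) (hε : 0 < ε) (hεδ : ε ≤ δ) (hδ1 : δ ≤ 1) (hr : r ^ 2 ≤ 1 / 4)
    (p : Fin n) (i j : Fin (2 * width 1 δ + 1)) (s : Fin 2) (e : Fin (2 * E + 1))
    (hg : PairGuard B δ (r ^ 2) E t p i j s e) :
    ValidKey (keyBase (E + 20) ε) (pairLookup B δ ε (r ^ 2) E t p i j s e) := by
  have hE : (0 : ℝ) ≤ E := Nat.cast_nonneg E
  have hε1 := hεδ.trans hδ1
  obtain ⟨g1, g2, g3, g4⟩ := SphereGuard.bounds hg (signOf_eq s)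
  refine validKey_of_abs_le ?_ ?_ ?_ ?_ ?_
  · exact abs_centered_width_le (by norm_num) hδ hε hεδ hε1 (by push_cast; linarith) i
  · exact abs_centered_width_le (by norm_num) hδ hε hεδ hε1 (by push_cast; linarith) j
  · exact abs_floor_div_le' hδ hε hεδ hε1 (by push_cast; linarith) g3
  · exact abs_floor_div_le' hδ hε hεδ hε1 (by push_cast; linarith) g4
  · refine abs_floor_div_add_le (c := 2) (E := E) hε hε1 (by push_cast; linarith) ?_
      (abs_centered_le e)
    have h1 := abs_coord_le_one (hB p) t
    have h2 : |sphereHeight (r ^ 2) (centered _ i * δ - B p (t + 1)) (centered _ j * δ - B p (t + 2))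
        (signOf s)| ≤ 1 := by
      apply abs_le_of_sq_le_sq _ (by norm_num)
      rw [g1]
      linarith [mul_self_nonneg (centered (width 1 δ) i * δ - B p (t + 1)),
        mul_self_nonneg (centered (width 1 δ) j * δ - B p (t + 2))]
    exact (abs_add_le _ _).trans (by linarith)

/-- `N` dominates the overhead of the insertion loops and of the query loops; the last summand
counts the stored copies. For `δ = √ε` everything is `O(n / ε)`. -/
theorem emits_pairPhaseC {n : ℕ} {B : Fin n → Pt} (hB : ∀ i, ‖B i‖ ≤ 1) {a b c : Pt} {δ ε : ℝ}
    (hδ : 0 < δ) (hε : 0 < ε) (hεδ : ε ≤ δ) (hδ1 : δ ≤ 1) (hab : dist a b ≤ 1 / 2) (E : ℕ)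
    (t : Fin 3) {A : ℕ} (hA : 20 ≤ A) {ρ : ℕ → ℝ} (h0 : ρ 0 = n) (h1 : ρ 1 = ε) (h2 : ρ 2 = δ)
    {N : ℕ} (hN : 1 + n * (1 + (2 * width 2 δ + 1) * 1) ≤ N)
    (hN' : 1 + n * (1 + (2 * width 1 δ + 1) * (1 + (2 * width 1 δ + 1) *
      (1 + 2 * (1 + (2 * E + 1) * 1)))) ≤ N) :
    Emits 3 (Fresh (HoldsPairs B a b c) A) (Fresh (HoldsPairs B a b c) (A + 2))
      (fun x => [encodePair x]) (pairPhaseC E t A) ρ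
      (pairAnswers B δ ε (dist a b ^ 2) E t)
      (N + n * ((2 * width 2 δ + 1) * (2 * width 2 δ + 1))) := by
  rw [← length_insertions (pairKey B δ ε t)]
  have hab2 : dist a b ^ 2 ≤ 1 / 4 := by nlinarith [dist_nonneg (x := a) (y := b)]
  have hbase : ∀ σ, Agree 3 ρ σ → (keyBaseE (E + 20) (.reg 1)).eval σ = keyBase (E + 20) ε := by
    intro σ hσ
    rw [eval_keyBaseE]
    simp only [Expr.eval]
    rw [hσ 1 (by norm_num), h1]
  have hw2 : ∀ σ, Agree 3 ρ σ → (widthE 2 (.reg 2)).eval σ = width 2 δ := fun σ hσ =>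
    eval_widthE_two hδ (by simp only [Expr.eval]; rw [hσ 2 (by norm_num), h2])
  have hw1 : ∀ σ, Agree 3 ρ σ → (widthE 1 (.reg 2)).eval σ = width 1 δ := fun σ hσ =>
    eval_widthE_one hδ (by rw [hσ 2 (by norm_num), h2])
  refine emits_insert_query (isLocal_holdsPairs B a b c) (R := keyBase (E + 20) ε) hA
    (fun l M₀ hM₀ => (emits_insertC hA h0 (fun σ hσ _ => eval_spanE (hw2 σ hσ))
      (fun σ hσ _ => hbase σ hσ) (validKey_pairKey hB hδ hε hεδ hδ1) ?_).mono hN)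
    (fun M₀ hS => (emits_queryC hA hS (fun l σ hσ hL => ⟨?_, eval_spanE (hw1 σ hσ),
      eval_spanE (hw1 σ hσ), ?_, ?_, hbase σ hσ⟩) ?_
      (validKey_pairLookup hB hδ hε hεδ hδ1 hab2) ?_ ?_).mono hN')
  · intro o j k σ hσ hM e3 e4 e5
    have hin : HoldsInput B a b c σ.mem := hM₀.1.congr fun k hk => (hM k (by omega)).symm
    rw [map_eval_sphereKeyE (eval_centered e4 (hw2 σ hσ)) (eval_centered e5 (hw2 σ hσ)),
      eval_coordE hin (x := .reg 3) e3, eval_coordE hin (x := .reg 3) e3, eval_coordE hin (x := .reg 3) e3]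
    simp only [Expr.eval]
    rw [hσ 1 (by norm_num), hσ 2 (by norm_num), h1, h2]
    rfl
  · simp only [Expr.eval]; rw [hσ 0 (by norm_num), h0]
  · simp
  · simp
  · intro p i j s e l σ hσ hL e3 e4 e5 e6 e7
    rw [eval_sphereGuardE (eval_centered e4 (hw1 σ hσ)) (eval_centered e5 (hw1 σ hσ)),
      eval_coordE hL.1 (x := .reg 3) e3, eval_coordE hL.1 (x := .reg 3) e3, eval_distSqE hL.1.fst hL.1.snd]
    simp only [Expr.eval]
    rw [hσ 2 (by norm_num), h2]
    rfl
  · intro p i j s e l σ hσ hL e3 e4 e5 e6 e7 _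
    rw [map_eval_sphereLookupE (eval_centered e4 (hw1 σ hσ)) (eval_centered e5 (hw1 σ hσ))
      (eval_centered e7 (by simp)),
      eval_coordE hL.1 (x := .reg 3) e3, eval_coordE hL.1 (x := .reg 3) e3, eval_coordE hL.1 (x := .reg 3) e3,
      eval_distSqE hL.1.fst hL.1.snd, eval_signE e6]
    simp only [Expr.eval]
    rw [hσ 1 (by norm_num), hσ 2 (by norm_num), h1, h2]
    rfl
  · intro p q ρ' item hp hitem
    exact emits_emitPairC (fun M M' hM hU k hk => by rw [← hM k hk]; exact hU k hk) (by norm_num)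
      hp hitem

theorem mem_pairAnswers {n : ℕ} {B : Fin n → Pt} {δ ε R : ℝ} {E : ℕ} {t : Fin 3} {p q : Fin n} :
    (p, q) ∈ pairAnswers B δ ε R E t ↔ ∃ i j s e, PairGuard B δ R E t p i j s e ∧
      ∃ k l, pairKey B δ ε t q k l = pairLookup B δ ε R E t p i j s e := by
  simp only [pairAnswers, mem_answers, mem_insertions, Prod.mk.injEq]
  constructor
  · rintro ⟨p', i, j, s, e, hg, q', hk, rfl, rfl⟩
    exact ⟨i, j, s, e, hg, hk⟩
  · rintro ⟨i, j, s, e, hg, hk⟩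
    exact ⟨p, i, j, s, e, hg, q, hk, rfl, rfl⟩

theorem nearDist_of_mem_pairAnswers {n : ℕ} {B : Fin n → Pt} {β δ ε r : ℝ} {E : ℕ} {t : Fin 3}
    (hβ : 0 < β) (hβr : β ≤ r) (hr : r ≤ 1 / 2) (hδ : 0 < δ) (hε : ε ≤ 1 / 2) (hδε : δ * δ = ε)
    {p q : Fin n} (h : (p, q) ∈ pairAnswers B δ ε (r ^ 2) E t) :
    NearDist r (pairConst β E * ε) (B p) (B q) := by
  obtain ⟨i, j, s, e, hg, k, l, hk⟩ := mem_pairAnswers.1 h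
  exact nearDist_of_sphere_lookup hβ hβr hδ hε hδε hr (signOf_eq s) (abs_centered_le e) hg hk

theorem exists_mem_pairAnswers {n : ℕ} {B : Fin n → Pt} (hB : ∀ i, ‖B i‖ ≤ 1) {β δ ε r : ℝ}
    {E : ℕ} (hβ : 0 < β) (hβr : β ≤ r) (hr : r ≤ 1 / 2) (hδ : 0 < δ) (hε : ε ≤ 1 / 2)
    (hδβ : δ ≤ β ^ 2 / 200) (hδε : δ * δ = ε) (hE : sphereConst β + 3 ≤ E) {p q : Fin n}
    (h : NearDist r ε (B p) (B q)) : ∃ t, (p, q) ∈ pairAnswers B δ ε (r ^ 2) E t := by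
  obtain ⟨t, sg, e, k, l, hsg, he, hk, hl, hg, hkey⟩ :=
    exists_sphere_lookup hβ hβr hr hδ hε hδβ hδε hE h
  obtain ⟨s, rfl⟩ := exists_signOf hsg
  obtain ⟨e, rfl⟩ := exists_centered he
  obtain ⟨k, rfl⟩ := exists_centered_of_le hk lt_width
  obtain ⟨l, rfl⟩ := exists_centered_of_le hl lt_width
  obtain ⟨i, hi⟩ := exists_centered_of_le
    (abs_floor_div_le hδ (abs_coord_le_one (hB q) (t + 1))) lt_width
  obtain ⟨j, hj⟩ := exists_centered_of_le
    (abs_floor_div_le hδ (abs_coord_le_one (hB q) (t + 2))) lt_width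
  refine ⟨t, mem_pairAnswers.2 ⟨i, j, s, e, ?_, k, l, ?_⟩⟩
  · unfold PairGuard; rw [hi, hj]; exact hg
  · unfold pairKey pairLookup; rw [hi, hj]; exact hkey

theorem nodup_pairInsertions {n : ℕ} {B : Fin n → Pt} {δ ε : ℝ} {t : Fin 3} :
    (insertions n (2 * width 2 δ + 1) (pairKey B δ ε t)).Nodup := by
  refine nodup_insertions fun o j k j' k' h => ?_
  simp only [pairKey, sphereKey, List.cons.injEq] at h
  exact ⟨centered_injective h.2.2.1, centered_injective h.2.2.2.1⟩

/-- The pair determines `p`, and the first two digits of the key of `q` determine the cell. Only the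
sign and the shift are free, and a bucket lists `q` at most once. -/
theorem count_pairAnswers_le {n : ℕ} {B : Fin n → Pt} {δ ε R : ℝ} {E : ℕ} {t : Fin 3}
    (x : Fin n × Fin n) : (pairAnswers B δ ε R E t).count x ≤ 2 * ((2 * E + 1) * 1) := by
  classical
  have hmem : ∀ {p i j s e} {y : Fin n × Fin n},
      (y ∈ if PairGuard B δ R E t p i j s e then
        (bucket (insertions n (2 * width 2 δ + 1) (pairKey B δ ε t))
          (pairLookup B δ ε R E t p i j s e)).map (fun q => (p, q)) else []) →
      y.1 = p ∧ centered _ i = ⌊B y.2 (t + 1) / δ⌋ ∧ centered _ j = ⌊B y.2 (t + 2) / δ⌋ := by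
    intro p i j s e y hy
    split_ifs at hy with hg
    · obtain ⟨q, hq, rfl⟩ := List.mem_map.1 hy
      obtain ⟨k, l, hkl⟩ := mem_insertions.1 (mem_bucket.1 hq)
      simp only [pairKey, pairLookup, sphereKey, sphereLookup, List.cons.injEq] at hkl
      exact ⟨rfl, hkl.1.symm, hkl.2.1.symm⟩
    · simp at hy
  unfold pairAnswers answers
  refine count_flatMap_le_of_unique _ x (fun p => ?_) (fun p p' h h' => ?_)
  refine count_flatMap_le_of_unique _ x (fun i => ?_) (fun i i' h h' => ?_)
  refine count_flatMap_le_of_unique _ x (fun j => ?_) (fun j j' h h' => ?_)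
  refine count_flatMap_le _ x (fun s => ?_)
  refine count_flatMap_le _ x (fun e => ?_)
  · split_ifs
    · refine List.nodup_iff_count_le_one.1 ?_ x
      exact (nodup_bucket nodup_pairInsertions _).map fun q q' h => (Prod.ext_iff.1 h).2
    · simp
  all_goals
    simp only [List.mem_flatMap, List.mem_finRange, true_and] at h h'
  · obtain ⟨s, e, h⟩ := h
    obtain ⟨s', e', h'⟩ := h'
    exact centered_injective ((hmem h).2.2.trans (hmem h').2.2.symm)
  · obtain ⟨j, s, e, h⟩ := h
    obtain ⟨j', s', e', h'⟩ := h'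
    exact centered_injective ((hmem h).2.1.trans (hmem h').2.1.symm)
  · obtain ⟨i, j, s, e, h⟩ := h
    obtain ⟨i', j', s', e', h'⟩ := h'
    exact (hmem h).1.symm.trans (hmem h').1

end NearTriangles

/-! ### The triple step along one axis: expressions and program -/

namespace NearTriangles

open RealRAM

section CircleExpr

variable (δ η ε R₁ R₂ p₀ p₁ p₂ v₀ v₁ v₂ h sg : Expr)

/-- The expression for `circleAlong`. -/
def circleAlongE : Expr :=
  ((v₀ * v₀ + v₁ * v₁ + v₂ * v₂ + R₁ - R₂) / .const 2 - v₀ * h) / (v₁ * v₁ + v₂ * v₂)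

/-- The expression for `circleDisc`. -/
def circleDiscE : Expr :=
  (R₁ - h * h) / (v₁ * v₁ + v₂ * v₂) -
    circleAlongE R₁ R₂ v₀ v₁ v₂ h * circleAlongE R₁ R₂ v₀ v₁ v₂ h

/-- The expression for `circleAcross`. -/
def circleAcrossE : Expr := sg * .sqrt (circleDiscE R₁ R₂ v₀ v₁ v₂ h)

/-- The expression for `circleFst`. -/
def circleFstE : Expr :=
  circleAlongE R₁ R₂ v₀ v₁ v₂ h * v₁ - circleAcrossE R₁ R₂ v₀ v₁ v₂ h sg * v₂

/-- The expression for `circleSnd`. -/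
def circleSndE : Expr :=
  circleAlongE R₁ R₂ v₀ v₁ v₂ h * v₂ + circleAcrossE R₁ R₂ v₀ v₁ v₂ h sg * v₁

/-- The expression for `circleDen`. -/
def circleDenE : Expr := circleAcrossE R₁ R₂ v₀ v₁ v₂ h sg * (v₁ * v₁ + v₂ * v₂)

/-- The expression for `circleNumFst`. -/
def circleNumFstE : Expr := h * v₂ - v₀ * circleSndE R₁ R₂ v₀ v₁ v₂ h sg

/-- The expression for `circleNumSnd`. -/
def circleNumSndE : Expr := v₀ * circleFstE R₁ R₂ v₀ v₁ v₂ h sg - v₁ * h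

/-- The expressions for `circleKey`. -/
def circleKeyE (o₀ o₁ o₂ j k : Expr) : List Expr :=
  [.floor (o₀ / δ), j, k, .floor ((o₁ - j * η * (o₀ - .floor (o₀ / δ) * δ)) / ε),
    .floor ((o₂ - k * η * (o₀ - .floor (o₀ / δ) * δ)) / ε)]

/-- The expressions for `circleLookup`, for the plane at height `h` above the center. -/
def circleLookupE (i e f : Expr) : List Expr :=
  [i, .floor (circleNumFstE R₁ R₂ v₀ v₁ v₂ h sg / circleDenE R₁ R₂ v₀ v₁ v₂ h sg / η),
    .floor (circleNumSndE R₁ R₂ v₀ v₁ v₂ h sg / circleDenE R₁ R₂ v₀ v₁ v₂ h sg / η),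
    .floor ((p₁ + circleFstE R₁ R₂ v₀ v₁ v₂ h sg) / ε) + e,
    .floor ((p₂ + circleSndE R₁ R₂ v₀ v₁ v₂ h sg) / ε) + f]

/-- The expressions for `CircleGuard`. -/
def circleGuardE : List (Expr × Expr) :=
  [(.const 0, circleDiscE R₁ R₂ v₀ v₁ v₂ h),
    (circleNumFstE R₁ R₂ v₀ v₁ v₂ h sg * circleNumFstE R₁ R₂ v₀ v₁ v₂ h sg,
      .const 4 * (circleDenE R₁ R₂ v₀ v₁ v₂ h sg * circleDenE R₁ R₂ v₀ v₁ v₂ h sg)),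
    (circleNumSndE R₁ R₂ v₀ v₁ v₂ h sg * circleNumSndE R₁ R₂ v₀ v₁ v₂ h sg,
      .const 4 * (circleDenE R₁ R₂ v₀ v₁ v₂ h sg * circleDenE R₁ R₂ v₀ v₁ v₂ h sg))]

variable {δ η ε R₁ R₂ p₀ p₁ p₂ v₀ v₁ v₂ h sg} {σ : State}

theorem eval_circleDiscE : (circleDiscE R₁ R₂ v₀ v₁ v₂ h).eval σ =
    circleDisc (R₁.eval σ) (R₂.eval σ) (v₀.eval σ) (v₁.eval σ) (v₂.eval σ) (h.eval σ) := by
  simp [circleDiscE, circleDisc, circleAlongE, circleAlong]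

theorem eval_circleFstE : (circleFstE R₁ R₂ v₀ v₁ v₂ h sg).eval σ = circleFst (R₁.eval σ)
    (R₂.eval σ) (v₀.eval σ) (v₁.eval σ) (v₂.eval σ) (h.eval σ) (sg.eval σ) := by
  simp [circleFstE, circleFst, circleAcrossE, circleAcross, eval_circleDiscE, circleAlongE,
    circleAlong, Expr.eval]

theorem eval_circleSndE : (circleSndE R₁ R₂ v₀ v₁ v₂ h sg).eval σ = circleSnd (R₁.eval σ)
    (R₂.eval σ) (v₀.eval σ) (v₁.eval σ) (v₂.eval σ) (h.eval σ) (sg.eval σ) := by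
  simp [circleSndE, circleSnd, circleAcrossE, circleAcross, eval_circleDiscE, circleAlongE,
    circleAlong, Expr.eval]

theorem eval_circleDenE : (circleDenE R₁ R₂ v₀ v₁ v₂ h sg).eval σ = circleDen (R₁.eval σ)
    (R₂.eval σ) (v₀.eval σ) (v₁.eval σ) (v₂.eval σ) (h.eval σ) (sg.eval σ) := by
  simp [circleDenE, circleDen, circleAcrossE, circleAcross, eval_circleDiscE, Expr.eval]

theorem eval_circleNumFstE : (circleNumFstE R₁ R₂ v₀ v₁ v₂ h sg).eval σ = circleNumFst (R₁.eval σ)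
    (R₂.eval σ) (v₀.eval σ) (v₁.eval σ) (v₂.eval σ) (h.eval σ) (sg.eval σ) := by
  simp [circleNumFstE, circleNumFst, eval_circleSndE]

theorem eval_circleNumSndE : (circleNumSndE R₁ R₂ v₀ v₁ v₂ h sg).eval σ = circleNumSnd (R₁.eval σ)
    (R₂.eval σ) (v₀.eval σ) (v₁.eval σ) (v₂.eval σ) (h.eval σ) (sg.eval σ) := by
  simp [circleNumSndE, circleNumSnd, eval_circleFstE]

theorem map_eval_circleKeyE {o₀ o₁ o₂ j k : Expr} {j' k' : ℤ} (hj : j.eval σ = j')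
    (hk : k.eval σ = k') : (circleKeyE δ η ε o₀ o₁ o₂ j k).map (Expr.eval σ) =
      (circleKey (δ.eval σ) (η.eval σ) (ε.eval σ) (o₀.eval σ) (o₁.eval σ) (o₂.eval σ) j' k').map
        (fun z : ℤ => (z : ℝ)) := by
  simp [circleKeyE, circleKey, hj, hk]

theorem map_eval_circleLookupE {i e f : Expr} {i' e' f' : ℤ} (hi : i.eval σ = i')
    (he : e.eval σ = e') (hf : f.eval σ = f') :
    (circleLookupE η ε R₁ R₂ p₁ p₂ v₀ v₁ v₂ (i * δ - p₀) sg i e f).map (Expr.eval σ) =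
      (circleLookup (δ.eval σ) (η.eval σ) (ε.eval σ) (R₁.eval σ) (R₂.eval σ) (p₀.eval σ)
        (p₁.eval σ) (p₂.eval σ) (v₀.eval σ) (v₁.eval σ) (v₂.eval σ) (sg.eval σ) i' e' f').map
        (fun z : ℤ => (z : ℝ)) := by
  simp [circleLookupE, circleLookup, eval_circleNumFstE, eval_circleNumSndE, eval_circleDenE,
    eval_circleFstE, eval_circleSndE, hi, he, hf]

theorem eval_circleGuardE : (∀ g ∈ circleGuardE R₁ R₂ v₀ v₁ v₂ h sg, g.1.eval σ < g.2.eval σ) ↔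
    CircleGuard (R₁.eval σ) (R₂.eval σ) (v₀.eval σ) (v₁.eval σ) (v₂.eval σ) (h.eval σ)
      (sg.eval σ) := by
  simp [circleGuardE, CircleGuard, eval_circleNumFstE, eval_circleNumSndE, eval_circleDenE,
    eval_circleDiscE]

end CircleExpr

section TriplePhase

variable {n : ℕ} (B : Fin n → Pt) (δ η ε R₁ R₂ : ℝ) (E : ℕ) (t : Fin 3)
  (l : List (Fin n × Fin n))

/-- The keys of the points in the triple step. -/
noncomputable def tripleKey (o : Fin n) (j k : Fin (2 * width 2 η + 1)) : List ℤ :=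
  circleKey δ η ε (B o t) (B o (t + 1)) (B o (t + 2)) (centered _ j) (centered _ k)

/-- The keys that are looked up in the triple step. -/
noncomputable def tripleLookup (m : Fin l.length) (i : Fin (2 * width 1 δ + 1)) (s : Fin 2)
    (e f : Fin (2 * E + 1)) : List ℤ :=
  circleLookup δ η ε R₁ R₂ (B l[m].1 t) (B l[m].1 (t + 1)) (B l[m].1 (t + 2))
    (B l[m].2 t - B l[m].1 t) (B l[m].2 (t + 1) - B l[m].1 (t + 1))
    (B l[m].2 (t + 2) - B l[m].1 (t + 2)) (signOf s) (centered _ i) (centered E e) (centered E f)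

/-- The condition for looking up a key in the triple step. -/
def TripleGuard (m : Fin l.length) (i : Fin (2 * width 1 δ + 1)) (s : Fin 2)
    (_ _ : Fin (2 * E + 1)) : Prop :=
  CircleGuard R₁ R₂ (B l[m].2 t - B l[m].1 t) (B l[m].2 (t + 1) - B l[m].1 (t + 1))
    (B l[m].2 (t + 2) - B l[m].1 (t + 2)) (centered _ i * δ - B l[m].1 t) (signOf s)

/-- The triples that are found in the triple step in the direction of axis `t`. -/
noncomputable def tripleAnswers : List (Fin n × Fin n × Fin n) :=
  answers (insertions n (2 * width 2 η + 1) (tripleKey B δ η ε t)) (TripleGuard B δ R₁ R₂ E t l)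
    (tripleLookup B δ η ε R₁ R₂ E t l) fun m o => (l[m].1, l[m].2, o)

end TriplePhase

/-- The triple of the saved pair with index in register `3` and the value of `item`. -/
def emitTripleC (item : Expr) : Cmd := .report [.get 9 (.reg 3), .get 10 (.reg 3), item]

/-- Coordinate `t` of the first point of the saved pair with index in register `3`. -/
def fstE (t : Fin 3) : Expr := coordE t (.get 9 (.reg 3))

/-- Coordinate `t` of the difference of the saved pair with index in register `3`. -/
def diffE (t : Fin 3) : Expr := coordE t (.get 10 (.reg 3)) - coordE t (.get 9 (.reg 3))

/-- The part of the triple step for the axis `t`, with buckets in the arrays `A` and `A + 1`. -/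
def triplePhaseC (E : ℕ) (t : Fin 3) (A : ℕ) : Cmd :=
  .seq
    (insertC A (keyBaseE (E + 20) (.reg 1)) (spanE (widthE 2 (.reg 1 / .reg 2)))
      (circleKeyE (.reg 2) (.reg 1 / .reg 2) (.reg 1) (coordE t (.reg 3))
        (coordE (t + 1) (.reg 3)) (coordE (t + 2) (.reg 3))
        (.reg 4 - widthE 2 (.reg 1 / .reg 2)) (.reg 5 - widthE 2 (.reg 1 / .reg 2))))
    (queryC A (keyBaseE (E + 20) (.reg 1)) (.get 8 (.const 0)) (spanE (widthE 1 (.reg 2)))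
      (.const 2) (.const (2 * E + 1)) (.const (2 * E + 1))
      (circleGuardE (distSqE 3 5) (distSqE 4 5) (diffE t) (diffE (t + 1)) (diffE (t + 2))
        ((.reg 4 - widthE 1 (.reg 2)) * .reg 2 - fstE t) (signE 5))
      (circleLookupE (.reg 1 / .reg 2) (.reg 1) (distSqE 3 5) (distSqE 4 5) (fstE (t + 1))
        (fstE (t + 2)) (diffE t) (diffE (t + 1)) (diffE (t + 2))
        ((.reg 4 - widthE 1 (.reg 2)) * .reg 2 - fstE t) (signE 5)
        (.reg 4 - widthE 1 (.reg 2)) (.reg 6 - .const E) (.reg 7 - .const E))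
      emitTripleC)

theorem validKey_tripleKey {n : ℕ} {B : Fin n → Pt} (hB : ∀ i, ‖B i‖ ≤ 1) {δ η ε : ℝ} {E : ℕ}
    {t : Fin 3} (hδ : 0 < δ) (hη : 0 < η) (hε : 0 < ε) (hεδ : ε ≤ δ) (hεη : ε ≤ η) (hδ1 : δ ≤ 1)
    (hη1 : η ≤ 1) (o : Fin n) (j k : Fin (2 * width 2 η + 1)) :
    ValidKey (keyBase (E + 20) ε) (tripleKey B δ η ε t o j k) := by
  have hE : (0 : ℝ) ≤ E := Nat.cast_nonneg E
  have hε1 := hεδ.trans hδ1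
  obtain ⟨a1, a2⟩ := sub_floor_mul_mem (x := B o t) hδ
  have key : ∀ (i : Fin (2 * width 2 η + 1)) (u : Fin 3),
      |B o u - centered _ i * η * (B o t - ⌊B o t / δ⌋ * δ)| ≤ 4 := by
    intro i u
    have h1 := abs_mul_le_mul (mul_width_two_le hη hη1 (abs_centered_le i))
      (show |B o t - ⌊B o t / δ⌋ * δ| ≤ 1 by rw [abs_of_nonneg a1]; linarith)
    have h3 := abs_coord_le_one (hB o) u
    rw [abs_le] at *
    constructor <;> linarith
  refine validKey_of_abs_le ?_ ?_ ?_ ?_ ?_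
  · exact abs_floor_div_le' hδ hε hεδ hε1 (by push_cast; linarith) (abs_coord_le_one (hB o) _)
  · exact abs_centered_width_le (by norm_num) hη hε hεη hε1 (by push_cast; linarith) j
  · exact abs_centered_width_le (by norm_num) hη hε hεη hε1 (by push_cast; linarith) k
  · exact abs_floor_div_le' (c := 4) hε hε le_rfl hε1 (by push_cast; linarith) (key j _)
  · exact abs_floor_div_le' (c := 4) hε hε le_rfl hε1 (by push_cast; linarith) (key k _)

theorem validKey_tripleLookup {n : ℕ} {B : Fin n → Pt} (hB : ∀ i, ‖B i‖ ≤ 1) {δ η ε R₁ R₂ : ℝ}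
    {E : ℕ} {t : Fin 3} (hδ : 0 < δ) (hη : 0 < η) (hε : 0 < ε) (hεδ : ε ≤ δ) (hεη : ε ≤ η)
    (hδ1 : δ ≤ 1) (hR : R₁ ≤ 1) (l : List (Fin n × Fin n)) (m : Fin l.length)
    (i : Fin (2 * width 1 δ + 1)) (s : Fin 2) (e f : Fin (2 * E + 1))
    (hg : TripleGuard B δ R₁ R₂ E t l m i s e f) :
    ValidKey (keyBase (E + 20) ε) (tripleLookup B δ η ε R₁ R₂ E t l m i s e f) := by
  have hE : (0 : ℝ) ≤ E := Nat.cast_nonneg E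
  have hε1 := hεδ.trans hδ1
  obtain ⟨g1, -, -, -, g5, g6⟩ := CircleGuard.facts hg (signOf_eq s)
  have key : ∀ {y : ℝ} {u : Fin 3}, y ^ 2 ≤ 1 → |B l[m].1 u + y| ≤ 2 := by
    intro y u hy
    have h1 := abs_coord_le_one (hB l[m].1) u
    have h2 : |y| ≤ 1 := abs_le_of_sq_le_sq (by simpa using hy) (by norm_num)
    exact (abs_add_le _ _).trans (by linarith)
  refine validKey_of_abs_le ?_ ?_ ?_ ?_ ?_
  · exact abs_centered_width_le (by norm_num) hδ hε hεδ hε1 (by push_cast; linarith) i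
  · exact abs_floor_div_le' hη hε hεη hε1 (by push_cast; linarith) g5
  · exact abs_floor_div_le' hη hε hεη hε1 (by push_cast; linarith) g6
  · refine abs_floor_div_add_le (c := 2) (E := E) hε hε1 (by push_cast; linarith) (key ?_)
      (abs_centered_le e)
    · refine le_trans ?_ (g1.le.trans hR)
      rw [add_right_comm]
      exact le_add_of_nonneg_left (by positivity)
  · refine abs_floor_div_add_le (c := 2) (E := E) hε hε1 (by push_cast; linarith) (key ?_)
      (abs_centered_le f)
    · refine le_trans ?_ (g1.le.trans hR)
      exact le_add_of_nonneg_left (by positivity)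

theorem HoldsPairs.eval_get {n : ℕ} {B : Fin n → Pt} {a b c : Pt} {l : List (Fin n × Fin n)}
    {σ : State} (h : HoldsPairs B a b c l σ.mem) {x : Expr} {m : Fin l.length}
    (hx : x.eval σ = (m : ℕ)) :
    (Expr.get 9 x).eval σ = (l[m].1 : ℕ) ∧ (Expr.get 10 x).eval σ = (l[m].2 : ℕ) := by
  simp only [Expr.eval, hx, Int.floor_natCast]
  exact h.2.2 m m.2

/-- Triples are reported but not stored, so the memory invariant ignores the list of those already
emitted. -/
theorem emits_emitTripleC {n : ℕ} {B : Fin n → Pt} {a b c : Pt} {l : List (Fin n × Fin n)}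
    {J : List (Fin n × Fin n × Fin n) → Memory → Prop} (hJ : ∀ l' M, J l' M → HoldsPairs B a b c l M)
    (hJ' : ∀ l' l'' M, J l' M → J l'' M) {d : ℕ} (hd : 3 < d) {ρ : ℕ → ℝ} {m : Fin l.length}
    {o : Fin n} {item : Expr} (hm : ρ 3 = (m : ℕ))
    (hitem : ∀ l' σ, Agree d ρ σ → J l' σ.mem → item.eval σ = (o : ℕ)) :
    Emits d J J (fun x => [encodeTriple x]) (emitTripleC item) ρ [(l[m].1, l[m].2, o)] 0 := by
  intro l' σ hσ hM
  obtain ⟨h1, h2⟩ := (hJ l' _ hM).eval_get (x := .reg 3) (m := m) (by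
    simp only [Expr.eval]; rw [hσ 3 hd, hm])
  have r := Runs.report σ [.get 9 (.reg 3), .get 10 (.reg 3), item]
  simp only [List.map_cons, List.map_nil, h1, h2, hitem l' σ hσ hM] at r
  exact ⟨σ, _, r, hσ, hJ' _ _ _ hM, by simp [emitTripleC, Cmd.size]⟩

/-- Storing costs `O(n / η²)` and looking up costs `O(|l| / δ)`; the choice of `δ` with `η = ε / δ`
is left open in order to balance the two. -/
theorem emits_triplePhaseC {n : ℕ} {B : Fin n → Pt} (hB : ∀ i, ‖B i‖ ≤ 1) {a b c : Pt}
    {δ η ε : ℝ} (hδ : 0 < δ) (hη : 0 < η) (hε : 0 < ε) (hεδ : ε ≤ δ) (hεη : ε ≤ η) (hδ1 : δ ≤ 1)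
    (hη1 : η ≤ 1) (hηδ : ε / δ = η) (hac : dist a c ^ 2 ≤ 1) (E : ℕ) (t : Fin 3)
    (l : List (Fin n × Fin n)) {A : ℕ}
    (hA : 20 ≤ A) {ρ : ℕ → ℝ} (h0 : ρ 0 = n) (h1 : ρ 1 = ε) (h2 : ρ 2 = δ)
    {N : ℕ} (hN : 1 + n * (1 + (2 * width 2 η + 1) * 1) ≤ N)
    (hN' : 1 + l.length * (1 + (2 * width 1 δ + 1) * (1 + 2 * (1 + (2 * E + 1) *
      (1 + (2 * E + 1) * 1)))) ≤ N) :
    Emits 3 (Fresh (fun _ => HoldsPairs B a b c l) A) (Fresh (fun _ => HoldsPairs B a b c l) (A + 2))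
      (fun x => [encodeTriple x]) (triplePhaseC E t A) ρ
      (tripleAnswers B δ η ε (dist a c ^ 2) (dist b c ^ 2) E t l)
      (N + n * ((2 * width 2 η + 1) * (2 * width 2 η + 1))) := by
  rw [← length_insertions (tripleKey B δ η ε t)]
  have hbase : ∀ σ, Agree 3 ρ σ → (keyBaseE (E + 20) (.reg 1)).eval σ = keyBase (E + 20) ε := by
    intro σ hσ
    rw [eval_keyBaseE]
    simp only [Expr.eval]
    rw [hσ 1 (by norm_num), h1]
  have hEη : ∀ σ, Agree 3 ρ σ → (Expr.reg 1 / Expr.reg 2).eval σ = η := fun σ hσ => by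
    simp only [Expr.eval_div, Expr.eval]
    rw [hσ 1 (by norm_num), hσ 2 (by norm_num), h1, h2, hηδ]
  have hw2 : ∀ σ, Agree 3 ρ σ → (widthE 2 (.reg 1 / .reg 2)).eval σ = width 2 η := fun σ hσ =>
    eval_widthE_two hη (hEη σ hσ)
  have hw1 : ∀ σ, Agree 3 ρ σ → (widthE 1 (.reg 2)).eval σ = width 1 δ := fun σ hσ =>
    eval_widthE_one hδ (by rw [hσ 2 (by norm_num), h2])
  have hfst : ∀ (σ : State) (m : Fin l.length), HoldsPairs B a b c l σ.mem → σ.reg 3 = (m : ℕ) →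
      ∀ u : Fin 3,
      (fstE u).eval σ = B l[m].1 u ∧ (diffE u).eval σ = B l[m].2 u - B l[m].1 u := by
    intro σ m hL e3 u
    obtain ⟨g1, g2⟩ := hL.eval_get (x := .reg 3) (m := m) e3
    rw [fstE, diffE, Expr.eval_sub, eval_coordE hL.1 g1, eval_coordE hL.1 g2]
    exact ⟨rfl, rfl⟩
  refine emits_insert_query (L := fun _ => HoldsPairs B a b c l) (R := keyBase (E + 20) ε)
    (fun _ _ _ hM hL => isLocal_holdsPairs B a b c l _ _ hM hL) hA
    (fun _ M₀ hM₀ => (emits_insertC hA h0 (fun σ hσ _ => eval_spanE (hw2 σ hσ))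
      (fun σ hσ _ => hbase σ hσ) (validKey_tripleKey hB hδ hη hε hεδ hεη hδ1 hη1) ?_).mono hN)
    (fun M₀ hS => (emits_queryC hA hS (fun _ σ hσ hL => ⟨?_, eval_spanE (hw1 σ hσ),
      ?_, ?_, ?_, hbase σ hσ⟩) ?_
      (validKey_tripleLookup hB hδ hη hε hεδ hεη hδ1 hac l) ?_ ?_).mono hN')
  · intro o j k σ hσ hM e3 e4 e5
    have hin : HoldsInput B a b c σ.mem := hM₀.1.congr fun k hk => (hM k (by omega)).symm
    rw [map_eval_circleKeyE (eval_centered e4 (hw2 σ hσ)) (eval_centered e5 (hw2 σ hσ)),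
      eval_coordE hin (x := .reg 3) e3, eval_coordE hin (x := .reg 3) e3,
      eval_coordE hin (x := .reg 3) e3, hEη σ hσ]
    simp only [Expr.eval]
    rw [hσ 1 (by norm_num), hσ 2 (by norm_num), h1, h2]
    rfl
  · simp [Expr.eval, hL.2.1]
  · simp
  · simp
  · simp
  · intro m i s e f _ σ hσ hL e3 e4 e5 e6 e7
    have hf := hfst σ m hL e3
    rw [eval_circleGuardE, Expr.eval_sub, Expr.eval_mul, eval_centered e4 (hw1 σ hσ),
      eval_distSqE hL.1.fst hL.1.trd, eval_distSqE hL.1.snd hL.1.trd, eval_signE e5,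
      (hf t).1, (hf t).2, (hf (t + 1)).2, (hf (t + 2)).2]
    simp only [Expr.eval]
    rw [hσ 2 (by norm_num), h2]
    rfl
  · intro m i s e f _ σ hσ hL e3 e4 e5 e6 e7 _
    have hf := hfst σ m hL e3
    rw [map_eval_circleLookupE (eval_centered e4 (hw1 σ hσ)) (eval_centered e6 (by simp))
      (eval_centered e7 (by simp)),
      eval_distSqE hL.1.fst hL.1.trd, eval_distSqE hL.1.snd hL.1.trd, eval_signE e5, hEη σ hσ,
      (hf t).1, (hf (t + 1)).1, (hf (t + 2)).1, (hf t).2, (hf (t + 1)).2, (hf (t + 2)).2]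
    simp only [Expr.eval]
    rw [hσ 1 (by norm_num), hσ 2 (by norm_num), h1, h2]
    rfl
  · intro m o ρ' item hm hitem
    exact emits_emitTripleC (fun _ _ h => h.1) (fun _ _ _ h => h) (by norm_num) hm hitem

end NearTriangles

/-! ### Correctness and multiplicity of the triple step -/

namespace NearTriangles

open RealRAM

/-- A saved pair may occur repeatedly in `l`, and a triple can be found from each occurrence of its
pair. -/
theorem count_flatMap_finRange_length_le {X Y : Type*} [BEq X] [LawfulBEq X]
    [BEq Y] [LawfulBEq Y] (l : List Y)
    {M : ℕ} (f : Fin l.length → List X) (x : X) (y : Y) (h : ∀ m, (f m).count x ≤ M)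
    (hu : ∀ m, x ∈ f m → l[m] = y) :
    ((List.finRange l.length).flatMap f).count x ≤ l.count y * M := by
  classical
  have hsum : ∀ l : List Y, (l.map fun z => if z = y then M else 0).sum = l.count y * M := by
    intro l
    induction l with
    | nil => simp
    | cons z l ih =>
      by_cases hz : z = y
      · simp [hz, ih, add_mul, add_comm]
      · simp [hz, ih]
  rw [List.count_flatMap, ← hsum l]
  have hl : l.map (fun z => if z = y then M else 0) =
      (List.finRange l.length).map fun m => if l[m] = y then M else 0 := by
    conv_lhs => rw [← List.ofFn_getElem (xs := l), List.map_ofFn, List.ofFn_eq_map]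
    rfl
  rw [hl]
  refine List.sum_le_sum fun m _ => ?_
  by_cases hm : l[m] = y
  · simp only [hm, if_true]; exact h m
  · simp only [Function.comp, List.count_eq_zero.2 fun hx => hm (hu m hx), Nat.zero_le]

theorem mem_tripleAnswers {n : ℕ} {B : Fin n → Pt} {δ η ε R₁ R₂ : ℝ} {E : ℕ} {t : Fin 3}
    {l : List (Fin n × Fin n)} {p q o : Fin n} :
    (p, q, o) ∈ tripleAnswers B δ η ε R₁ R₂ E t l ↔ ∃ m : Fin l.length, l[m] = (p, q) ∧
      ∃ i s e f, TripleGuard B δ R₁ R₂ E t l m i s e f ∧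
      ∃ j k, tripleKey B δ η ε t o j k = tripleLookup B δ η ε R₁ R₂ E t l m i s e f := by
  simp only [tripleAnswers, mem_answers, mem_insertions, Prod.mk.injEq]
  constructor
  · rintro ⟨m, i, s, e, f, hg, o', hk, h1, h2, rfl⟩
    exact ⟨m, Prod.ext h1 h2, i, s, e, f, hg, hk⟩
  · rintro ⟨m, hm, i, s, e, f, hg, hk⟩
    exact ⟨m, i, s, e, f, hg, o, hk, by rw [hm], by rw [hm], rfl⟩

theorem nearDist_of_mem_tripleAnswers {n : ℕ} {B : Fin n → Pt} {s δ η ε r₁ r₂ : ℝ} {E : ℕ}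
    {t : Fin 3} {l : List (Fin n × Fin n)} (hs : 0 < s) (hs₁ : s ≤ r₁) (hs₂ : s ≤ r₂)
    (hr₁ : r₁ ≤ 1 / 2) (hr₂ : r₂ ≤ 1 / 2) (hδ : 0 < δ) (hη : 0 < η) (hε : ε ≤ 1 / 2)
    (hηδ : η * δ = ε) (hδε : δ ^ 2 ≤ ε) {p q o : Fin n}
    (h : (p, q, o) ∈ tripleAnswers B δ η ε (r₁ ^ 2) (r₂ ^ 2) E t l) :
    (p, q) ∈ l ∧ NearDist r₁ (tripleConst s E * ε) (B p) (B o) ∧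
      NearDist r₂ (tripleConst s E * ε) (B q) (B o) := by
  obtain ⟨m, hm, i, s, e, f, hg, j, k, hk⟩ := mem_tripleAnswers.1 h
  refine ⟨hm ▸ List.getElem_mem m.2, ?_⟩
  unfold TripleGuard at hg
  unfold tripleKey tripleLookup at hk
  rw [hm] at hg hk
  exact nearDist_of_circle_lookup hs hs₁ hs₂ hr₁ hr₂ hδ hη hε hηδ hδε (signOf_eq s)
    (abs_centered_le e) (abs_centered_le f) hg hk

theorem exists_mem_tripleAnswers {n : ℕ} {B : Fin n → Pt} (hB : ∀ i, ‖B i‖ ≤ 1) {β s δ η ε : ℝ}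
    {a b c : Pt} {E : ℕ} {l : List (Fin n × Fin n)} (hβ : 0 < β) (hs : 0 < s)
    (hfat : IsFat β s a b c) (hδ : 0 < δ) (hη : 0 < η) (hδc : δ ≤ (β * s / 3) ^ 6 / 200)
    (hε : ε ≤ δ) (hηδ : η * δ = ε) (hδε : δ ^ 2 ≤ ε) (hεc : ε ≤ (β * s / 3) ^ 2 / 40)
    (hE : circleConst (β * s / 3) + 2 ≤ E) {p q o : Fin n} (hpq : (p, q) ∈ l)
    (h : NearCongruent a b c ε (B p) (B q) (B o)) :
    ∃ t, (p, q, o) ∈ tripleAnswers B δ η ε (dist a c ^ 2) (dist b c ^ 2) E t l := by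
  obtain ⟨t, sg, e, f, j, k, hsg, he, hf, hj, hk, hg, hkey⟩ :=
    exists_circle_lookup hβ hs hfat hδ hη hδc hε hηδ hδε hεc hE h
  obtain ⟨s, rfl⟩ := exists_signOf hsg
  obtain ⟨e, rfl⟩ := exists_centered he
  obtain ⟨f, rfl⟩ := exists_centered hf
  obtain ⟨j, rfl⟩ := exists_centered_of_le hj lt_width
  obtain ⟨k, rfl⟩ := exists_centered_of_le hk lt_width
  obtain ⟨i, hi⟩ := exists_centered_of_le (abs_floor_div_le hδ (abs_coord_le_one (hB o) t)) lt_width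
  obtain ⟨m, hm, hml⟩ := List.getElem_of_mem hpq
  refine ⟨t, mem_tripleAnswers.2 ⟨⟨m, hm⟩, hml, i, s, e, f, ?_, j, k, ?_⟩⟩
  · unfold TripleGuard
    simp only [Fin.getElem_fin, hml, hi]
    exact hg
  · unfold tripleKey tripleLookup
    simp only [Fin.getElem_fin, hml, hi]
    exact hkey

theorem nodup_tripleInsertions {n : ℕ} {B : Fin n → Pt} {δ η ε : ℝ} {t : Fin 3} :
    (insertions n (2 * width 2 η + 1) (tripleKey B δ η ε t)).Nodup := by
  refine nodup_insertions fun o j k j' k' h => ?_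
  simp only [tripleKey, circleKey, List.cons.injEq] at h
  exact ⟨centered_injective h.2.1, centered_injective h.2.2.1⟩

/-- The slab is determined by the first digit of the key of the third point. The sign and two shifts
are free, and `M` accounts for repetitions of the pair. -/
theorem count_tripleAnswers_le {n : ℕ} {B : Fin n → Pt} {δ η ε R₁ R₂ : ℝ} {E : ℕ} {t : Fin 3}
    {l : List (Fin n × Fin n)} {M : ℕ} (hl : ∀ x, l.count x ≤ M) (x : Fin n × Fin n × Fin n) :
    (tripleAnswers B δ η ε R₁ R₂ E t l).count x ≤
      M * (2 * ((2 * E + 1) * ((2 * E + 1) * 1))) := by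
  classical
  have hmem : ∀ {m i s e f} {y : Fin n × Fin n × Fin n},
      (y ∈ if TripleGuard B δ R₁ R₂ E t l m i s e f then
        (bucket (insertions n (2 * width 2 η + 1) (tripleKey B δ η ε t))
          (tripleLookup B δ η ε R₁ R₂ E t l m i s e f)).map (fun o => (l[m].1, l[m].2, o))
        else []) →
      l[m] = (y.1, y.2.1) ∧ centered _ i = ⌊B y.2.2 t / δ⌋ := by
    intro m i s e f y hy
    split_ifs at hy with hg
    · obtain ⟨o, ho, rfl⟩ := List.mem_map.1 hy
      obtain ⟨j, k, hjk⟩ := mem_insertions.1 (mem_bucket.1 ho)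
      simp only [tripleKey, tripleLookup, circleKey, circleLookup, List.cons.injEq] at hjk
      exact ⟨rfl, hjk.1.symm⟩
    · simp at hy
  unfold tripleAnswers answers
  refine (count_flatMap_finRange_length_le l _ x (x.1, x.2.1) (fun m => ?_) (fun m h => ?_)).trans
    (Nat.mul_le_mul_right _ (hl _))
  refine count_flatMap_le_of_unique _ x (fun i => ?_) (fun i i' h h' => ?_)
  refine count_flatMap_le _ x (fun s => ?_)
  refine count_flatMap_le _ x (fun e => ?_)
  refine count_flatMap_le _ x (fun f => ?_)
  · split_ifs
    · refine List.nodup_iff_count_le_one.1 ?_ x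
      exact (nodup_bucket nodup_tripleInsertions _).map fun q q' h =>
        (Prod.ext_iff.1 (Prod.ext_iff.1 h).2).2
    · simp
  all_goals
    simp only [List.mem_flatMap, List.mem_finRange, true_and] at h
  · simp only [List.mem_flatMap, List.mem_finRange, true_and] at h'
    obtain ⟨s, e, f, h⟩ := h
    obtain ⟨s', e', f', h'⟩ := h'
    exact centered_injective ((hmem h).2.trans (hmem h').2.symm)
  · obtain ⟨i, s, e, f, h⟩ := h
    exact (hmem h).1

end NearTriangles

/-! ### The two programs assembled -/

namespace RealRAM

theorem Emits.imp {X : Type*} {d : ℕ} {J₁ J₂ J₁' J₂' : List X → Memory → Prop}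
    {rep : X → List (List ℝ)} {c : Cmd} {ρ : ℕ → ℝ} {xs : List X} {b : ℕ}
    (h : Emits d J₁ J₂ rep c ρ xs b) (h₁ : ∀ l M, J₁' l M → J₁ l M)
    (h₂ : ∀ l M, J₂ l M → J₂' l M) : Emits d J₁' J₂' rep c ρ xs b := by
  intro l σ hσ hJ
  obtain ⟨σ', t, a1, a2, a3, a4⟩ := h l σ hσ (h₁ _ _ hJ)
  exact ⟨σ', t, a1, a2, h₂ _ _ a3, a4⟩

theorem Fresh.mono {X : Type*} {L : List X → Memory → Prop} {A A' : ℕ} (hA : A ≤ A') {l : List X}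
    {M : Memory} (h : Fresh L A l M) : Fresh L A' l M :=
  ⟨h.1, fun k hk => h.2 k (hA.trans hk)⟩

/-- Times are proved in terms of lengths but claimed in terms of distinct items; bounded
multiplicity converts one into the other. -/
theorem length_le_mul_card_toFinset {X : Type*} [DecidableEq X] [i : BEq X] [LawfulBEq X] {l : List X}
    {M : ℕ} (h : ∀ x, l.count x ≤ M) : l.length ≤ M * l.toFinset.card := by
  obtain rfl : i = instBEqOfDecidableEq := lawful_beq_subsingleton _ _
  rw [← List.sum_toFinset_count_eq_length, mul_comm]
  exact Finset.sum_le_card_nsmul _ _ _ fun x _ => h x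

end RealRAM

namespace NearTriangles

open RealRAM

/-- The pair step: bucketing if `ε` is less than `1 / K`, and all pairs otherwise. -/
def pairStepC (K E : ℕ) : Cmd :=
  .seq (.assign 2 (.sqrt (.reg 1)))
    (.branch (.reg 1 * .const K) (.const 1)
      (.seq (pairPhaseC E 0 20) (.seq (pairPhaseC E 1 22) (pairPhaseC E 2 24)))
      (forC 3 (.reg 0) (forC 4 (.reg 0) (emitPairC (.reg 4)))))

/-- The phases of the triple step. -/
def triplePhasesC (E : ℕ) : Cmd :=
  .seq (triplePhaseC E 0 26) (.seq (triplePhaseC E 1 28) (triplePhaseC E 2 30))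

/-- The triple step: bucketing, with a width that depends on the number of saved pairs, if `ε` is
less than `1 / K`, and all extensions of saved pairs otherwise. -/
def tripleStepC (K E : ℕ) : Cmd :=
  .branch (.reg 1 * .const K) (.const 1)
    (.branch (.get 8 (.const 0) * .sqrt (.reg 1)) (.reg 0)
      (.seq (.assign 2 (.reg 1)) (triplePhasesC E))
      (.seq (.assign 2 (.sqrt (.reg 1))) (triplePhasesC E)))
    (.seq (.assign 2 (.reg 1))
      (forC 3 (.get 8 (.const 0)) (forC 4 (.reg 0) (emitTripleC (.reg 4)))))

section Steps

variable {n : ℕ} {B : Fin n → Pt} {a b c : Pt} {δ η ε : ℝ} {ρ : ℕ → ℝ}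

theorem eval_lt_one_iff {σ : State} {K : ℕ} (h1 : ρ 1 = ε) {d : ℕ} (hd : 1 < d)
    (hσ : Agree d ρ σ) :
    (Expr.reg 1 * Expr.const K).eval σ < (Expr.const 1).eval σ ↔ ε * K < 1 := by
  simp [Expr.eval, hσ 1 hd, h1]

theorem emits_pairStepC_of_lt (hB : ∀ i, ‖B i‖ ≤ 1) (hε : 0 < ε) (hε1 : ε ≤ 1)
    (hab : dist a b ≤ 1 / 2) (K E : ℕ) (hK : ε * K < 1) (h0 : ρ 0 = n) (h1 : ρ 1 = ε) {N : ℕ}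
    (hN : 1 + n * (1 + (2 * width 2 (√ε) + 1) * 1) ≤ N)
    (hN' : 1 + n * (1 + (2 * width 1 (√ε) + 1) * (1 + (2 * width 1 (√ε) + 1) *
      (1 + 2 * (1 + (2 * E + 1) * 1)))) ≤ N) :
    Emits 2 (Fresh (HoldsPairs B a b c) 20) (Fresh (HoldsPairs B a b c) 26)
      (fun x => [encodePair x]) (pairStepC K E) ρ
      (pairAnswers B (√ε) ε (dist a b ^ 2) E 0 ++ (pairAnswers B (√ε) ε (dist a b ^ 2) E 1 ++
        pairAnswers B (√ε) ε (dist a b ^ 2) E 2))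
      (N + n * ((2 * width 2 (√ε) + 1) * (2 * width 2 (√ε) + 1))) := by
  have hs0 : 0 < √ε := Real.sqrt_pos.2 hε
  have hs1 : √ε ≤ 1 := Real.sqrt_le_one.2 hε1
  have hεs : ε ≤ √ε := Real.le_sqrt_of_sq_le (by nlinarith)
  -- Each axis uses its own two empty arrays, starting at `20`, `22` and `24`; those from `26` on
  -- stay empty for the triple step.
  have hphase : ∀ t A, 20 ≤ A → _ := fun t A hA => emits_pairPhaseC (c := c) hB hs0 hε hεs hs1 hab E t
    hA (ρ := Function.update ρ 2 (√ε)) (by simpa using h0) (by simpa using h1) (by simp) hN hN'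
  refine .assign_seq (by omega) (.branch_pos (by omega) ((hphase 0 20 (by norm_num)).seq
    ((hphase 1 22 (by norm_num)).seq (hphase 2 24 (by norm_num)))) fun l σ hσ _ => ?_)
    fun l σ hσ _ => ?_
  · rwa [eval_lt_one_iff (by simpa using h1) (by norm_num) hσ]
  · simp [Expr.eval, hσ 1 (by norm_num), h1]

/-- All pairs of indices. -/
def allPairs (n : ℕ) : List (Fin n × Fin n) :=
  (List.finRange n).flatMap fun p => (List.finRange n).flatMap fun q => [(p, q)]

theorem mem_allPairs (x : Fin n × Fin n) : x ∈ allPairs n := by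
  exact List.mem_flatMap.2 ⟨x.1, List.mem_finRange _,
    List.mem_flatMap.2 ⟨x.2, List.mem_finRange _, List.mem_singleton.2 rfl⟩⟩

theorem count_allPairs_le (x : Fin n × Fin n) : (allPairs n).count x ≤ 1 := by
  refine count_flatMap_le_of_unique _ x (fun p => count_flatMap_le_of_unique _ x (fun q => ?_) ?_) ?_
  · exact List.count_le_length
  · simp +contextual [Prod.ext_iff]
  · simp +contextual [Prod.ext_iff]

/-- The quadratic time is paid by the output, since every innermost iteration emits a pair. -/
theorem emits_pairStepC_of_not_lt (K E : ℕ) (hK : ¬ ε * K < 1) (h0 : ρ 0 = n) (h1 : ρ 1 = ε) :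
    Emits 2 (Fresh (HoldsPairs B a b c) 20) (Fresh (HoldsPairs B a b c) 26)
      (fun x => [encodePair x]) (pairStepC K E) ρ (allPairs n) (1 + n * 1) := by
  refine .assign_seq (v := √ε) (by omega) (.branch_neg (by omega) (.imp (.forC (b := 1)
    (fun l σ hσ _ => ?_) (fun p => .forC (b := 0) (fun l σ hσ _ => ?_) (fun q => ?_)
      (by omega) (by simp)) le_rfl (by simp)) (fun _ _ h => h)
    (fun _ _ h => h.mono (by norm_num))) fun l σ hσ _ => ?_) fun l σ hσ _ => ?_
  · simp [Expr.eval, hσ 0 (by norm_num), h0]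
  · simp [Expr.eval, hσ 0 (by norm_num), h0]
  · exact emits_emitPairC (U := fun M => ∀ k, 20 ≤ k → ∀ z, M k z = 0)
      (fun M M' hM hU k hk => by rw [← hM k hk]; exact hU k hk) (by norm_num) (by simp)
      (fun l σ hσ _ => by simp [Expr.eval, hσ 4 (by norm_num)])
  · rwa [eval_lt_one_iff (by simpa using h1) (by norm_num) hσ]
  · simp [Expr.eval, hσ 1 (by norm_num), h1]

variable {l : List (Fin n × Fin n)}

theorem emits_triplePhasesC (hB : ∀ i, ‖B i‖ ≤ 1) (hδ : 0 < δ) (hη : 0 < η) (hε : 0 < ε)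
    (hεδ : ε ≤ δ) (hεη : ε ≤ η) (hδ1 : δ ≤ 1) (hη1 : η ≤ 1) (hηδ : ε / δ = η)
    (hac : dist a c ^ 2 ≤ 1) (E : ℕ) (h0 : ρ 0 = n) (h1 : ρ 1 = ε) (h2 : ρ 2 = δ) {N : ℕ}
    (hN : 1 + n * (1 + (2 * width 2 η + 1) * 1) ≤ N)
    (hN' : 1 + l.length * (1 + (2 * width 1 δ + 1) * (1 + 2 * (1 + (2 * E + 1) *
      (1 + (2 * E + 1) * 1)))) ≤ N) :
    Emits 3 (Fresh (fun _ => HoldsPairs B a b c l) 26) (Fresh (fun _ => HoldsPairs B a b c l) 32)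
      (fun x => [encodeTriple x]) (triplePhasesC E) ρ
      (tripleAnswers B δ η ε (dist a c ^ 2) (dist b c ^ 2) E 0 l ++
        (tripleAnswers B δ η ε (dist a c ^ 2) (dist b c ^ 2) E 1 l ++
          tripleAnswers B δ η ε (dist a c ^ 2) (dist b c ^ 2) E 2 l))
      (N + n * ((2 * width 2 η + 1) * (2 * width 2 η + 1))) := by
  have hphase : ∀ t A, 20 ≤ A → _ := fun t A hA => emits_triplePhaseC (b := b) hB hδ hη hε hεδ hεη
    hδ1 hη1 hηδ hac E t l hA h0 h1 h2 hN hN'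
  exact (hphase 0 26 (by norm_num)).seq
    ((hphase 1 28 (by norm_num)).seq (hphase 2 30 (by norm_num)))

theorem eval_get_lt_iff {σ : State} (hσ : Agree 2 ρ σ) (hJ : HoldsPairs B a b c l σ.mem)
    (h0 : ρ 0 = n) (h1 : ρ 1 = ε) :
    (Expr.get 8 (.const 0) * .sqrt (.reg 1)).eval σ < (Expr.reg 0).eval σ ↔ l.length * √ε < n := by
  simp [Expr.eval, hσ 0 (by norm_num), hσ 1 (by norm_num), h0, h1, hJ.2.1]

/-- Few pairs: with slabs of thickness `ε` the slopes are rounded to integers, so each point is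
stored only a bounded number of times. -/
theorem emits_tripleStepC_of_lt_of_lt (hB : ∀ i, ‖B i‖ ≤ 1) (hε : 0 < ε) (hε1 : ε ≤ 1)
    (hac : dist a c ^ 2 ≤ 1) (K E : ℕ) (hK : ε * K < 1) (hl : l.length * √ε < n) (h0 : ρ 0 = n)
    (h1 : ρ 1 = ε) {N : ℕ} (hN : 1 + n * (1 + (2 * width 2 1 + 1) * 1) ≤ N)
    (hN' : 1 + l.length * (1 + (2 * width 1 ε + 1) * (1 + 2 * (1 + (2 * E + 1) *
      (1 + (2 * E + 1) * 1)))) ≤ N) :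
    Emits 2 (Fresh (fun _ => HoldsPairs B a b c l) 26) (Fresh (fun _ => HoldsPairs B a b c l) 32)
      (fun x => [encodeTriple x]) (tripleStepC K E) ρ
      (tripleAnswers B ε 1 ε (dist a c ^ 2) (dist b c ^ 2) E 0 l ++
        (tripleAnswers B ε 1 ε (dist a c ^ 2) (dist b c ^ 2) E 1 l ++
          tripleAnswers B ε 1 ε (dist a c ^ 2) (dist b c ^ 2) E 2 l))
      (N + n * ((2 * width 2 1 + 1) * (2 * width 2 1 + 1))) := by
  refine .branch_pos (by omega) (.branch_pos (by omega) (.assign_seq (v := ε) (by omega)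
    (emits_triplePhasesC hB hε one_pos hε le_rfl hε1 hε1 le_rfl (div_self hε.ne') hac E
      (by simpa using h0) (by simpa using h1) (by simp) hN hN')
    fun _ σ hσ _ => ?_) fun _ σ hσ hJ => ?_) fun _ σ hσ _ => ?_
  · simp [Expr.eval, hσ 1 (by norm_num), h1]
  · rwa [eval_get_lt_iff hσ hJ.1 h0 h1]
  · rwa [eval_lt_one_iff h1 (by norm_num) hσ]

/-- Many pairs: slabs as thick as `δ ^ 2 ≤ ε` allows, which makes the lookups per pair as few as
possible. -/
theorem emits_tripleStepC_of_lt_of_not_lt (hB : ∀ i, ‖B i‖ ≤ 1) (hε : 0 < ε) (hε1 : ε ≤ 1)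
    (hac : dist a c ^ 2 ≤ 1) (K E : ℕ) (hK : ε * K < 1) (hl : ¬ l.length * √ε < n) (h0 : ρ 0 = n)
    (h1 : ρ 1 = ε) {N : ℕ} (hN : 1 + n * (1 + (2 * width 2 (√ε) + 1) * 1) ≤ N)
    (hN' : 1 + l.length * (1 + (2 * width 1 (√ε) + 1) * (1 + 2 * (1 + (2 * E + 1) *
      (1 + (2 * E + 1) * 1)))) ≤ N) :
    Emits 2 (Fresh (fun _ => HoldsPairs B a b c l) 26) (Fresh (fun _ => HoldsPairs B a b c l) 32)
      (fun x => [encodeTriple x]) (tripleStepC K E) ρ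
      (tripleAnswers B (√ε) (√ε) ε (dist a c ^ 2) (dist b c ^ 2) E 0 l ++
        (tripleAnswers B (√ε) (√ε) ε (dist a c ^ 2) (dist b c ^ 2) E 1 l ++
          tripleAnswers B (√ε) (√ε) ε (dist a c ^ 2) (dist b c ^ 2) E 2 l))
      (N + n * ((2 * width 2 (√ε) + 1) * (2 * width 2 (√ε) + 1))) := by
  have hs0 : 0 < √ε := Real.sqrt_pos.2 hε
  have hs1 : √ε ≤ 1 := Real.sqrt_le_one.2 hε1
  have hεs : ε ≤ √ε := Real.le_sqrt_of_sq_le (by nlinarith)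
  refine .branch_pos (by omega) (.branch_neg (by omega) (.assign_seq (v := √ε) (by omega)
    (emits_triplePhasesC hB hs0 hs0 hε hεs hεs hs1 hs1 Real.div_sqrt hac E
      (by simpa using h0) (by simpa using h1) (by simp) hN hN')
    fun _ σ hσ _ => ?_) fun _ σ hσ hJ => ?_) fun _ σ hσ _ => ?_
  · simp [Expr.eval, hσ 1 (by norm_num), h1]
  · rwa [eval_get_lt_iff hσ hJ.1 h0 h1]
  · rwa [eval_lt_one_iff h1 (by norm_num) hσ]

/-- All extensions of the pairs in a list to triples. -/
def allExtensions (l : List (Fin n × Fin n)) : List (Fin n × Fin n × Fin n) :=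
  (List.finRange l.length).flatMap fun m => (List.finRange n).flatMap fun o =>
    [(l[m].1, l[m].2, o)]

theorem mem_allExtensions {p q o : Fin n} : (p, q, o) ∈ allExtensions l ↔ (p, q) ∈ l := by
  simp only [allExtensions, List.mem_flatMap, List.mem_finRange, true_and, List.mem_singleton,
    Prod.mk.injEq]
  constructor
  · rintro ⟨m, o, h1, h2, -⟩
    have : l[m] = (p, q) := Prod.ext h1.symm h2.symm
    exact this ▸ List.getElem_mem m.2
  · intro h
    obtain ⟨m, hm, hml⟩ := List.getElem_of_mem h
    exact ⟨⟨m, hm⟩, o, by simp [hml]⟩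

theorem count_allExtensions_le {M : ℕ} (hl : ∀ x, l.count x ≤ M) (x : Fin n × Fin n × Fin n) :
    (allExtensions l).count x ≤ M * 1 := by
  refine (count_flatMap_finRange_length_le l _ x (x.1, x.2.1) (M := 1) (fun m =>
    count_flatMap_le_of_unique _ x (fun o => ?_) ?_) ?_).trans (Nat.mul_le_mul_right _ (hl _))
  · exact List.count_le_length
  · simp +contextual [Prod.ext_iff]
  · simp +contextual [Prod.ext_iff]

theorem emits_tripleStepC_of_not_lt (K E : ℕ) (hK : ¬ ε * K < 1) (h0 : ρ 0 = n) (h1 : ρ 1 = ε) :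
    Emits 2 (Fresh (fun _ => HoldsPairs B a b c l) 26) (Fresh (fun _ => HoldsPairs B a b c l) 32)
      (fun x => [encodeTriple x]) (tripleStepC K E) ρ (allExtensions l) (1 + l.length * 1) := by
  -- The value of register `2` is irrelevant here. The assignment only protects it, so that the loop
  -- counters start at register `3`, which `emitTripleC` reads.
  refine .branch_neg (by omega) (.assign_seq (v := ε) (by omega) (.imp (.forC (b := 1)
    (fun _ σ hσ hJ => ?_) (fun m => .forC (b := 0) (fun _ σ hσ _ => ?_) (fun o => ?_)
      (by omega) (by simp)) le_rfl (by simp)) (fun _ _ h => h)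
    (fun _ _ h => h.mono (by norm_num))) fun _ σ hσ _ => ?_) fun _ σ hσ _ => ?_
  · simp [Expr.eval, hJ.1.2.1]
  · simp [Expr.eval, hσ 0 (by norm_num), h0]
  · exact emits_emitTripleC (fun _ _ h => h.1) (fun _ _ _ h => h) (by norm_num) (by simp)
      (fun _ σ hσ _ => by simp [Expr.eval, hσ 4 (by norm_num)])
  · simp [Expr.eval, hσ 1 (by norm_num), h1]
  · rwa [eval_lt_one_iff h1 (by norm_num) hσ]

end Steps

end NearTriangles

/-! ### Choice of constants, running times and the theorem -/

namespace RealRAM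

theorem Emits.exists_runs {X : Type*} {d : ℕ} {J J' : List X → Memory → Prop} {f : X → List ℝ}
    {c : Cmd} {ρ : ℕ → ℝ} {xs : List X} {b : ℕ} (h : Emits d J J' (fun x => [f x]) c ρ xs b)
    {σ : State} (hσ : Agree d ρ σ) (hJ : J [] σ.mem) :
    ∃ σ' t, Runs c σ σ' (xs.map f) t ∧ Agree d ρ σ' ∧ J' xs σ'.mem ∧
      t ≤ c.size * (b + xs.length) := by
  rw [List.map_eq_flatMap]
  exact h [] σ hσ hJ

end RealRAM

namespace NearTriangles

open RealRAM

/-- Translates the test `ε * K < 1` made by the program into the smallness of `√ε` that the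
geometric estimates need. -/
theorem sqrt_le_of_mul_lt_one {x ε : ℝ} {K : ℕ} (hx : 0 < x) (hε : 0 < ε) (hK : (1 / x) ^ 2 ≤ K)
    (h : ε * K < 1) : √ε ≤ x := by
  rw [Real.sqrt_le_left hx.le]
  have h1 : ε * (1 / x) ^ 2 ≤ 1 := (mul_le_mul_of_nonneg_left hK hε.le).trans h.le
  rw [div_pow, one_pow, mul_one_div, div_le_one (by positivity)] at h1
  exact h1

theorem NearDist.mono {d δ δ' : ℝ} {p q : Pt} (h : NearDist d δ p q) (hδ : δ ≤ δ') :
    NearDist d δ' p q := le_trans h hδ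

/-- Distances in the unit ball are at most `2`. This makes exhaustive reporting sound when `ε` is
not small. -/
theorem nearDist_three {d δ : ℝ} {p q : Pt} (hp : ‖p‖ ≤ 1) (hq : ‖q‖ ≤ 1) (hd : 0 ≤ d)
    (hd' : d ≤ 1 / 2) (hδ : 3 ≤ δ) : NearDist d δ p q := by
  have h1 : dist p q ≤ 2 := by
    rw [dist_eq_norm]; exact (norm_sub_le p q).trans (by linarith)
  have h2 := dist_nonneg (x := p) (y := q)
  unfold NearDist
  rw [abs_le]
  constructor <;> linarith

theorem two_mul_width_two_le {η : ℝ} (hη : 0 < η) (hη1 : η ≤ 1) :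
    ((2 * width 2 η + 1 : ℕ) : ℝ) ≤ 7 * (1 / η) := by
  have h1 := width_le (c := 2) (by norm_num) hη
  have h2 : 1 ≤ 1 / η := by rw [le_div_iff₀ hη]; linarith
  have h3 : 2 / η = 2 * (1 / η) := by ring
  push_cast
  linarith

theorem two_mul_width_one_le {δ : ℝ} (hδ : 0 < δ) (hδ1 : δ ≤ 1) :
    ((2 * width 1 δ + 1 : ℕ) : ℝ) ≤ 5 * (1 / δ) := by
  have h1 := width_le (c := 1) (by norm_num) hδ
  have h2 : 1 ≤ 1 / δ := by rw [le_div_iff₀ hδ]; linarith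
  push_cast
  linarith

theorem pair_cost_le {n x W S G : ℝ} (hn : 1 ≤ n) (hx : 1 ≤ x) (hW0 : 0 ≤ W) (hW : W ≤ 7 * x)
    (hS0 : 0 ≤ S) (hS : S ≤ 5 * x) (hG : 0 ≤ G) :
    1 + n * (1 + W * 1) + (1 + n * (1 + S * (1 + S * G))) + n * (W * W) ≤
      (67 + 25 * G) * (n * x ^ 2) := by
  have hx2 : x ≤ x ^ 2 := by nlinarith
  have e1 : W * W ≤ 7 * x * (7 * x) := by gcongr
  have e2 : S * (1 + S * G) ≤ 5 * x * (x + 5 * x * G) := by gcongr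
  have e3 : n * (2 + (1 + W * 1) + (1 + S * (1 + S * G)) + W * W) ≤
      n * ((67 + 25 * G) * x ^ 2) := by
    refine mul_le_mul_of_nonneg_left ?_ (by linarith)
    nlinarith
  nlinarith

theorem triple_cost_le {n k x y W S G : ℝ} (hn : 1 ≤ n) (hk : 0 ≤ k) (hx : 1 ≤ x) (hy : 1 ≤ y)
    (hW0 : 0 ≤ W) (hW : W ≤ 7 * y) (hS : S ≤ 5 * x) (hG : 0 ≤ G) :
    1 + n * (1 + W * 1) + (1 + k * (1 + S * G)) + n * (W * W) ≤
      59 * (n * y ^ 2) + (1 + 5 * G) * (k * x) := by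
  have hy2 : y ≤ y ^ 2 := by nlinarith
  have e1 : W * W ≤ 7 * y * (7 * y) := by gcongr
  have e2 : n * (2 + (1 + W * 1) + W * W) ≤ n * (59 * y ^ 2) := by
    refine mul_le_mul_of_nonneg_left ?_ (by linarith)
    nlinarith
  have e3 : k * (1 + S * G) ≤ k * (x + 5 * x * G) := by gcongr
  nlinarith

/-- The cube root of the hypothesis is `N ^ (1/3) * ε ^ (1/6) ≤ n ^ (1/3)`; multiply by `N ^ (2/3) /
ε ^ (7/6)`. -/
theorem div_le_of_mul_sqrt_le {n N ε : ℝ} (hN : 0 ≤ N) (hε : 0 < ε) (h : N * √ε ≤ n) :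
    N / ε ≤ n ^ (1 / 3 : ℝ) * N ^ (2 / 3 : ℝ) / ε ^ (7 / 6 : ℝ) := by
  have h1 : N ^ (1 / 3 : ℝ) * ε ^ (1 / 6 : ℝ) ≤ n ^ (1 / 3 : ℝ) := by
    have := Real.rpow_le_rpow (by positivity) h (show (0 : ℝ) ≤ 1 / 3 by norm_num)
    rw [Real.mul_rpow hN (Real.sqrt_nonneg _), Real.sqrt_eq_rpow, ← Real.rpow_mul hε.le] at this
    norm_num at this ⊢
    exact this
  have h2 : N ^ (1 / 3 : ℝ) * N ^ (2 / 3 : ℝ) = N := by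
    rw [← Real.rpow_add_of_nonneg hN (by norm_num) (by norm_num)]; norm_num
  have h3 : ε ^ (7 / 6 : ℝ) = ε ^ (1 / 6 : ℝ) * ε := by
    rw [← Real.rpow_add_one hε.ne']; norm_num
  rw [h3, div_le_div_iff₀ hε (by positivity)]
  calc N * (ε ^ (1 / 6 : ℝ) * ε) = N ^ (1 / 3 : ℝ) * ε ^ (1 / 6 : ℝ) * N ^ (2 / 3 : ℝ) * ε := by
        nth_rewrite 1 [← h2]; ring
    _ ≤ _ := by gcongr

theorem time_le {X : Type*} [DecidableEq X] [BEq X] [LawfulBEq X] {xs : List X} {t size b M : ℕ} {C Y : ℝ}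
    (ht : t ≤ size * (b + xs.length)) (hb : (b : ℝ) ≤ C * Y) (hM : ∀ x, xs.count x ≤ M)
    (hC : 0 ≤ C) (hY : 0 ≤ Y) : (t : ℝ) ≤ size * (C + M) * (Y + xs.toFinset.card) := by
  have h1 : (xs.length : ℝ) ≤ M * xs.toFinset.card := by
    exact_mod_cast length_le_mul_card_toFinset hM
  have h2 : (t : ℝ) ≤ size * (b + xs.length) := by exact_mod_cast ht
  have h3 : (b : ℝ) + xs.length ≤ (C + M) * (Y + xs.toFinset.card) := by
    have : 0 ≤ C * (xs.toFinset.card : ℝ) := by positivity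
    have : 0 ≤ (M : ℝ) * Y := by positivity
    linarith
  rw [mul_assoc]
  exact h2.trans (by gcongr)

theorem exists_pairStep {β : ℝ} (hβ : 0 < β) : ∃ (α' C : ℝ) (M : ℕ) (c : Cmd), 0 ≤ C ∧
    ∀ (n : ℕ) (_ : 1 ≤ n) (B : Fin n → Pt) (_ : ∀ i, ‖B i‖ ≤ 1) (u v w : Pt) (_ : β ≤ dist u v)
      (_ : dist u v ≤ 1 / 2) (ε : ℝ) (_ : 0 < ε) (_ : ε ≤ 1 / 2),
    ∃ (σ : State) (l : List (Fin n × Fin n)) (t : ℕ),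
      Runs c (input B u v w ε) σ (l.map encodePair) t ∧
      (∀ i j, NearDist (dist u v) ε (B i) (B j) → (i, j) ∈ l) ∧
      (∀ i j, (i, j) ∈ l → NearDist (dist u v) (α' * ε) (B i) (B j)) ∧
      (∀ x, l.count x ≤ M) ∧ (t : ℝ) ≤ C * (n / ε + l.toFinset.card) ∧
      σ.reg 0 = n ∧ σ.reg 1 = ε ∧
      ∀ l' : List (Fin n × Fin n × Fin n), Fresh (fun _ => HoldsPairs B u v w l) 26 l' σ.mem := by
  obtain ⟨K, hK⟩ := exists_nat_ge ((1 / (β ^ 2 / 200)) ^ 2)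
  obtain ⟨E, hE⟩ := exists_nat_ge (sphereConst β + 3)
  have hα : 0 ≤ pairConst β E := by unfold pairConst; positivity
  set M : ℕ := 3 * (2 * ((2 * E + 1) * 1)) with hM
  set G : ℝ := 1 + 2 * (1 + (2 * E + 1) * 1) with hG
  have hG0 : 0 ≤ G := by rw [hG]; positivity
  -- The summand `3 * K` serves the exhaustive branch, where `ε * K ≥ 1` and hence `3 * K * ε ≥ 3`.
  refine ⟨pairConst β E + 3 * K, (pairStepC K E).size * ((67 + 25 * G) + M), M, pairStepC K E,
    by positivity, fun n hn B hB u v w huv huv' ε hε hε' => ?_⟩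
  have hn' : (1 : ℝ) ≤ n := by exact_mod_cast hn
  have hnε : (n : ℝ) ≤ n / ε := by rw [le_div_iff₀ hε]; nlinarith
  suffices ∃ (l : List (Fin n × Fin n)) (b : ℕ),
      Emits 2 (Fresh (HoldsPairs B u v w) 20) (Fresh (HoldsPairs B u v w) 26)
        (fun x => [encodePair x]) (pairStepC K E) (input B u v w ε).reg l b ∧
      (b : ℝ) ≤ (67 + 25 * G) * (n / ε) ∧
      (∀ i j, NearDist (dist u v) ε (B i) (B j) → (i, j) ∈ l) ∧
      (∀ i j, (i, j) ∈ l → NearDist (dist u v) ((pairConst β E + 3 * K) * ε) (B i) (B j)) ∧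
      ∀ x, l.count x ≤ M by
    obtain ⟨l, b, h1, h2, h3, h4, h5⟩ := this
    have hin : HoldsInput B u v w (input B u v w ε).mem := by
      refine ⟨fun t => ?_, rfl, rfl, rfl⟩
      fin_cases t <;> rfl
    have hJ : Fresh (HoldsPairs B u v w) 20 [] (input B u v w ε).mem := by
      refine ⟨⟨hin, by simp [input], by simp⟩, fun k hk z => ?_⟩
      simp only [input]
      split <;> first | omega | rfl
    obtain ⟨σ, t, r1, r2, r3, r4⟩ := h1.exists_runs (fun _ _ => rfl) hJ
    exact ⟨σ, l, t, r1, h3, h4, h5, time_le r4 h2 h5 (by positivity) (by positivity),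
      r2 0 (by norm_num), r2 1 (by norm_num), fun _ => r3⟩
  by_cases hεK : ε * K < 1
  · have hs0 : 0 < √ε := Real.sqrt_pos.2 hε
    have hs1 : √ε ≤ 1 := Real.sqrt_le_one.2 (by linarith)
    have hss : √ε * √ε = ε := Real.mul_self_sqrt hε.le
    have hsβ := sqrt_le_of_mul_lt_one (by positivity) hε hK hεK
    refine ⟨_, _, emits_pairStepC_of_lt hB hε (by linarith) huv' K E hεK rfl rfl
      (Nat.le_add_right _ _) (Nat.le_add_left _ _), ?_, fun i j h => ?_, fun i j h => ?_,
      fun x => ?_⟩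
    · have h := pair_cost_le hn' (x := 1 / √ε) (by rw [le_div_iff₀ hs0]; linarith)
        (Nat.cast_nonneg _) (two_mul_width_two_le hs0 hs1) (Nat.cast_nonneg _)
        (two_mul_width_one_le hs0 hs1) hG0
      rw [div_pow, one_pow, Real.sq_sqrt hε.le, mul_one_div] at h
      refine le_trans (le_of_eq ?_) h
      rw [hG]
      push_cast
      ring
    · obtain ⟨t, ht⟩ := exists_mem_pairAnswers hB hβ huv huv' hs0 hε' hsβ hss hE h
      simp only [List.mem_append]
      fin_cases t
      exacts [.inl ht, .inr (.inl ht), .inr (.inr ht)]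
    · have key : ∃ t, (i, j) ∈ pairAnswers B (√ε) ε (dist u v ^ 2) E t := by
        simp only [List.mem_append] at h
        rcases h with h | h | h
        exacts [⟨_, h⟩, ⟨_, h⟩, ⟨_, h⟩]
      obtain ⟨t, ht⟩ := key
      refine (nearDist_of_mem_pairAnswers hβ huv huv' hs0 hε' hss ht).mono ?_
      gcongr
      exact le_add_of_nonneg_right (by positivity)
    · simp only [List.count_append]
      have := fun t => count_pairAnswers_le (B := B) (δ := √ε) (ε := ε) (R := dist u v ^ 2) (E := E)
        (t := t) x
      have h0 := this 0
      have h1 := this 1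
      have h2 := this 2
      omega
  · refine ⟨_, _, emits_pairStepC_of_not_lt K E hεK rfl rfl, ?_, fun i j _ => mem_allPairs _,
      fun i j _ => nearDist_three (hB i) (hB j) dist_nonneg huv' ?_,
      fun x => (count_allPairs_le x).trans (by omega)⟩
    · push_cast
      nlinarith
    · push Not at hεK
      nlinarith


/-- The output of the bucketing variant of the triple step is complete and sound, and no triple
occurs often. -/
theorem tripleAnswers_append_spec {n : ℕ} {B : Fin n → Pt} (hB : ∀ i, ‖B i‖ ≤ 1)
    {β s α α' δ η ε : ℝ} {u v w : Pt} {E M' : ℕ} {l : List (Fin n × Fin n)} (hβ : 0 < β)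
    (hs : 0 < s) (hfat : IsFat β s u v w) (hε : 0 < ε) (hε' : ε ≤ 1 / 2)
    (hE : circleConst (β * s / 3) + 2 ≤ E)
    (hl : ∀ i j, NearDist (dist u v) ε (B i) (B j) → (i, j) ∈ l)
    (hl' : ∀ i j, (i, j) ∈ l → NearDist (dist u v) (α' * ε) (B i) (B j))
    (hlM : ∀ x, l.count x ≤ M') (hα' : α' * ε ≤ α * ε) (hα'' : tripleConst s E * ε ≤ α * ε)
    (hεδ : ε ≤ δ) (hη : 0 < η) (hδκ : δ ≤ (β * s / 3) ^ 6 / 200) (hηδ : η * δ = ε)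
    (hδε : δ ^ 2 ≤ ε) {l' : List (Fin n × Fin n × Fin n)}
    (hl'_eq : l' = tripleAnswers B δ η ε (dist u w ^ 2) (dist v w ^ 2) E 0 l ++
      (tripleAnswers B δ η ε (dist u w ^ 2) (dist v w ^ 2) E 1 l ++
        tripleAnswers B δ η ε (dist u w ^ 2) (dist v w ^ 2) E 2 l)) :
    (∀ i j k, NearCongruent u v w ε (B i) (B j) (B k) → (i, j, k) ∈ l') ∧
    (∀ i j k, (i, j, k) ∈ l' → NearCongruent u v w (α * ε) (B i) (B j) (B k)) ∧
    ∀ x, l'.count x ≤ 3 * (M' * (2 * ((2 * E + 1) * ((2 * E + 1) * 1)))) := by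
  subst hl'_eq
  have hκ : 0 < β * s / 3 := by positivity
  have huv' := hfat.ab_le
  have huw' := hfat.ac_le.trans huv'
  have hvw' := hfat.bc_le.trans huv'
  have hδ : 0 < δ := hε.trans_le hεδ
  refine ⟨fun i j k h => ?_, fun i j k h => ?_, fun x => ?_⟩
  · have hκ1 : β * s / 3 ≤ 1 := by
      have h1 := hfat.le_ab.trans huv'
      have h2 := hfat.le_ac.trans huw'
      nlinarith
    have hεκ : ε ≤ (β * s / 3) ^ 2 / 40 := by
      have : (β * s / 3) ^ 6 ≤ (β * s / 3) ^ 2 := pow_le_pow_of_le_one hκ.le hκ1 (by norm_num)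
      linarith [pow_pos hκ 2]
    obtain ⟨t, ht⟩ := exists_mem_tripleAnswers hB hβ hs hfat hδ hη (hδκ) hεδ hηδ hδε
      hεκ hE (hl i j h.1) h
    simp only [List.mem_append]
    fin_cases t
    exacts [.inl ht, .inr (.inl ht), .inr (.inr ht)]
  · have key : ∃ t, (i, j, k) ∈
        tripleAnswers B δ η ε (dist u w ^ 2) (dist v w ^ 2) E t l := by
      simp only [List.mem_append] at h
      rcases h with h | h | h
      exacts [⟨_, h⟩, ⟨_, h⟩, ⟨_, h⟩]
    obtain ⟨t, ht⟩ := key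
    obtain ⟨g1, g2, g3⟩ := nearDist_of_mem_tripleAnswers hs hfat.le_ac hfat.le_bc huw' hvw' hδ hη
      hε' hηδ hδε ht
    exact ⟨(hl' i j g1).mono hα', g2.mono hα'', g3.mono hα''⟩
  · simp only [List.count_append]
    have := fun t => count_tripleAnswers_le (B := B) (δ := δ) (η := η) (ε := ε)
      (R₁ := dist u w ^ 2) (R₂ := dist v w ^ 2) (E := E) (t := t) hlM x
    have h0 := this 0
    have h1 := this 1
    have h2 := this 2
    omega

set_option maxHeartbeats 1000000 in
theorem exists_tripleStep {β s : ℝ} (hβ : 0 < β) (hs : 0 < s) (α' : ℝ) (M' : ℕ) :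
    ∃ (α C : ℝ) (M : ℕ) (c : Cmd), 0 ≤ C ∧
    ∀ (n : ℕ) (_ : 1 ≤ n) (B : Fin n → Pt) (_ : ∀ i, ‖B i‖ ≤ 1) (u v w : Pt) (_ : IsFat β s u v w)
      (ε : ℝ) (_ : 0 < ε) (_ : ε ≤ 1 / 2) (l : List (Fin n × Fin n)) (σ : State)
      (_ : ∀ i j, NearDist (dist u v) ε (B i) (B j) → (i, j) ∈ l)
      (_ : ∀ i j, (i, j) ∈ l → NearDist (dist u v) (α' * ε) (B i) (B j))
      (_ : ∀ x, l.count x ≤ M') (_ : σ.reg 0 = n) (_ : σ.reg 1 = ε)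
      (_ : Fresh (fun _ : List (Fin n × Fin n × Fin n) => HoldsPairs B u v w l) 26 [] σ.mem),
    ∃ (σ' : State) (l' : List (Fin n × Fin n × Fin n)) (t : ℕ),
      Runs c σ σ' (l'.map encodeTriple) t ∧
      (∀ i j k, NearCongruent u v w ε (B i) (B j) (B k) → (i, j, k) ∈ l') ∧
      (∀ i j k, (i, j, k) ∈ l' → NearCongruent u v w (α * ε) (B i) (B j) (B k)) ∧
      (∀ x, l'.count x ≤ M) ∧
      (t : ℝ) ≤ C * ((n + l.toFinset.card) / ε ^ (1 / 2 : ℝ)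
        + (n : ℝ) ^ (1 / 3 : ℝ) * (l.toFinset.card : ℝ) ^ (2 / 3 : ℝ) / ε ^ (7 / 6 : ℝ)
        + l'.toFinset.card) := by
  have hκ : 0 < β * s / 3 := by positivity
  obtain ⟨K, hK⟩ := exists_nat_ge ((1 / ((β * s / 3) ^ 6 / 200)) ^ 2)
  obtain ⟨E, hE⟩ := exists_nat_ge (circleConst (β * s / 3) + 2)
  have hα : 0 ≤ tripleConst s E := by unfold tripleConst; positivity
  set M : ℕ := 3 * (M' * (2 * ((2 * E + 1) * ((2 * E + 1) * 1)))) with hM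
  set G : ℝ := 1 + 2 * (1 + (2 * E + 1) * (1 + (2 * E + 1) * 1)) with hG
  have hG0 : 0 ≤ G := by rw [hG]; positivity
  -- The sign of `α'` is not known, hence the absolute value. In `60 + 5 * G`, the part `59` is the
  -- insertion cost, which is charged to the pairs when there are many of them, and `1 + 5 * G` is
  -- the lookup cost. The factor `M'` passes from `l.length` to the number of distinct pairs.
  refine ⟨|α'| + tripleConst s E + 3 * K, (tripleStepC K E).size * (59 + (60 + 5 * G) * M' + M), M,
    tripleStepC K E, by positivity,
    fun n hn B hB u v w hfat ε hε hε' l σ hl hl' hlM h0 h1 hJ => ?_⟩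
  have huv' := hfat.ab_le
  have huw' := hfat.ac_le.trans huv'
  have hvw' := hfat.bc_le.trans huv'
  have huw2 : dist u w ^ 2 ≤ 1 := pow_le_one₀ dist_nonneg (by linarith)
  have hs0 : 0 < √ε := Real.sqrt_pos.2 hε
  have hs1 : √ε ≤ 1 := Real.sqrt_le_one.2 (by linarith)
  have hss : √ε * √ε = ε := Real.mul_self_sqrt hε.le
  have hεs : ε ≤ √ε := by nlinarith
  have hn' : (1 : ℝ) ≤ n := by exact_mod_cast hn
  have hnε : (n : ℝ) ≤ n / √ε := by rw [le_div_iff₀ hs0]; nlinarith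
  have hlen : (l.length : ℝ) ≤ M' * l.toFinset.card := by
    exact_mod_cast length_le_mul_card_toFinset hlM
  have hlen' : (l.toFinset.card : ℝ) ≤ l.length := by exact_mod_cast l.toFinset_card_le
  have hlen0 : (0 : ℝ) ≤ l.length := Nat.cast_nonneg _
  have hlenε : (l.length : ℝ) / √ε ≤ M' * (l.toFinset.card / √ε) := by
    rw [← mul_div_assoc]; gcongr
  have h1s : 1 ≤ 1 / √ε := by rw [le_div_iff₀ hs0]; linarith
  rw [← Real.sqrt_eq_rpow]
  set N : ℝ := (l.toFinset.card : ℝ) with hN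
  have hN0 : 0 ≤ N := Nat.cast_nonneg _
  set Z : ℝ := (n : ℝ) ^ (1 / 3 : ℝ) * N ^ (2 / 3 : ℝ) / ε ^ (7 / 6 : ℝ) with hZ
  have hZ0 : 0 ≤ Z := by rw [hZ]; positivity
  have hNs : 0 ≤ N / √ε := by positivity
  have hM'0 : (0 : ℝ) ≤ M' := Nat.cast_nonneg _
  have hcost : ∀ b : ℝ, b ≤ 59 * (n / √ε) + (60 + 5 * G) * (M' * (N / √ε)) +
      (60 + 5 * G) * (M' * Z) →
      b ≤ (59 + (60 + 5 * G) * M') * ((n + N) / √ε + Z) := by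
    intro b hb
    refine hb.trans ?_
    rw [add_div]
    have e1 : 0 ≤ (60 + 5 * G) * M' * (n / √ε) := by positivity
    linarith
  have hα' : α' * ε ≤ (|α'| + tripleConst s E + 3 * K) * ε := by
    gcongr
    linarith [le_abs_self α', Nat.cast_nonneg (α := ℝ) K]
  have hα'' : tripleConst s E * ε ≤ (|α'| + tripleConst s E + 3 * K) * ε := by
    gcongr
    linarith [abs_nonneg α', Nat.cast_nonneg (α := ℝ) K]
  suffices ∃ (l' : List (Fin n × Fin n × Fin n)) (b : ℕ),
      Emits 2 (Fresh (fun _ => HoldsPairs B u v w l) 26)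
        (Fresh (fun _ => HoldsPairs B u v w l) 32)
        (fun x => [encodeTriple x]) (tripleStepC K E) σ.reg l' b ∧
      (b : ℝ) ≤ (59 + (60 + 5 * G) * M') * ((n + N) / √ε + Z) ∧
      (∀ i j k, NearCongruent u v w ε (B i) (B j) (B k) → (i, j, k) ∈ l') ∧
      (∀ i j k, (i, j, k) ∈ l' →
        NearCongruent u v w ((|α'| + tripleConst s E + 3 * K) * ε) (B i) (B j) (B k)) ∧
      ∀ x, l'.count x ≤ M by
    obtain ⟨l', b, h1, h2, h3, h4, h5⟩ := this
    obtain ⟨σ', t, r1, r2, r3, r4⟩ := h1.exists_runs (fun _ _ => rfl) hJ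
    exact ⟨σ', l', t, r1, h3, h4, h5, time_le r4 h2 h5 (by positivity) (by positivity)⟩
  have hsκ : ε * K < 1 → √ε ≤ (β * s / 3) ^ 6 / 200 :=
    fun h => sqrt_le_of_mul_lt_one (by positivity) hε hK h
  by_cases hεK : ε * K < 1
  · by_cases hln : l.length * √ε < n
    · obtain ⟨f1, f2, f3⟩ := tripleAnswers_append_spec hB hβ hs hfat hε hε' hE hl hl' hlM hα' hα''
        le_rfl one_pos (hεs.trans (hsκ hεK)) (one_mul ε) (by nlinarith) rfl
      refine ⟨_, _, emits_tripleStepC_of_lt_of_lt hB hε (by linarith) huw2 K E hεK hln h0 h1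
        (Nat.le_add_right _ _) (Nat.le_add_left _ _), hcost _ ?_, f1, f2, f3⟩
      have h := triple_cost_le hn' hlen0 (x := 1 / ε) (y := 1)
        (by rw [le_div_iff₀ hε]; linarith) le_rfl (Nat.cast_nonneg (2 * width 2 1 + 1))
        (by simpa using two_mul_width_two_le one_pos le_rfl)
        (two_mul_width_one_le hε (by linarith)) hG0
      -- Few pairs: the lookup cost is absorbed by the mixed term. The program compares `l.length`,
      -- with repetitions, which is at least `N`, so its test also bounds `N * √ε`.
      have h2 : (l.length : ℝ) * (1 / ε) ≤ M' * Z := by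
        have h3 : N / ε ≤ Z := div_le_of_mul_sqrt_le hN0 hε
          ((mul_le_mul_of_nonneg_right hlen' hs0.le).trans hln.le)
        rw [mul_one_div]
        calc (l.length : ℝ) / ε ≤ M' * N / ε := by gcongr
          _ = M' * (N / ε) := by ring
          _ ≤ M' * Z := by gcongr
      have h3 : (1 + 5 * G) * (l.length * (1 / ε)) ≤ (60 + 5 * G) * (M' * Z) := by
        gcongr; norm_num
      have h4 : 0 ≤ (60 + 5 * G) * (M' * (N / √ε)) := by positivity
      have h5 := le_trans h (b := 59 * ((n : ℝ) * 1 ^ 2) + (1 + 5 * G) * (l.length * (1 / ε)))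
        (c := 59 * (n / √ε) + (60 + 5 * G) * (M' * (N / √ε)) + (60 + 5 * G) * (M' * Z))
        (by linarith)
      refine le_trans (le_of_eq ?_) h5
      rw [hG]
      push_cast
      ring
    · obtain ⟨f1, f2, f3⟩ := tripleAnswers_append_spec hB hβ hs hfat hε hε' hE hl hl' hlM hα' hα''
        hεs hs0 (hsκ hεK) hss (Real.sq_sqrt hε.le).le rfl
      refine ⟨_, _, emits_tripleStepC_of_lt_of_not_lt hB hε (by linarith) huw2 K E hεK hln h0 h1
        (Nat.le_add_right _ _) (Nat.le_add_left _ _), hcost _ ?_, f1, f2, f3⟩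
      have h := triple_cost_le hn' hlen0 h1s h1s
        (Nat.cast_nonneg _) (two_mul_width_two_le hs0 hs1) (two_mul_width_one_le hs0 hs1) hG0
      push Not at hln
      -- Many pairs: the failed test `l.length * √ε < n` bounds the insertion cost `n / ε` by the
      -- lookup cost.
      have h2 : (n : ℝ) * (1 / √ε) ^ 2 ≤ l.length / √ε := by
        rw [le_div_iff₀ hs0]
        calc (n : ℝ) * (1 / √ε) ^ 2 * √ε = n / √ε := by field_simp
          _ ≤ l.length := by rw [div_le_iff₀ hs0]; exact hln
      have h3 : (60 + 5 * G) * ((l.length : ℝ) / √ε) ≤ (60 + 5 * G) * (M' * (N / √ε)) := by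
        gcongr
      have h4 : 0 ≤ (60 + 5 * G) * (M' * Z) := by positivity
      have h6 : (l.length : ℝ) * (1 / √ε) = l.length / √ε := mul_one_div _ _
      rw [h6] at h
      have h5 := le_trans h
        (c := 59 * (n / √ε) + (60 + 5 * G) * (M' * (N / √ε)) + (60 + 5 * G) * (M' * Z))
        (by linarith)
      refine le_trans (le_of_eq ?_) h5
      rw [hG]
      push_cast
      ring
  · have h3 : 3 ≤ (|α'| + tripleConst s E + 3 * K) * ε := by
      push Not at hεK
      have : 0 ≤ (|α'| + tripleConst s E) * ε := by positivity
      linarith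
    refine ⟨_, _, emits_tripleStepC_of_not_lt K E hεK h0 h1, hcost _ ?_,
      fun i j k h => mem_allExtensions.2 (hl i j h.1),
      fun i j k h => ⟨(hl' i j (mem_allExtensions.1 h)).mono hα',
        nearDist_three (hB i) (hB k) dist_nonneg huw' h3,
        nearDist_three (hB j) (hB k) dist_nonneg hvw' h3⟩,
      fun x => (count_allExtensions_le hlM x).trans ?_⟩
    · push_cast
      have h4 : (l.length : ℝ) ≤ l.length / √ε := by rw [le_div_iff₀ hs0]; nlinarith
      have h5 : 0 ≤ (60 + 5 * G) * (M' * Z) := by positivity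
      have h6 : 0 ≤ (59 + 5 * G) * (M' * (N / √ε)) := by positivity
      linarith
    · have h4 : 1 ≤ 2 * ((2 * E + 1) * ((2 * E + 1) * 1)) := Nat.one_le_iff_ne_zero.2 (by positivity)
      nlinarith [Nat.mul_le_mul_left M' h4]

end NearTriangles

open RealRAM NearTriangles in
theorem mainTheorem7 (β s : ℝ) (hβ : 0 < β) (hs : 0 < s) :
    ∃ (α α' C : ℝ) (M : ℕ) (pairStep tripleStep : Cmd),
      ∀ (n : ℕ) (_ : 1 ≤ n) (B : Fin n → Pt) (_ : ∀ i, ‖B i‖ ≤ 1)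
        (a b c : Pt) (_ : IsFat β s a b c)
        (ε : ℝ) (_ : 0 < ε) (_ : ε ≤ β) (_ : ε ≤ s),
      ∃ (σ₁ σ₂ : State) (Pairs : List (Fin n × Fin n))
        (Triples : List (Fin n × Fin n × Fin n)) (t₁ t₂ : ℕ),
        -- the pair step, with its output and its running time
        Runs pairStep (input B a b c ε) σ₁ (Pairs.map encodePair) t₁ ∧
        (∀ i j, NearDist (dist a b) ε (B i) (B j) → (i, j) ∈ Pairs) ∧
        (∀ i j, (i, j) ∈ Pairs → NearDist (dist a b) (α' * ε) (B i) (B j)) ∧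
        (∀ x, Pairs.count x ≤ M) ∧
        (t₁ : ℝ) ≤ C * (n / ε + Pairs.toFinset.card) ∧
        -- the triple step, started where the pair step has halted
        Runs tripleStep σ₁ σ₂ (Triples.map encodeTriple) t₂ ∧
        (∀ i j l, NearCongruent a b c ε (B i) (B j) (B l) → (i, j, l) ∈ Triples) ∧
        (∀ i j l, (i, j, l) ∈ Triples → NearCongruent a b c (α * ε) (B i) (B j) (B l)) ∧
        (∀ x, Triples.count x ≤ M) ∧
        (t₂ : ℝ) ≤ C * ((n + Pairs.toFinset.card) / ε ^ (1 / 2 : ℝ)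
          + (n : ℝ) ^ (1 / 3 : ℝ) * (Pairs.toFinset.card : ℝ) ^ (2 / 3 : ℝ) / ε ^ (7 / 6 : ℝ)
          + Triples.toFinset.card) := by
  obtain ⟨α', C₁, M₁, c₁, hC₁, h₁⟩ := exists_pairStep hβ
  obtain ⟨α, C₂, M₂, c₂, hC₂, h₂⟩ := exists_tripleStep hβ hs α' M₁
  refine ⟨α, α', C₁ + C₂, M₁ + M₂, c₁, c₂, fun n hn B hB a b c hfat ε hε hεβ _ => ?_⟩
  -- The chain `ε ≤ β ≤ |ab| ≤ 1 / 2`.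
  have hε' : ε ≤ 1 / 2 := hεβ.trans (hfat.le_ab.trans hfat.ab_le)
  obtain ⟨σ₁, l, t₁, p1, p2, p3, p4, p5, p6, p7, p8⟩ :=
    h₁ n hn B hB a b c hfat.le_ab hfat.ab_le ε hε hε'
  obtain ⟨σ₂, l', t₂, q1, q2, q3, q4, q5⟩ :=
    h₂ n hn B hB a b c hfat ε hε hε' l σ₁ p2 p3 p4 p6 p7 (p8 [])
  refine ⟨σ₁, σ₂, l, l', t₁, t₂, p1, p2, p3, fun x => (p4 x).trans (Nat.le_add_right _ _),
    p5.trans ?_, q1, q2, q3, fun x => (q4 x).trans (Nat.le_add_left _ _), q5.trans ?_⟩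
  · gcongr
    exact le_add_of_nonneg_right hC₂
  · gcongr
    exact le_add_of_nonneg_left hC₁
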